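/- **Conventions.** For a set $S$ contained up to a null set in an open set on which $v$ has weak derivatives, $|v|_{W^{k,p}(S)}=\big\||D^kv|\big\|_{L^p(S)}$, where $|D^kv|$ is the Euclidean (Frobenius) norm of the array of all $k$-th order weak partial derivatives, and $|v|_{H^k(S)}=|v|_{W^{k,2}(S)}$. For a triangle $K\subset\mathbb R^2$ (closed, nondegenerate), $R_K$ is its circumradius, $h_K$ its diameter, and $\Pi_Kv$ the linear Lagrange interpolant of $v$ (in its continuous representative) at the vertices of $K$. Call $C_c$ a *circumradius constant* if $|v-\Pi_Kv|_{W^{1,\infty}(K)}\le C_cR_K|v|_{W^{2,\infty}(K)}$ for every triangle $K$ and every $v\in W^{2,\infty}(K)$. For $\alpha_0<\pi$ call $C_I$ a *maximum-angle constant for $\alpha_0$* if $|v-\Pi_Kv|_{H^1(K)}\le C_Ih_K|v|_{H^2(K)}$ for every triangle $K$ with all angles at most $\alpha_0$ and every $v\in H^2(K)$. **Theorem.** There is a positive circumradius constant $C_c$, and for every $\alpha_0<\pi$ there is a positive maximum-angle constant $C_I=C_I(\alpha_0)$. Moreover, for any $\alpha_0<\pi$ and any such constants $C_c$, $C_I$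 the following holds. Let $\mathcal T_h$ be a finite conforming mesh of nondegenerate closed triangles in $\mathbb R^2$, let $\Omega$ be the interior of the union of its triangles, and let $\mathcal B$ (the band) be the union of some subfamily $\mathcal T_{\mathcal B}\subset\mathcal T_h$. Suppose that every triangle of $\mathcal T_h\setminus\mathcal T_{\mathcal B}$ has all its angles at most $\alpha_0$, that every triangle of $\mathcal T_h$ has diameter at most $h$, and that every altitude of every triangle of $\mathcal T_{\mathcal B}$ is at least $\bar h>0$. Let $f\in L^2(\Omega)$ and let $u\in H^1_0(\Omega)$ be the weak solution of $-\Delta u=f$ in $\Omega$, $u=0$ on $\partial\Omega$, i.e. $\int_\Omega\nabla u\cdot\nabla v\,dx=\int_\Omega fv\,dx$ for all $v\in H^1_0(\Omega)$. Let $0<D\le1$, let $d=D$ on $\mathcal B$ and $d=1$ on $\Omega\setminus\mathcal B$, let $V_h$ be the space of continuous functions that are affine on every triangle of $\mathcal T_h$ and belong to $H^1_0(\Omega)$, and let $\tilde u_h\in V_h$ be the tempered finite element (TFEM) solution: $$\int_\Omega d\,\nabla\tilde u_h\cdot\nabla v_h\,dx=\int_\Omega f\,v_h\,dx\qquad\text{for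 all }v_h\in V_h.$$ If $u\in W^{2,\infty}(\Omega)$, then $$|u-\tilde u_h|^2_{H^1(\Omega\setminus\mathcal B)}+D|u-\tilde u_h|^2_{H^1(\mathcal B)}\le4C_I^2h^2|u|^2_{H^2(\Omega\setminus\mathcal B)}+\frac4D|\mathcal B|\,|u|^2_{W^{1,\infty}(\mathcal B)}+6D|\mathcal B|\,C_c^2\frac{h^4}{\bar h^2}|u|^2_{W^{2,\infty}(\mathcal B)} .$$ -/

import Mathlib

open MeasureTheory Filter Topology
open scoped ENNReal ContDiff

/-- The Euclidean plane. -/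
abbrev Plane : Type := EuclideanSpace ℝ (Fin 2)

/-! ## Weak derivatives and Sobolev spaces on open subsets of the plane -/

/-- The first-order derivatives `(∂₁ v, ∂₂ v)` of an `F`-valued function, normed by
`(‖∂₁ v‖² + ‖∂₂ v‖²)^(1/2)`.  For `F = ℝ` this is `Plane` (gradients); for `F = Plane` it is the
space of Hessians with the Frobenius norm. -/
abbrev Grad (F : Type) : Type := PiLp 2 (fun _ : Fin 2 => F)

/-- `φ ∈ C_c^∞(U)`. -/
def IsTestFunction (U : Set Plane) (φ : Plane → ℝ) : Prop :=
  ContDiff ℝ ∞ φ ∧ HasCompactSupport φ ∧ tsupport φ ⊆ U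

/-- `G` is the weak gradient of `v` on `U`: `∫_U v ∂ᵢφ = - ∫_U Gᵢ φ` for all `φ ∈ C_c^∞(U)`. -/
def IsWeakGrad {F : Type} [NormedAddCommGroup F] [NormedSpace ℝ F]
    (U : Set Plane) (v : Plane → F) (G : Plane → Grad F) : Prop :=
  LocallyIntegrableOn v U ∧ LocallyIntegrableOn G U ∧
    ∀ φ : Plane → ℝ, IsTestFunction U φ → ∀ i : Fin 2,
      ∫ x in U, (fderiv ℝ φ x (EuclideanSpace.single i 1)) • v x = - ∫ x in U, φ x • G x i

/-- `v` has a weak gradient on `U`. -/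
def HasWeakGrad {F : Type} [NormedAddCommGroup F] [NormedSpace ℝ F]
    (U : Set Plane) (v : Plane → F) : Prop :=
  ∃ G : Plane → Grad F, IsWeakGrad U v G

open Classical in
/-- The weak gradient of `v` on `U` (unique up to null sets of `U`; `0` if there is none). -/
noncomputable def weakGrad {F : Type} [NormedAddCommGroup F] [NormedSpace ℝ F]
    (U : Set Plane) (v : Plane → F) : Plane → Grad F :=
  if h : HasWeakGrad U v then h.choose else 0

/-- The weak Hessian of `v` on `U`. -/
noncomputable def weakHess (U : Set Plane) (v : Plane → ℝ) : Plane → Grad Plane :=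
  weakGrad U (weakGrad U v)

/-- `v ∈ W^{1,p}(U)`. -/
def MemW1 (U : Set Plane) (p : ℝ≥0∞) (v : Plane → ℝ) : Prop :=
  HasWeakGrad U v ∧ MemLp v p (volume.restrict U) ∧ MemLp (weakGrad U v) p (volume.restrict U)

/-- `v ∈ W^{2,p}(U)`. -/
def MemW2 (U : Set Plane) (p : ℝ≥0∞) (v : Plane → ℝ) : Prop :=
  MemW1 U p v ∧ HasWeakGrad U (weakGrad U v) ∧ MemLp (weakHess U v) p (volume.restrict U)

/-- The seminorm `|v|_{W^{1,p}(S)} = ‖ |∇v| ‖_{L^p(S)}`, the weak gradient being taken on the open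
set `U`, with `S ⊆ U` up to a null set.  `|v|_{H¹(S)}` is the case `p = 2`. -/
noncomputable def seminorm1 (U S : Set Plane) (p : ℝ≥0∞) (v : Plane → ℝ) : ℝ≥0∞ :=
  eLpNorm (weakGrad U v) p (volume.restrict S)

/-- The seminorm `|v|_{W^{2,p}(S)} = ‖ |D²v| ‖_{L^p(S)}`, the weak Hessian being taken on the open
set `U`, with `S ⊆ U` up to a null set.  `|v|_{H²(S)}` is the case `p = 2`. -/
noncomputable def seminorm2 (U S : Set Plane) (p : ℝ≥0∞) (v : Plane → ℝ) : ℝ≥0∞ :=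
  eLpNorm (weakHess U v) p (volume.restrict S)

/-- `v ∈ H¹₀(U)`: `v ∈ H¹(U)` is the limit in `H¹(U)` of a sequence in `C_c^∞(U)`. -/
def MemH10 (U : Set Plane) (v : Plane → ℝ) : Prop :=
  MemW1 U 2 v ∧ ∃ φ : ℕ → Plane → ℝ, (∀ n, IsTestFunction U (φ n)) ∧
    Tendsto (fun n => eLpNorm (fun x => φ n x - v x) 2 (volume.restrict U)) atTop (𝓝 0) ∧
    Tendsto (fun n => seminorm1 U U 2 (fun x => φ n x - v x)) atTop (𝓝 0)

/-- `u` is the weak solution of `-Δu = f` in `U`, `u = 0` on `∂U`. -/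
def IsWeakPoissonSolution (U : Set Plane) (f u : Plane → ℝ) : Prop :=
  MemH10 U u ∧ ∀ v : Plane → ℝ, MemH10 U v →
    ∫ x in U, inner ℝ (weakGrad U u x) (weakGrad U v x) = ∫ x in U, f x * v x

/-! ## Triangles, interpolation constants -/

/-- Every interior angle of the triangle `T` is at most `α`. -/
def AnglesLE (T : Affine.Triangle ℝ Plane) (α : ℝ) : Prop :=
  ∀ i j k : Fin 3, i ≠ j → j ≠ k → i ≠ k →
    EuclideanGeometry.angle (T.points i) (T.points j) (T.points k) ≤ α

/-- `q` is the linear Lagrange interpolant of `v` on `T`. -/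
def IsInterpolant (T : Affine.Triangle ℝ Plane) (v : Plane → ℝ) (q : Plane →ᵃ[ℝ] ℝ) : Prop :=
  ∀ i, q (T.points i) = v (T.points i)

/-- `C` is a constant for which the circumradius estimate
`|v - Π_K v|_{W^{1,∞}(K)} ≤ C R_K |v|_{W^{2,∞}(K)}` holds for every triangle `K` and every
`v ∈ W^{2,∞}(K)` (given by its representative that is continuous on the closed triangle). -/
def IsCircumradiusConstant (C : ℝ) : Prop :=
  ∀ (K : Affine.Triangle ℝ Plane) (v : Plane → ℝ) (q : Plane →ᵃ[ℝ] ℝ),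
    ContinuousOn v K.closedInterior → MemW2 (interior K.closedInterior) ∞ v →
    IsInterpolant K v q →
    seminorm1 (interior K.closedInterior) (interior K.closedInterior) ∞ (fun x => v x - q x) ≤
      ENNReal.ofReal (C * K.circumradius) *
        seminorm2 (interior K.closedInterior) (interior K.closedInterior) ∞ v

/-- `C` is a constant for which the estimate `|v - Π_K v|_{H¹(K)} ≤ C h_K |v|_{H²(K)}` holds for
every triangle `K` with all angles at most `α` and every `v ∈ H²(K)` (given by its representative
that is continuous on the closed triangle); `h_K` is the diameter of `K`. -/
def IsMaxAngleConstant (α C : ℝ) : Prop :=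
  ∀ (K : Affine.Triangle ℝ Plane) (v : Plane → ℝ) (q : Plane →ᵃ[ℝ] ℝ),
    AnglesLE K α → ContinuousOn v K.closedInterior → MemW2 (interior K.closedInterior) 2 v →
    IsInterpolant K v q →
    seminorm1 (interior K.closedInterior) (interior K.closedInterior) 2 (fun x => v x - q x) ≤
      ENNReal.ofReal (C * Metric.diam K.closedInterior) *
        seminorm2 (interior K.closedInterior) (interior K.closedInterior) 2 v

/-! ## Meshes and the tempered finite element method -/

/-- The union of the closed triangles of a finite family. -/
def region (B : Finset (Affine.Triangle ℝ Plane)) : Set Plane :=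
  ⋃ T ∈ B, T.closedInterior

/-- A conforming triangulation: finitely many nondegenerate triangles with pairwise disjoint
interiors, two of which meet exactly in the convex hull of their common vertices
(nothing, a vertex or an edge). -/
structure TriMesh where
  triangles : Finset (Affine.Triangle ℝ Plane)
  disjoint_interior : ∀ S ∈ triangles, ∀ T ∈ triangles, S ≠ T →
    Disjoint (interior S.closedInterior) (interior T.closedInterior)
  conforming : ∀ S ∈ triangles, ∀ T ∈ triangles, S ≠ T →
    S.closedInterior ∩ T.closedInterior =
      convexHull ℝ (Set.range S.points ∩ Set.range T.points)

/-- The open polygonal domain `Ω` that is triangulated by the mesh. -/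
def TriMesh.domain (M : TriMesh) : Set Plane :=
  interior (region M.triangles)

/-- `v ∈ X_h`: `v` is continuous and piecewise linear over the mesh. -/
def TriMesh.MemX (M : TriMesh) (v : Plane → ℝ) : Prop :=
  ContinuousOn v (region M.triangles) ∧
    ∀ T ∈ M.triangles, ∃ q : Plane →ᵃ[ℝ] ℝ, ∀ x ∈ T.closedInterior, v x = q x

/-- `v ∈ V_h = X_h ∩ H¹₀(Ω)`. -/
def TriMesh.MemV (M : TriMesh) (v : Plane → ℝ) : Prop :=
  M.MemX v ∧ MemH10 M.domain v

open Classical in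
/-- The tempered diffusion coefficient: `D` on the band, `1` elsewhere. -/
noncomputable def temperedCoeff (B : Finset (Affine.Triangle ℝ Plane)) (D : ℝ) (x : Plane) : ℝ :=
  if x ∈ region B then D else 1

/-- `w` is the TFEM solution: `w ∈ V_h` and `∫_Ω d ∇w·∇v = ∫_Ω f v` for all `v ∈ V_h`, where `d` is
the diffusion coefficient reduced to `D` on the band `B`. -/
def TriMesh.IsTFEMSolution (M : TriMesh) (B : Finset (Affine.Triangle ℝ Plane)) (D : ℝ)
    (f w : Plane → ℝ) : Prop :=
  M.MemV w ∧ ∀ v : Plane → ℝ, M.MemV v →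
    ∫ x in M.domain,
        temperedCoeff B D x * inner ℝ (weakGrad M.domain w x) (weakGrad M.domain v x) =
      ∫ x in M.domain, f x * v x

/-!
The proof rests on two facts: interpolation on a triangle is stable in every shape that has one
good angle, and the tempered problem is a perturbation of the Poisson problem that is visible only
on the band.

**Interpolation constants.** Let `q` interpolate `v` at the vertices of a triangle with corner `A`
and sides `b`, `c`. The derivative of the error along `b` has mean value zero on the edge from `A`
to `A + b`, and its derivatives along chords of the triangle are bounded by `h_K ‖b‖ |D²v|`. A
function with mean zero on an edge satisfies a Poincaré inequality in terms of the derivatives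
along chords, with an absolute constant (`integral_sq_le_of_mean_edge_eq_zero`): in Duffy
coordinates, which collapse the opposite vertex, this is a computation on the unit square that
does not see the shape of the triangle. The same holds for `c`, and a vector is recovered from its
components along `b` and `c` at the cost of `1 / sin θ`, where `θ` is the angle at `A`
(`norm_le_inv_sin_mul`). Sobolev functions are reached from smooth ones by mollifying on slightly
shrunk triangles and applying Fatou's lemma (`seminorm1_sub_interpolant_le`). If `A` is chosen
opposite to the longest side, then `h_K / sin θ = 2 R_K` gives the circumradius constant. Since
some angle is at least `π / 3`, one may also take `θ ∈ [π / 3, α₀]`, which gives the maximum-angle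
constant.

**The discrete comparison function.** Extended by zero, the solution `u` has the extension of its
weak gradient by zero as weak gradient on the whole plane, because it is a limit of test functions
(`MemH10.isWeakGrad_indicator`). This gradient is bounded, so `u` has a Lipschitz representative
`g` on the plane that vanishes off `Ω` (`MemH10.exists_lipschitz`). A vertex of the mesh that
carries a hat function not vanishing at some point off `Ω` lies off `Ω` itself, because the mesh
is conforming (`TriMesh.vertex_notMem_domain`), so the nodal interpolant of `g` vanishes off `Ω`,
and a Lipschitz function which vanishes off `Ω`, and whose gradient vanishes a.e. on its zero set,
is in `H¹₀(Ω)` (`LipschitzWith.memH10`). Hence the interpolant is in `V_h`.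

**The energy estimate.** With `e` the error, `η` the interpolation error and `G = ∇u`, testing
both equations with the difference of the interpolant and the discrete solution gives
`∫ d ∇e · (∇e - ∇η) = -∫ (1 - d) G · (∇e - ∇η)`, the right side living on the band. Young's
inequality, in pointwise form `energy_pointwise`, gives `energy_le`. Off the band, `η` is
controlled by the maximum-angle constant; on the band by the circumradius constant together with
`R_K ≤ h² / (2 hbar)` (`circumradius_le_of_height`).
-/

/-! ### Weak gradients -/

section WeakGradients

variable {F : Type} [NormedAddCommGroup F] [NormedSpace ℝ F] {U V : Set Plane}

theorem MeasureTheory.LocallyIntegrableOn.congr_ae {E : Type*} [NormedAddCommGroup E]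
    {f g : Plane → E} (h : LocallyIntegrableOn f U) (hfg : f =ᵐ[volume.restrict U] g) :
    LocallyIntegrableOn g U := by
  intro x hx
  obtain ⟨t, ht, hft⟩ := h x hx
  refine ⟨t ∩ U, inter_mem ht self_mem_nhdsWithin, ?_⟩
  refine (hft.mono_set Set.inter_subset_left).congr ?_
  exact ae_mono (Measure.restrict_mono Set.inter_subset_right le_rfl) hfg

theorem MeasureTheory.MemLp.locallyIntegrableOn_restrict {E : Type*} [NormedAddCommGroup E]
    {f : Plane → E} {p : ℝ≥0∞} (hp : 1 ≤ p) (h : MemLp f p (volume.restrict U)) :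
    LocallyIntegrableOn f U :=
  locallyIntegrableOn_of_locallyIntegrable_restrict (h.locallyIntegrable hp)

theorem integrableOn_smul_of_tsupport_subset {ψ : Plane → ℝ} {g : Plane → F}
    (hψ : Continuous ψ) (hc : HasCompactSupport ψ) (hs : tsupport ψ ⊆ U)
    (hg : LocallyIntegrableOn g U) : IntegrableOn (fun x => ψ x • g x) U := by
  have h1 : IntegrableOn g (tsupport ψ) := hg.integrableOn_compact_subset hs hc
  have h2 : IntegrableOn (fun x => ψ x • g x) (tsupport ψ) :=
    h1.continuousOn_smul hψ.continuousOn hc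
  have h3 : Integrable (fun x => ψ x • g x) := by
    rw [← integrableOn_iff_integrable_of_support_subset (s := tsupport ψ)]
    · exact h2
    · intro x hx
      apply subset_tsupport
      intro h0
      exact hx (by simp [h0])
  exact h3.integrableOn

theorem IsTestFunction.continuous_partial {φ : Plane → ℝ} (h : IsTestFunction U φ) (e : Plane) :
    Continuous (fun x => fderiv ℝ φ x e) :=
  (h.1.continuous_fderiv (by simp)).clm_apply continuous_const

theorem tsupport_partial_subset (φ : Plane → ℝ) (e : Plane) :
    tsupport (fun x => fderiv ℝ φ x e) ⊆ tsupport φ := by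
  refine closure_minimal ?_ (isClosed_tsupport φ)
  intro x hx
  by_contra h
  apply hx
  have : fderiv ℝ φ x = 0 := by
    by_contra h'
    exact h (support_fderiv_subset ℝ h')
  simp [this]

theorem IsTestFunction.mono {φ : Plane → ℝ} (h : IsTestFunction V φ) (hVU : V ⊆ U) :
    IsTestFunction U φ := ⟨h.1, h.2.1, h.2.2.trans hVU⟩

theorem IsTestFunction.integrableOn_smul {φ : Plane → ℝ} (h : IsTestFunction U φ) {g : Plane → F}
    (hg : LocallyIntegrableOn g U) : IntegrableOn (fun x => φ x • g x) U :=
  integrableOn_smul_of_tsupport_subset h.1.continuous h.2.1 h.2.2 hg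

theorem IsTestFunction.integrableOn_partial_smul {φ : Plane → ℝ} (h : IsTestFunction U φ)
    {g : Plane → F} (hg : LocallyIntegrableOn g U) (e : Plane) :
    IntegrableOn (fun x => fderiv ℝ φ x e • g x) U :=
  integrableOn_smul_of_tsupport_subset (h.continuous_partial e)
    (h.2.1.of_isClosed_subset (isClosed_tsupport _) (tsupport_partial_subset φ e))
    ((tsupport_partial_subset φ e).trans h.2.2) hg

theorem MeasureTheory.LocallyIntegrableOn.grad_apply {G : Plane → Grad F}
    (h : LocallyIntegrableOn G U) (i : Fin 2) : LocallyIntegrableOn (fun x => G x i) U := by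
  intro x hx
  obtain ⟨t, ht, hft⟩ := h x hx
  exact ⟨t, ht, (PiLp.proj 2 (fun _ : Fin 2 => F) i : Grad F →L[ℝ] F).integrable_comp hft⟩

theorem IsWeakGrad.ae_eq [CompleteSpace F] (hU : IsOpen U) {v : Plane → F} {G G' : Plane → Grad F}
    (h : IsWeakGrad U v G) (h' : IsWeakGrad U v G') : G =ᵐ[volume.restrict U] G' := by
  have key : ∀ i : Fin 2, ∀ᵐ x, x ∈ U → G x i - G' x i = 0 := by
    intro i
    refine hU.ae_eq_zero_of_integral_contDiff_smul_eq_zero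
      ((h.2.1.grad_apply i).sub (h'.2.1.grad_apply i)) ?_
    intro φ h1 h2 h3
    have ht : IsTestFunction U φ := ⟨h1, h2, h3⟩
    have e1 := h.2.2 φ ht i
    have e2 := h'.2.2 φ ht i
    have e3 : ∫ x, φ x • (G x i - G' x i) = ∫ x in U, φ x • (G x i - G' x i) := by
      rw [setIntegral_eq_integral_of_forall_compl_eq_zero]
      intro x hx
      have : φ x = 0 := image_eq_zero_of_notMem_tsupport fun h => hx (h3 h)
      simp [this]
    refine e3.trans ?_
    simp_rw [smul_sub]
    rw [integral_sub (ht.integrableOn_smul (h.2.1.grad_apply i))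
      (ht.integrableOn_smul (h'.2.1.grad_apply i))]
    rw [e1] at e2
    rw [sub_eq_zero]
    exact neg_inj.mp e2
  rw [EventuallyEq, ae_restrict_iff' hU.measurableSet]
  filter_upwards [key 0, key 1] with x h0 h1 hx
  ext i
  fin_cases i
  · exact sub_eq_zero.mp (h0 hx)
  · exact sub_eq_zero.mp (h1 hx)

theorem IsWeakGrad.congr {v v' : Plane → F} {G G' : Plane → Grad F}
    (h : IsWeakGrad U v G) (hv : v =ᵐ[volume.restrict U] v') (hG : G =ᵐ[volume.restrict U] G') :
    IsWeakGrad U v' G' := by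
  refine ⟨h.1.congr_ae hv, h.2.1.congr_ae hG, fun φ hφ i => ?_⟩
  have e1 : ∫ x in U, (fderiv ℝ φ x (EuclideanSpace.single i 1)) • v' x =
      ∫ x in U, (fderiv ℝ φ x (EuclideanSpace.single i 1)) • v x :=
    integral_congr_ae (by filter_upwards [hv] with x hx; simp [hx])
  have e2 : ∫ x in U, φ x • G' x i = ∫ x in U, φ x • G x i :=
    integral_congr_ae (by filter_upwards [hG] with x hx; simp [hx])
  rw [e1, e2]
  exact h.2.2 φ hφ i

theorem IsWeakGrad.mono {v : Plane → F} {G : Plane → Grad F} (h : IsWeakGrad U v G)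
    (hU : IsOpen U) (hVU : V ⊆ U) : IsWeakGrad V v G := by
  refine ⟨h.1.mono_set hVU, h.2.1.mono_set hVU, fun φ hφ i => ?_⟩
  have e1 : ∫ x in U, (fderiv ℝ φ x (EuclideanSpace.single i 1)) • v x =
      ∫ x in V, (fderiv ℝ φ x (EuclideanSpace.single i 1)) • v x := by
    refine setIntegral_eq_of_subset_of_forall_sdiff_eq_zero hU.measurableSet hVU ?_
    intro x hx
    have : fderiv ℝ φ x (EuclideanSpace.single i 1) = 0 :=
      image_eq_zero_of_notMem_tsupport (f := fun x => fderiv ℝ φ x (EuclideanSpace.single i 1))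
        fun h => hx.2 (hφ.2.2 (tsupport_partial_subset φ _ h))
    simp [this]
  have e2 : ∫ x in U, φ x • G x i = ∫ x in V, φ x • G x i := by
    refine setIntegral_eq_of_subset_of_forall_sdiff_eq_zero hU.measurableSet hVU ?_
    intro x hx
    have : φ x = 0 := image_eq_zero_of_notMem_tsupport fun h => hx.2 (hφ.2.2 h)
    simp [this]
  rw [← e1, ← e2]
  exact h.2.2 φ (hφ.mono hVU) i

theorem IsWeakGrad.sub {v v' : Plane → F} {G G' : Plane → Grad F}
    (h : IsWeakGrad U v G) (h' : IsWeakGrad U v' G') :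
    IsWeakGrad U (fun x => v x - v' x) (fun x => G x - G' x) := by
  refine ⟨h.1.sub h'.1, h.2.1.sub h'.2.1, fun φ hφ i => ?_⟩
  simp_rw [PiLp.sub_apply, smul_sub]
  rw [integral_sub (hφ.integrableOn_partial_smul h.1 _) (hφ.integrableOn_partial_smul h'.1 _),
    integral_sub (hφ.integrableOn_smul (h.2.1.grad_apply i))
      (hφ.integrableOn_smul (h'.2.1.grad_apply i)), h.2.2 φ hφ i, h'.2.2 φ hφ i]
  abel

theorem HasWeakGrad.isWeakGrad {v : Plane → F} (h : HasWeakGrad U v) :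
    IsWeakGrad U v (weakGrad U v) := by
  rw [weakGrad, dif_pos h]
  exact h.choose_spec

theorem IsWeakGrad.hasWeakGrad {v : Plane → F} {G : Plane → Grad F} (h : IsWeakGrad U v G) :
    HasWeakGrad U v := ⟨G, h⟩

theorem IsWeakGrad.weakGrad_ae_eq [CompleteSpace F] (hU : IsOpen U) {v : Plane → F}
    {G : Plane → Grad F} (h : IsWeakGrad U v G) : weakGrad U v =ᵐ[volume.restrict U] G :=
  h.hasWeakGrad.isWeakGrad.ae_eq hU h

/-- The gradient read off from the Fréchet derivative (zero where the function is not
differentiable). -/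
noncomputable def classicalGrad (v : Plane → ℝ) (x : Plane) : Grad ℝ :=
  WithLp.toLp 2 fun i => fderiv ℝ v x (EuclideanSpace.single i 1)

theorem classicalGrad_apply (v : Plane → ℝ) (x : Plane) (i : Fin 2) :
    classicalGrad v x i = fderiv ℝ v x (EuclideanSpace.single i 1) := rfl

theorem plane_eq_sum_single (d : Plane) :
    d = d 0 • EuclideanSpace.single (0 : Fin 2) (1 : ℝ) +
      d 1 • EuclideanSpace.single 1 (1 : ℝ) := by
  ext i
  fin_cases i <;> simp

theorem inner_classicalGrad (v : Plane → ℝ) (x d : Plane) :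
    inner ℝ (classicalGrad v x) d = fderiv ℝ v x d := by
  conv_rhs => rw [plane_eq_sum_single d]
  rw [map_add, map_smul, map_smul, PiLp.inner_apply, Fin.sum_univ_two]
  simp [classicalGrad_apply]

theorem norm_classicalGrad_le (v : Plane → ℝ) (x : Plane) :
    ‖classicalGrad v x‖ ≤ ‖fderiv ℝ v x‖ := by
  have h := inner_classicalGrad v x (classicalGrad v x)
  rw [real_inner_self_eq_norm_sq] at h
  have h2 : ‖classicalGrad v x‖ ^ 2 ≤ ‖fderiv ℝ v x‖ * ‖classicalGrad v x‖ := by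
    rw [h]
    exact (le_abs_self _).trans ((fderiv ℝ v x).le_opNorm _)
  by_contra! hlt
  have hp : 0 < ‖classicalGrad v x‖ := lt_of_le_of_lt (norm_nonneg _) hlt
  nlinarith

theorem measurable_classicalGrad (v : Plane → ℝ) : Measurable (classicalGrad v) := by
  have h : Measurable fun x => fun i => fderiv ℝ v x (EuclideanSpace.single i (1 : ℝ)) :=
    measurable_pi_lambda _ fun i => measurable_fderiv_apply_const ℝ v _
  exact (WithLp.measurable_toLp 2 _).comp h

theorem LipschitzWith.norm_classicalGrad_le {v : Plane → ℝ} {C : NNReal} (h : LipschitzWith C v)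
    (x : Plane) : ‖classicalGrad v x‖ ≤ C :=
  (_root_.norm_classicalGrad_le v x).trans (norm_fderiv_le_of_lipschitz ℝ h)

/-- By Rademacher's theorem a Lipschitz function has its a.e. gradient as weak gradient. -/
theorem LipschitzWith.isWeakGrad {v : Plane → ℝ} {C : NNReal} (h : LipschitzWith C v) :
    IsWeakGrad U v (classicalGrad v) := by
  suffices H : IsWeakGrad Set.univ v (classicalGrad v) from
    H.mono isOpen_univ (Set.subset_univ U)
  refine ⟨(h.continuous.locallyIntegrable).locallyIntegrableOn _, ?_, ?_⟩
  · have : MemLp (classicalGrad v) ∞ (volume.restrict (Set.univ : Set Plane)) :=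
      memLp_top_of_bound (measurable_classicalGrad v).aestronglyMeasurable C
        (ae_of_all _ h.norm_classicalGrad_le)
    exact this.locallyIntegrableOn_restrict (by simp)
  · intro φ hφ i
    rw [setIntegral_univ, setIntegral_univ]
    obtain ⟨D, hD⟩ := hφ.1.lipschitzWith_of_hasCompactSupport hφ.2.1 (by simp)
    have key := h.integral_lineDeriv_mul_eq (μ := volume) hD hφ.2.1
      (EuclideanSpace.single i (1 : ℝ))
    have e1 : ∫ x, φ x • classicalGrad v x i =
        ∫ x, lineDeriv ℝ v x (EuclideanSpace.single i 1) * φ x := by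
      refine integral_congr_ae ?_
      filter_upwards [h.ae_differentiableAt] with x hx
      rw [hx.lineDeriv_eq_fderiv, classicalGrad_apply, smul_eq_mul, mul_comm]
    rw [e1, key, ← integral_neg]
    refine integral_congr_ae (ae_of_all _ fun x => ?_)
    have hd : DifferentiableAt ℝ φ x := (hφ.1.differentiable (by simp)).differentiableAt
    simp only [hd.lineDeriv_eq_fderiv, map_neg, smul_eq_mul]
    ring

theorem AffineMap.exists_lipschitzWith (q : Plane →ᵃ[ℝ] ℝ) : ∃ C, LipschitzWith C q := by
  refine ⟨‖q.linear.toContinuousLinearMap‖₊, LipschitzWith.of_dist_le_mul fun x y => ?_⟩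
  rw [dist_eq_norm, dist_eq_norm]
  have : q x - q y = q.linear.toContinuousLinearMap (x - y) := by
    simpa using (q.linearMap_vsub x y).symm
  rw [this]
  exact ContinuousLinearMap.le_opNorm _ _

theorem AffineMap.hasFDerivAt (q : Plane →ᵃ[ℝ] ℝ) (x : Plane) :
    HasFDerivAt q q.linear.toContinuousLinearMap x := by
  have h : (q : Plane → ℝ) = fun y => q.linear.toContinuousLinearMap y + q 0 := by
    ext y
    have := q.decomp
    rw [this]
    simp
  rw [h]
  exact (q.linear.toContinuousLinearMap.hasFDerivAt).add_const _

/-- The constant gradient of an affine function. -/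
noncomputable def AffineMap.grad (q : Plane →ᵃ[ℝ] ℝ) : Grad ℝ :=
  WithLp.toLp 2 fun i => q.linear (EuclideanSpace.single i 1)

theorem AffineMap.classicalGrad_eq (q : Plane →ᵃ[ℝ] ℝ) (x : Plane) :
    classicalGrad q x = q.grad := by
  ext i
  rw [classicalGrad_apply, (q.hasFDerivAt x).fderiv]
  rfl

theorem AffineMap.isWeakGrad (q : Plane →ᵃ[ℝ] ℝ) :
    IsWeakGrad U q (fun _ => q.grad) := by
  obtain ⟨C, hC⟩ := q.exists_lipschitzWith
  have := hC.isWeakGrad (U := U)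
  rwa [show classicalGrad q = fun _ => q.grad from funext q.classicalGrad_eq] at this

theorem AffineMap.inner_grad (q : Plane →ᵃ[ℝ] ℝ) (d : Plane) : inner ℝ q.grad d = q.linear d := by
  rw [← q.classicalGrad_eq 0, inner_classicalGrad, (q.hasFDerivAt 0).fderiv]
  rfl

theorem IsTestFunction.isWeakGrad {φ : Plane → ℝ} (hφ : IsTestFunction V φ) :
    IsWeakGrad U φ (classicalGrad φ) := by
  obtain ⟨D, hD⟩ := hφ.1.lipschitzWith_of_hasCompactSupport hφ.2.1 (by simp)
  exact hD.isWeakGrad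

end WeakGradients

/-! ### Mollification -/

section Mollification

open ContinuousLinearMap

variable {F : Type} [NormedAddCommGroup F] [NormedSpace ℝ F] {U V : Set Plane}

/-- A smooth bump at the origin of the plane, supported in the ball of radius `1 / (n + 1)`. -/
noncomputable def planeBump (n : ℕ) : ContDiffBump (0 : Plane) where
  rIn := 1 / (n + 1 : ℝ) / 2
  rOut := 1 / (n + 1 : ℝ)
  rIn_pos := by positivity
  rIn_lt_rOut := half_lt_self (by positivity)

theorem tendsto_planeBump_rOut : Tendsto (fun n => (planeBump n).rOut) atTop (𝓝 0) :=
  tendsto_one_div_add_atTop_nhds_zero_nat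

/-- The mollification of `g` at scale `1 / (n + 1)`. -/
noncomputable def mollify (n : ℕ) (g : Plane → F) : Plane → F :=
  convolution ((planeBump n).normed volume) g (lsmul ℝ ℝ) volume

theorem mollify_apply (n : ℕ) (g : Plane → F) (x : Plane) :
    mollify n g x = ∫ y, (planeBump n).normed volume y • g (x - y) := rfl

theorem mollify_apply_swap (n : ℕ) (g : Plane → F) (x : Plane) :
    mollify n g x = ∫ y, (planeBump n).normed volume (x - y) • g y := by
  rw [mollify, convolution_eq_swap]
  rfl

theorem contDiff_mollify (n : ℕ) [CompleteSpace F] {g : Plane → F} (hg : LocallyIntegrable g) :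
    ContDiff ℝ ∞ (mollify n g) :=
  (planeBump n).hasCompactSupport_normed.contDiff_convolution_left _
    (planeBump n).contDiff_normed hg

theorem ae_tendsto_mollify [CompleteSpace F] {g : Plane → F} (hg : LocallyIntegrable g) :
    ∀ᵐ x, Tendsto (fun n => mollify n g x) atTop (𝓝 (g x)) := by
  refine ContDiffBump.ae_convolution_tendsto_right_of_locallyIntegrable (K := 2)
    tendsto_planeBump_rOut (Eventually.of_forall fun n => ?_) hg
  simp only [planeBump]
  linarith

theorem tendsto_mollify_of_continuousAt [CompleteSpace F] {g : Plane → F} {x : Plane}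
    (hg : AEStronglyMeasurable g) (hx : ContinuousAt g x) :
    Tendsto (fun n => mollify n g x) atTop (𝓝 (g x)) :=
  ContDiffBump.convolution_tendsto_right tendsto_planeBump_rOut (Eventually.of_forall fun _ => hg)
    (hx.tendsto.comp tendsto_snd) tendsto_const_nhds

theorem quasiMeasurePreserving_const_sub (x : Plane) :
    Measure.QuasiMeasurePreserving (fun y : Plane => x - y) volume volume :=
  (Measure.measurePreserving_sub_left volume x).quasiMeasurePreserving

theorem enorm_mollify_le (n : ℕ) (g : Plane → F) (x : Plane) :
    ‖mollify n g x‖ₑ ≤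
      ∫⁻ y, ENNReal.ofReal ((planeBump n).normed volume y) * ‖g (x - y)‖ₑ := by
  rw [mollify_apply]
  refine (enorm_integral_le_lintegral_enorm _).trans_eq ?_
  refine lintegral_congr fun y => ?_
  rw [enorm_smul, Real.enorm_of_nonneg ((planeBump n).nonneg_normed y)]

theorem lintegral_planeBump (n : ℕ) :
    ∫⁻ y, ENNReal.ofReal ((planeBump n).normed volume y) = 1 := by
  rw [← ofReal_integral_eq_lintegral_ofReal (planeBump n).integrable_normed
    (ae_of_all _ (planeBump n).nonneg_normed), (planeBump n).integral_normed, ENNReal.ofReal_one]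

theorem enorm_mollify_le_of_ae (n : ℕ) {g : Plane → F} {M : ℝ≥0∞} (h : ∀ᵐ x, ‖g x‖ₑ ≤ M)
    (x : Plane) : ‖mollify n g x‖ₑ ≤ M := by
  refine (enorm_mollify_le n g x).trans ?_
  calc ∫⁻ y, ENNReal.ofReal ((planeBump n).normed volume y) * ‖g (x - y)‖ₑ
      ≤ ∫⁻ y, ENNReal.ofReal ((planeBump n).normed volume y) * M := by
        refine lintegral_mono_ae ?_
        filter_upwards [(quasiMeasurePreserving_const_sub x).ae h] with y hy
        gcongr
    _ = M := by
        rw [lintegral_mul_const _ (planeBump n).continuous_normed.measurable.ennreal_ofReal,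
          lintegral_planeBump, one_mul]

theorem eLpNorm_top_mollify_le (n : ℕ) (g : Plane → F) :
    eLpNorm (mollify n g) ∞ volume ≤ eLpNorm g ∞ volume := by
  rw [eLpNorm_exponent_top, eLpNorm_exponent_top]
  exact essSup_le_of_ae_le _ (ae_of_all _
    (enorm_mollify_le_of_ae n (ae_le_eLpNormEssSup (f := g) (μ := volume))))

theorem lintegral_sq_mollify_le (n : ℕ) {g : Plane → F} (hg : AEStronglyMeasurable g) :
    ∫⁻ x, ‖mollify n g x‖ₑ ^ 2 ≤ ∫⁻ x, ‖g x‖ₑ ^ 2 := by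
  set ρ : Plane → ℝ≥0∞ := fun y => ENNReal.ofReal ((planeBump n).normed volume y) with hρ
  have hρm : Measurable ρ := (planeBump n).continuous_normed.measurable.ennreal_ofReal
  have hρ1 : ∫⁻ y, ρ y = 1 := lintegral_planeBump n
  -- Jensen's inequality for the probability density `ρ`
  have hJ : ∀ x, ‖mollify n g x‖ₑ ^ 2 ≤ ∫⁻ y, ρ y * ‖g (x - y)‖ₑ ^ 2 := by
    intro x
    have hgx : AEMeasurable (fun y => ‖g (x - y)‖ₑ) :=
      (hg.comp_quasiMeasurePreserving (quasiMeasurePreserving_const_sub x)).enorm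
    have hs : ∀ y, ρ y ^ (1 / 2 : ℝ) * ρ y ^ (1 / 2 : ℝ) = ρ y := fun y => by
      rw [← ENNReal.rpow_add_of_nonneg _ _ (by norm_num) (by norm_num)]
      norm_num
    have h2 : ∀ a : ℝ≥0∞, (a ^ (1 / 2 : ℝ)) ^ (2 : ℝ) = a := fun a => by
      rw [← ENNReal.rpow_mul]; norm_num
    have hH := ENNReal.lintegral_mul_le_Lp_mul_Lq volume Real.HolderConjugate.two_two
      (f := fun y => ρ y ^ (1 / 2 : ℝ)) (g := fun y => ρ y ^ (1 / 2 : ℝ) * ‖g (x - y)‖ₑ)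
      (hρm.pow_const _).aemeasurable ((hρm.pow_const _).aemeasurable.mul hgx)
    have e1 : ∀ y, ((fun y => ρ y ^ (1 / 2 : ℝ)) * fun y => ρ y ^ (1 / 2 : ℝ) * ‖g (x - y)‖ₑ) y =
        ρ y * ‖g (x - y)‖ₑ := fun y => by
      simp only [Pi.mul_apply]
      rw [← mul_assoc, hs]
    have e2 : ∀ y, (ρ y ^ (1 / 2 : ℝ) * ‖g (x - y)‖ₑ) ^ (2 : ℝ) = ρ y * ‖g (x - y)‖ₑ ^ 2 :=
      fun y => by
        rw [ENNReal.mul_rpow_of_nonneg _ _ (by norm_num), h2]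
        norm_num
    simp only [e1, e2, h2, hρ1, ENNReal.one_rpow, one_mul] at hH
    calc ‖mollify n g x‖ₑ ^ 2 ≤ ((∫⁻ y, ρ y * ‖g (x - y)‖ₑ ^ 2) ^ (1 / 2 : ℝ)) ^ 2 := by
          gcongr
          exact (enorm_mollify_le n g x).trans hH
      _ = _ := by
          rw [← ENNReal.rpow_natCast]
          exact h2 _
  have hprod : AEMeasurable (Function.uncurry fun x y : Plane => ρ y * ‖g (x - y)‖ₑ ^ 2)
      (volume.prod volume) := by
    refine (hρm.comp measurable_snd).aemeasurable.mul ?_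
    exact ((hg.comp_quasiMeasurePreserving
      (quasiMeasurePreserving_sub_of_right_invariant volume volume)).enorm).pow_const 2
  calc ∫⁻ x, ‖mollify n g x‖ₑ ^ 2 ≤ ∫⁻ x, ∫⁻ y, ρ y * ‖g (x - y)‖ₑ ^ 2 := lintegral_mono hJ
    _ = ∫⁻ y, ∫⁻ x, ρ y * ‖g (x - y)‖ₑ ^ 2 := lintegral_lintegral_swap hprod
    _ = ∫⁻ y, ρ y * ∫⁻ x, ‖g x‖ₑ ^ 2 := by
        refine lintegral_congr fun y => ?_
        rw [lintegral_const_mul' _ _ ENNReal.ofReal_ne_top,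
          lintegral_sub_right_eq_self (fun x => ‖g x‖ₑ ^ 2) y]
    _ = _ := by rw [lintegral_mul_const _ hρm, hρ1, one_mul]

theorem eLpNorm_two_sq {E : Type*} [NormedAddCommGroup E] {α : Type*} [MeasurableSpace α]
    (f : α → E) (μ : Measure α) : eLpNorm f 2 μ ^ 2 = ∫⁻ x, ‖f x‖ₑ ^ 2 ∂μ := by
  simpa using eLpNorm_nnreal_pow_eq_lintegral (f := f) (μ := μ) (p := 2) (by norm_num)

/-- Mollification does not increase the `L²` norm nor the `L^∞` norm. -/
theorem eLpNorm_mollify_le (n : ℕ) {p : ℝ≥0∞} (hp : p = 2 ∨ p = (∞ : ℝ≥0∞)) {g : Plane → F}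
    (hg : AEStronglyMeasurable g) : eLpNorm (mollify n g) p volume ≤ eLpNorm g p volume := by
  rcases hp with rfl | rfl
  · rw [← ENNReal.pow_le_pow_left_iff two_ne_zero, eLpNorm_two_sq, eLpNorm_two_sq]
    exact lintegral_sq_mollify_le n hg
  · exact eLpNorm_top_mollify_le n g

theorem support_mollify_subset (n : ℕ) (g : Plane → F) :
    Function.support (mollify n g) ⊆ Metric.cthickening (1 / (n + 1 : ℝ)) (tsupport g) := by
  intro x hx
  by_contra hc
  apply hx
  rw [mollify_apply_swap]
  refine integral_eq_zero_of_ae (ae_of_all _ fun y => ?_)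
  by_cases hy : y ∈ tsupport g
  · have : (planeBump n).normed volume (x - y) = 0 := by
      by_contra h0
      have h1 : x - y ∈ Function.support ((planeBump n).normed volume) := h0
      rw [(planeBump n).support_normed_eq, mem_ball_zero_iff, ← dist_eq_norm] at h1
      exact hc (Metric.mem_cthickening_of_dist_le x y _ _ hy h1.le)
    simp [this]
  · simp [image_eq_zero_of_notMem_tsupport hy]

/-- At distance more than the mollification radius from the complement of `U`, differentiation
commutes with mollification. -/
theorem fderiv_mollify [CompleteSpace F] {v : Plane → F} {G : Plane → Grad F}
    (hU : IsOpen U) (h : IsWeakGrad U v G) (hv : IntegrableOn v U) (hG : IntegrableOn G U) {n : ℕ}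
    {x : Plane} (hx : Metric.closedBall x (1 / (n + 1 : ℝ)) ⊆ U) (i : Fin 2) :
    fderiv ℝ (mollify n (U.indicator v)) x (EuclideanSpace.single i 1) =
      mollify n (U.indicator G) x i := by
  set ρ := (planeBump n).normed (volume : Measure Plane) with hρ
  have hρs : ContDiff ℝ ∞ ρ := (planeBump n).contDiff_normed
  have hρc : HasCompactSupport ρ := (planeBump n).hasCompactSupport_normed
  have hvi : Integrable (U.indicator v) := hv.integrable_indicator hU.measurableSet
  have hGi : Integrable (U.indicator G) := hG.integrable_indicator hU.measurableSet
  have hd := hρc.hasFDerivAt_convolution_left (lsmul ℝ ℝ : ℝ →L[ℝ] F →L[ℝ] F)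
    (hρs.of_le (by simp)) hvi.locallyIntegrable x
  have hd' : fderiv ℝ (mollify n (U.indicator v)) x =
    (convolution (fderiv ℝ ρ) (U.indicator v) ((lsmul ℝ ℝ).precompL Plane) volume) x := hd.fderiv
  have hex : ConvolutionExistsAt (fderiv ℝ ρ) (U.indicator v) x
      ((lsmul ℝ ℝ : ℝ →L[ℝ] F →L[ℝ] F).precompL Plane) volume :=
    (hρc.fderiv ℝ).convolutionExists_left _ (hρs.continuous_fderiv (by simp))
      hvi.locallyIntegrable x
  rw [hd', convolution_def, ContinuousLinearMap.integral_apply hex]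
  simp only [precompL_apply, lsmul_apply]
  -- the test function that the weak derivative is tested with
  set φ : Plane → ℝ := fun y => ρ (x - y) with hφ
  have hφd : ∀ y, fderiv ℝ φ y (EuclideanSpace.single i 1) =
      - fderiv ℝ ρ (x - y) (EuclideanSpace.single i 1) := fun y => by
    have h1 : HasFDerivAt ρ (fderiv ℝ ρ (x - y)) (x - y) :=
      (hρs.differentiable (by simp) _).hasFDerivAt
    have h2 : HasFDerivAt (fun y : Plane => x - y) (-ContinuousLinearMap.id ℝ Plane) y :=
      (hasFDerivAt_id y).const_sub x
    have h3 : HasFDerivAt φ _ y := h1.comp y h2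
    rw [h3.fderiv]
    simp
  have htest : IsTestFunction U φ := by
    have hs : tsupport φ ⊆ Metric.closedBall x (1 / (n + 1 : ℝ)) := by
      refine closure_minimal (fun y hy => ?_) Metric.isClosed_closedBall
      have h1 : x - y ∈ Function.support ((planeBump n).normed volume) := hy
      rw [(planeBump n).support_normed_eq, mem_ball_zero_iff, ← dist_eq_norm, dist_comm] at h1
      exact Metric.ball_subset_closedBall h1
    exact ⟨hρs.comp (contDiff_const.sub contDiff_id),
      (isCompact_closedBall x _).of_isClosed_subset (isClosed_tsupport φ) hs, hs.trans hx⟩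
  have key := h.2.2 φ htest i
  have e1 : ∫ t, (fderiv ℝ ρ t) (EuclideanSpace.single i 1) • U.indicator v (x - t) =
      - ∫ y in U, (fderiv ℝ φ y (EuclideanSpace.single i 1)) • v y := by
    rw [← integral_sub_left_eq_self _ volume x, ← integral_neg,
      ← integral_indicator hU.measurableSet]
    refine integral_congr_ae (ae_of_all _ fun y => ?_)
    by_cases hy : y ∈ U <;> simp [hy, hφd]
  have e2 : mollify n (U.indicator G) x i = ∫ y in U, φ y • G y i := by
    rw [mollify_apply_swap]
    have hint : Integrable (fun y => ρ (x - y) • U.indicator G y) := by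
      have := htest.integrableOn_smul h.2.1
      rw [← integrable_indicator_iff hU.measurableSet] at this
      refine this.congr (ae_of_all _ fun y => ?_)
      by_cases hy : y ∈ U <;> simp [hy, hφ]
    have := (PiLp.proj 2 (fun _ : Fin 2 => F) i : Grad F →L[ℝ] F).integral_comp_comm hint
    rw [← integral_indicator hU.measurableSet]
    refine Eq.trans this.symm (integral_congr_ae (ae_of_all _ fun y => ?_))
    by_cases hy : y ∈ U <;> simp [hy, hφ]
  rw [e1, key, neg_neg, e2]

/-- `fderiv_mollify` for real-valued functions, in terms of gradients. -/
theorem classicalGrad_mollify {v : Plane → ℝ} {G : Plane → Grad ℝ}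
    (hU : IsOpen U) (h : IsWeakGrad U v G) (hv : IntegrableOn v U) (hG : IntegrableOn G U) {n : ℕ}
    {x : Plane} (hx : Metric.closedBall x (1 / (n + 1 : ℝ)) ⊆ U) :
    classicalGrad (mollify n (U.indicator v)) x = mollify n (U.indicator G) x := by
  ext i
  rw [classicalGrad_apply, fderiv_mollify hU h hv hG hx]

end Mollification

/-! ### Interpolation estimates for smooth functions on a triangle -/

section SmoothEstimate

/-- The closed triangle with vertices `A`, `A + b` and `A + c`. -/
def cornerTriangle (A b c : Plane) : Set Plane :=
  (fun p : ℝ × ℝ => A + (p.1 • b + p.2 • c)) '' {p | 0 ≤ p.1 ∧ 0 ≤ p.2 ∧ p.1 + p.2 ≤ 1}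

theorem cornerTriangle_swap (A b c : Plane) : cornerTriangle A b c = cornerTriangle A c b := by
  have h : ∀ b c : Plane, cornerTriangle A b c ⊆ cornerTriangle A c b := by
    rintro b c _ ⟨p, ⟨h1, h2, h3⟩, rfl⟩
    exact ⟨(p.2, p.1), ⟨h2, h1, by simpa [add_comm] using h3⟩, by simp [add_comm]⟩
  exact (h b c).antisymm (h c b)

theorem isCompact_unitTriangle :
    IsCompact {p : ℝ × ℝ | 0 ≤ p.1 ∧ 0 ≤ p.2 ∧ p.1 + p.2 ≤ 1} := by
  refine (isCompact_Icc (a := ((0 : ℝ), (0 : ℝ))) (b := (1, 1))).of_isClosed_subset ?_ ?_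
  · exact (isClosed_le continuous_const continuous_fst).inter
      ((isClosed_le continuous_const continuous_snd).inter
        (isClosed_le (continuous_fst.add continuous_snd) continuous_const))
  · rintro ⟨x, y⟩ ⟨h1, h2, h3⟩
    simp only at h1 h2 h3
    exact ⟨⟨h1, h2⟩, ⟨by simp only; linarith, by simp only; linarith⟩⟩

theorem isCompact_cornerTriangle (A b c : Plane) : IsCompact (cornerTriangle A b c) :=
  isCompact_unitTriangle.image (by fun_prop)

/-- The Duffy parametrization of the triangle by the unit square, which collapses the side
`y = 1` of the square to the vertex `A + c`. -/
def duffy (A b c : Plane) (s y : ℝ) : Plane := A + ((s * (1 - y)) • b + y • c)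

theorem continuous_duffy (A b c : Plane) : Continuous fun p : ℝ × ℝ => duffy A b c p.1 p.2 := by
  unfold duffy; fun_prop

theorem duffy_mem {A b c : Plane} {s y : ℝ} (hs : s ∈ Set.Icc (0 : ℝ) 1)
    (hy : y ∈ Set.Icc (0 : ℝ) 1) : duffy A b c s y ∈ cornerTriangle A b c := by
  refine ⟨(s * (1 - y), y), ⟨mul_nonneg hs.1 (by linarith [hy.2]), hy.1, ?_⟩, rfl⟩
  simp only
  nlinarith [hs.2, hy.2]

/-- Integration over the unit triangle in Duffy coordinates, with Jacobian `1 - y`. -/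
theorem integral_unitTriangle {f : ℝ × ℝ → ℝ} (hf : Continuous f) :
    ∫ p in {p : ℝ × ℝ | 0 ≤ p.1 ∧ 0 ≤ p.2 ∧ p.1 + p.2 ≤ 1}, f p =
      ∫ y in (0 : ℝ)..1, (1 - y) * ∫ s in (0 : ℝ)..1, f (s * (1 - y), y) := by
  set T : Set (ℝ × ℝ) := {p : ℝ × ℝ | 0 ≤ p.1 ∧ 0 ≤ p.2 ∧ p.1 + p.2 ≤ 1} with hT
  have hTm : MeasurableSet T := isCompact_unitTriangle.isClosed.measurableSet
  have hint : Integrable (T.indicator f) :=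
    (hf.continuousOn.integrableOn_compact isCompact_unitTriangle).integrable_indicator hTm
  rw [← integral_indicator hTm, Measure.volume_eq_prod, integral_prod_symm _ hint,
    intervalIntegral.integral_of_le zero_le_one, ← integral_Icc_eq_integral_Ioc,
    ← integral_indicator measurableSet_Icc]
  refine integral_congr_ae (ae_of_all _ fun y => ?_)
  by_cases hy : y ∈ Set.Icc (0 : ℝ) 1
  · have h1 : ∀ x, T.indicator f (x, y) = (Set.Icc 0 (1 - y)).indicator (fun x => f (x, y)) x := by
      intro x
      by_cases hx : x ∈ Set.Icc 0 (1 - y)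
      · rw [Set.indicator_of_mem hx, Set.indicator_of_mem]
        exact ⟨hx.1, hy.1, by simp only; linarith [hx.2]⟩
      · rw [Set.indicator_of_notMem hx, Set.indicator_of_notMem]
        rintro ⟨h1, h2, h3⟩
        simp only at h1 h3
        exact hx ⟨h1, by linarith⟩
    simp only [h1, Set.indicator_of_mem hy]
    rw [integral_indicator measurableSet_Icc, integral_Icc_eq_integral_Ioc,
      ← intervalIntegral.integral_of_le (by linarith [hy.2]),
      intervalIntegral.mul_integral_comp_mul_right (f := fun x => f (x, y))]
    simp
  · have h1 : ∀ x, T.indicator f (x, y) = 0 := fun x => by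
      rw [Set.indicator_of_notMem]
      rintro ⟨h1, h2, h3⟩
      simp only at h1 h2 h3
      exact hy ⟨h2, by linarith⟩
    simp [h1, Set.indicator_of_notMem hy]

/-- Integration over a triangle in Duffy coordinates, up to the (irrelevant) constant Jacobian of
the affine map from the unit triangle. -/
theorem exists_integral_cornerTriangle (A : Plane) {b c : Plane}
    (hbc : LinearIndependent ℝ ![b, c]) :
    ∃ J : ℝ, 0 ≤ J ∧ ∀ f : Plane → ℝ, Continuous f →
      ∫ x in cornerTriangle A b c, f x =
        J * ∫ y in (0 : ℝ)..1, (1 - y) * ∫ s in (0 : ℝ)..1, f (duffy A b c s y) := by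
  let L₀ : ℝ × ℝ →ₗ[ℝ] Plane :=
    (LinearMap.fst ℝ ℝ ℝ).smulRight b + (LinearMap.snd ℝ ℝ ℝ).smulRight c
  have hL₀ : ∀ p, L₀ p = p.1 • b + p.2 • c := fun p => rfl
  have hinj : Function.Injective L₀ := by
    rw [injective_iff_map_eq_zero]
    intro p hp
    have := LinearIndependent.pair_iff.mp hbc p.1 p.2 hp
    exact Prod.ext this.1 this.2
  let L : (ℝ × ℝ) ≃L[ℝ] Plane :=
    (LinearEquiv.ofInjectiveOfFinrankEq L₀ hinj (by simp)).toContinuousLinearEquiv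
  have hL : ∀ p, L p = p.1 • b + p.2 • c := fun p => rfl
  have hJ := Measure.isAddLeftInvariant_eq_smul (volume : Measure Plane)
    ((volume : Measure (ℝ × ℝ)).map L)
  set J := Measure.addHaarScalarFactor (volume : Measure Plane)
    ((volume : Measure (ℝ × ℝ)).map L) with hJdef
  refine ⟨J, J.2, fun f hf => ?_⟩
  have hKm : MeasurableSet (cornerTriangle A b c) :=
    (isCompact_cornerTriangle A b c).isClosed.measurableSet
  have hTm := isCompact_unitTriangle.isClosed.measurableSet
  rw [← integral_indicator hKm, ← integral_add_left_eq_self _ A, hJ, integral_smul_nnreal_measure]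
  have hmap := L.toHomeomorph.toMeasurableEquiv.measurableEmbedding.integral_map
    (μ := (volume : Measure (ℝ × ℝ))) fun x => (cornerTriangle A b c).indicator f (A + x)
  refine (congrArg (J • ·) hmap).trans ?_
  have h2 := integral_unitTriangle (f := fun p => f (A + L p)) (by fun_prop)
  rw [NNReal.smul_def, smul_eq_mul]
  congr 1
  refine Eq.trans ?_ h2
  rw [← integral_indicator hTm]
  refine integral_congr_ae (ae_of_all _ fun p => ?_)
  change (cornerTriangle A b c).indicator f (A + L p) = _
  by_cases hp : p ∈ {p : ℝ × ℝ | 0 ≤ p.1 ∧ 0 ≤ p.2 ∧ p.1 + p.2 ≤ 1}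
  · rw [Set.indicator_of_mem hp, Set.indicator_of_mem]
    exact ⟨p, hp, rfl⟩
  · rw [Set.indicator_of_notMem hp, Set.indicator_of_notMem]
    rintro ⟨p', hp', h⟩
    have h' : A + L p' = A + L p := h
    rw [L.injective (add_left_cancel h')] at hp'
    exact hp hp'

theorem abs_sub_le_integral_of_abs_deriv_le {f f' g : ℝ → ℝ} {a b : ℝ} (hab : a ≤ b)
    (hf : ∀ t, HasDerivAt f (f' t) t) (hf' : Continuous f') (hg : Continuous g)
    (h : ∀ t ∈ Set.Icc a b, |f' t| ≤ g t) : |f b - f a| ≤ ∫ t in a..b, g t := by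
  rw [← intervalIntegral.integral_eq_sub_of_hasDerivAt (fun t _ => hf t)
    (hf'.intervalIntegrable a b)]
  refine (intervalIntegral.abs_integral_le_integral_abs hab).trans ?_
  exact intervalIntegral.integral_mono_on hab (hf'.abs.intervalIntegrable a b)
    (hg.intervalIntegrable a b) h

theorem sq_intervalIntegral_le {f : ℝ → ℝ} (hf : Continuous f) {a : ℝ} (ha : 0 ≤ a) :
    (∫ t in (0 : ℝ)..a, f t) ^ 2 ≤ a * ∫ t in (0 : ℝ)..a, f t ^ 2 := by
  rcases ha.eq_or_lt with rfl | ha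
  · simp
  set m := ∫ t in (0 : ℝ)..a, f t with hm
  have h : 0 ≤ ∫ t in (0 : ℝ)..a, (a * f t - m) ^ 2 :=
    intervalIntegral.integral_nonneg ha.le fun t _ => sq_nonneg _
  have e : ∀ t, (a * f t - m) ^ 2 = a ^ 2 * f t ^ 2 - 2 * a * m * f t + m ^ 2 := fun t => by ring
  simp_rw [e] at h
  rw [intervalIntegral.integral_add, intervalIntegral.integral_sub,
    intervalIntegral.integral_const_mul, intervalIntegral.integral_const_mul,
    intervalIntegral.integral_const, ← hm] at h
  · simp only [sub_zero, smul_eq_mul] at h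
    have : 0 ≤ a * (a * ∫ t in (0 : ℝ)..a, f t ^ 2) - a * m ^ 2 := by linarith
    nlinarith
  all_goals exact Continuous.intervalIntegrable (by fun_prop) _ _

theorem intervalIntegral_swap_of_continuous {f : ℝ → ℝ → ℝ}
    (hf : Continuous (Function.uncurry f)) :
    ∫ y in (0 : ℝ)..1, ∫ s in (0 : ℝ)..1, f y s = ∫ s in (0 : ℝ)..1, ∫ y in (0 : ℝ)..1, f y s := by
  simp only [intervalIntegral.integral_of_le zero_le_one]
  refine integral_integral_swap ?_
  rw [Measure.prod_restrict]
  exact (hf.continuousOn.integrableOn_compact (isCompact_Icc.prod isCompact_Icc)).mono_set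
    (Set.prod_mono Set.Ioc_subset_Icc_self Set.Ioc_subset_Icc_self)

/-- The square of the integral over the strip `[0, 1] × [0, y]`, controlled by the square integral
with the Duffy weight `1 - η`. -/
theorem sq_integral_strip_le {n : ℝ → ℝ → ℝ} (hn : Continuous fun p : ℝ × ℝ => n p.1 p.2)
    {y : ℝ} (hy : y ∈ Set.Icc (0 : ℝ) 1) :
    (1 - y) * (∫ s in (0 : ℝ)..1, ∫ η in (0 : ℝ)..y, n s η) ^ 2 ≤
      y * ∫ η in (0 : ℝ)..1, ∫ s in (0 : ℝ)..1, (1 - η) * n s η ^ 2 := by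
  have h1y : 0 ≤ 1 - y := by linarith [hy.2]
  set R := ∫ s in (0 : ℝ)..1, ∫ η in (0 : ℝ)..y, n s η with hR
  have hn2 : Continuous fun p : ℝ × ℝ => n p.1 p.2 ^ 2 := hn.pow 2
  have hWc : Continuous fun p : ℝ × ℝ => (1 - p.2) * n p.1 p.2 ^ 2 :=
    (continuous_const.sub continuous_snd).mul hn2
  have hRc : Continuous fun s => ∫ η in (0 : ℝ)..y, n s η :=
    intervalIntegral.continuous_parametric_intervalIntegral_of_continuous' hn 0 y
  have hIc : Continuous fun s => ∫ η in (0 : ℝ)..y, n s η ^ 2 :=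
    intervalIntegral.continuous_parametric_intervalIntegral_of_continuous' hn2 0 y
  have hKc : Continuous fun s => ∫ η in (0 : ℝ)..1, (1 - η) * n s η ^ 2 :=
    intervalIntegral.continuous_parametric_intervalIntegral_of_continuous' hWc 0 1
  have e1 : R ^ 2 ≤ ∫ s in (0 : ℝ)..1, y * ∫ η in (0 : ℝ)..y, n s η ^ 2 := by
    have := sq_intervalIntegral_le hRc zero_le_one
    rw [one_mul] at this
    refine this.trans ?_
    refine intervalIntegral.integral_mono_on zero_le_one
      ((hRc.pow 2).intervalIntegrable _ _)
      ((continuous_const.mul hIc).intervalIntegrable _ _) fun s _ => ?_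
    exact sq_intervalIntegral_le (hn.comp (continuous_const.prodMk continuous_id)) hy.1
  -- the weight `1 - η` is at least `1 - y` on `[0, y]`
  have e2 : ∀ s : ℝ, (1 - y) * ∫ η in (0 : ℝ)..y, n s η ^ 2 ≤
      ∫ η in (0 : ℝ)..1, (1 - η) * n s η ^ 2 := by
    intro s
    have hc1 : Continuous fun η => (1 - η) * n s η ^ 2 :=
      hWc.comp (continuous_const.prodMk continuous_id)
    have hc2 : Continuous fun η => (1 - y) * n s η ^ 2 :=
      continuous_const.mul (hn2.comp (continuous_const.prodMk continuous_id))
    rw [← intervalIntegral.integral_const_mul]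
    calc _ ≤ ∫ η in (0 : ℝ)..y, (1 - η) * n s η ^ 2 := by
          refine intervalIntegral.integral_mono_on hy.1 (hc2.intervalIntegrable _ _)
            (hc1.intervalIntegrable _ _) fun η hη => ?_
          exact mul_le_mul_of_nonneg_right (by linarith [hη.2]) (sq_nonneg _)
      _ ≤ _ := by
          have := intervalIntegral.integral_add_adjacent_intervals
            (hc1.intervalIntegrable (μ := volume) 0 y) (hc1.intervalIntegrable y 1)
          have h0 : 0 ≤ ∫ η in y..1, (1 - η) * n s η ^ 2 :=
            intervalIntegral.integral_nonneg hy.2 fun η hη =>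
              mul_nonneg (by linarith [hη.2]) (sq_nonneg _)
          linarith
  have e3 : ∫ η in (0 : ℝ)..1, ∫ s in (0 : ℝ)..1, (1 - η) * n s η ^ 2 =
      ∫ s in (0 : ℝ)..1, ∫ η in (0 : ℝ)..1, (1 - η) * n s η ^ 2 :=
    intervalIntegral_swap_of_continuous
      (f := fun η s => (1 - η) * n s η ^ 2) (hWc.comp continuous_swap)
  calc (1 - y) * R ^ 2
      ≤ (1 - y) * ∫ s in (0 : ℝ)..1, y * ∫ η in (0 : ℝ)..y, n s η ^ 2 :=
        mul_le_mul_of_nonneg_left e1 h1y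
    _ = y * ∫ s in (0 : ℝ)..1, (1 - y) * ∫ η in (0 : ℝ)..y, n s η ^ 2 := by
        rw [intervalIntegral.integral_const_mul, intervalIntegral.integral_const_mul]; ring
    _ ≤ _ := by
        rw [e3]
        refine mul_le_mul_of_nonneg_left ?_ hy.1
        exact intervalIntegral.integral_mono_on zero_le_one
          ((continuous_const.mul hIc).intervalIntegrable _ _)
          (hKc.intervalIntegrable _ _) fun s _ => e2 s

variable {A b c : Plane} {w N : Plane → ℝ} {k : ℝ}

/-- A function with mean zero on the edge from `A` to `A + b` is controlled by the integrals of
its derivatives along the coordinate lines of the Duffy parametrization. -/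
theorem abs_duffy_le (hw : ContDiff ℝ 1 w) (hN : Continuous N)
    (hN0 : ∀ z, 0 ≤ N z) (hk : 0 ≤ k)
    (hb : ∀ z ∈ cornerTriangle A b c, |fderiv ℝ w z b| ≤ k * N z)
    (hc : ∀ s ∈ Set.Icc (0 : ℝ) 1, ∀ z ∈ cornerTriangle A b c,
      |fderiv ℝ w z (c - s • b)| ≤ k * N z)
    (hmean : ∫ s in (0 : ℝ)..1, w (A + s • b) = 0)
    {s y : ℝ} (hs : s ∈ Set.Icc (0 : ℝ) 1) (hy : y ∈ Set.Icc (0 : ℝ) 1) :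
    |w (duffy A b c s y)| ≤ k * ((1 - y) * ∫ s' in (0 : ℝ)..1, N (duffy A b c s' y)) +
      k * ∫ s' in (0 : ℝ)..1, ∫ η in (0 : ℝ)..y, N (duffy A b c s' η) := by
  have hdc := continuous_duffy A b c
  have hwd : ∀ z, HasFDerivAt w (fderiv ℝ w z) z := fun z =>
    (hw.differentiable (by simp) z).hasFDerivAt
  have hfc : Continuous (fderiv ℝ w) := hw.continuous_fderiv (by simp)
  have h1y : 0 ≤ 1 - y := by linarith [hy.2]
  have hNy : Continuous fun t => N (duffy A b c t y) :=
    hN.comp (hdc.comp (continuous_id.prodMk continuous_const))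
  -- variation in the horizontal variable
  have hderiv1 : ∀ t, HasDerivAt (fun t => w (duffy A b c t y))
      (fderiv ℝ w (duffy A b c t y) ((1 - y) • b)) t := fun t => by
    have h1 : HasDerivAt (fun t => duffy A b c t y) ((1 - y) • b) t := by
      unfold duffy
      have h0 : HasDerivAt (fun t : ℝ => t * (1 - y)) (1 - y) t := by
        simpa using (hasDerivAt_id t).mul_const (1 - y)
      simpa using ((h0.smul_const b).add_const (y • c)).const_add A
    exact (hwd _).comp_hasDerivAt t h1
  have hcont1 : Continuous fun t => fderiv ℝ w (duffy A b c t y) ((1 - y) • b) :=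
    (hfc.comp (hdc.comp (continuous_id.prodMk continuous_const))).clm_apply continuous_const
  have hle1 : ∀ s₁ ∈ Set.Icc (0 : ℝ) 1, ∀ s₂ ∈ Set.Icc (0 : ℝ) 1, s₁ ≤ s₂ →
      |w (duffy A b c s₂ y) - w (duffy A b c s₁ y)| ≤
        k * ((1 - y) * ∫ s' in (0 : ℝ)..1, N (duffy A b c s' y)) := by
    intro s₁ h1 s₂ h2 h12
    have hg : Continuous fun t => k * ((1 - y) * N (duffy A b c t y)) := by fun_prop
    refine (abs_sub_le_integral_of_abs_deriv_le h12 hderiv1 hcont1 hg ?_).trans ?_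
    · intro t ht
      rw [map_smul, smul_eq_mul, abs_mul, abs_of_nonneg h1y]
      have := hb _ (duffy_mem (A := A) (b := b) (c := c)
        ⟨h1.1.trans ht.1, ht.2.trans h2.2⟩ hy)
      nlinarith
    · rw [← intervalIntegral.integral_const_mul, ← intervalIntegral.integral_const_mul]
      refine intervalIntegral.integral_mono_interval h1.1 h12 h2.2
        (ae_of_all _ fun t => ?_) (hg.intervalIntegrable _ _)
      exact mul_nonneg hk (mul_nonneg h1y (hN0 _))
  have hle1' : ∀ s' ∈ Set.Icc (0 : ℝ) 1, |w (duffy A b c s y) - w (duffy A b c s' y)| ≤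
        k * ((1 - y) * ∫ s' in (0 : ℝ)..1, N (duffy A b c s' y)) := by
    intro s' hs'
    rcases le_total s s' with h | h
    · rw [abs_sub_comm]; exact hle1 s hs s' hs' h
    · exact hle1 s' hs' s hs h
  -- variation in the vertical variable
  have hle2 : ∀ s' ∈ Set.Icc (0 : ℝ) 1, |w (duffy A b c s' y) - w (A + s' • b)| ≤
      k * ∫ η in (0 : ℝ)..y, N (duffy A b c s' η) := by
    intro s' hs'
    have hderiv2 : ∀ t, HasDerivAt (fun t => w (duffy A b c s' t))
        (fderiv ℝ w (duffy A b c s' t) (c - s' • b)) t := fun t => by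
      have h1 : HasDerivAt (fun t => duffy A b c s' t) (c - s' • b) t := by
        unfold duffy
        have h0 : HasDerivAt (fun t : ℝ => s' * (1 - t)) (-s') t := by
          simpa using ((hasDerivAt_id t).const_sub 1).const_mul s'
        have h3 := ((h0.smul_const b).add ((hasDerivAt_id t).smul_const c)).const_add A
        have e : c - s' • b = (-s') • b + (1 : ℝ) • c := by module
        rw [e]
        exact h3
      exact (hwd _).comp_hasDerivAt t h1
    have hcont2 : Continuous fun t => fderiv ℝ w (duffy A b c s' t) (c - s' • b) :=
      (hfc.comp (hdc.comp (continuous_const.prodMk continuous_id))).clm_apply continuous_const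
    have hg : Continuous fun t => k * N (duffy A b c s' t) :=
      continuous_const.mul (hN.comp (hdc.comp (continuous_const.prodMk continuous_id)))
    have := abs_sub_le_integral_of_abs_deriv_le hy.1 hderiv2 hcont2 hg
      fun t ht => hc s' hs' _ (duffy_mem hs' ⟨ht.1, ht.2.trans hy.2⟩)
    rw [intervalIntegral.integral_const_mul] at this
    have e0 : duffy A b c s' 0 = A + s' • b := by simp [duffy]
    rwa [e0] at this
  -- average over the parameter `s'` of the path
  set E := k * ((1 - y) * ∫ s' in (0 : ℝ)..1, N (duffy A b c s' y)) with hE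
  have hRc : Continuous fun s' => ∫ η in (0 : ℝ)..y, N (duffy A b c s' η) :=
    intervalIntegral.continuous_parametric_intervalIntegral_of_continuous'
      (f := fun s' η => N (duffy A b c s' η)) (hN.comp hdc) 0 y
  have hw0 : Continuous fun s' : ℝ => w (A + s' • b) := hw.continuous.comp (by fun_prop)
  have hup : ∀ σ : ℝ, |σ| = 1 → σ * w (duffy A b c s y) ≤
      E + k * ∫ s' in (0 : ℝ)..1, ∫ η in (0 : ℝ)..y, N (duffy A b c s' η) := by
    intro σ hσ
    have hpt : ∀ s' ∈ Set.Icc (0 : ℝ) 1, σ * w (duffy A b c s y) ≤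
        (E + σ * w (A + s' • b)) + k * ∫ η in (0 : ℝ)..y, N (duffy A b c s' η) := by
      intro s' hs'
      have h1 := le_abs_self (σ * (w (duffy A b c s y) - w (duffy A b c s' y)))
      have h2 := le_abs_self (σ * (w (duffy A b c s' y) - w (A + s' • b)))
      rw [abs_mul, hσ, one_mul] at h1 h2
      linarith [hle1' s' hs', hle2 s' hs']
    have hint := intervalIntegral.integral_mono_on zero_le_one
      (continuous_const.intervalIntegrable (μ := volume) (0 : ℝ) 1)
      (Continuous.intervalIntegrable (by fun_prop) (0 : ℝ) 1) hpt
    rw [intervalIntegral.integral_add (Continuous.intervalIntegrable (by fun_prop) _ _)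
      (Continuous.intervalIntegrable (by fun_prop) _ _),
      intervalIntegral.integral_add (Continuous.intervalIntegrable (by fun_prop) _ _)
      (Continuous.intervalIntegrable (by fun_prop) _ _), intervalIntegral.integral_const_mul k,
      intervalIntegral.integral_const_mul σ (fun s' : ℝ => w (A + s' • b)), hmean,
      intervalIntegral.integral_const, intervalIntegral.integral_const] at hint
    simpa using hint
  refine abs_le.mpr ⟨?_, ?_⟩
  · have := hup (-1) (by simp)
    linarith
  · have := hup 1 (by simp)
    linarith

/-- Trace Poincaré inequality on a triangle: a function with mean zero on an edge is controlled in
`L²` by its gradient, with a constant that does not depend on the shape of the triangle when the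
derivatives are taken in the directions of its chords. -/
theorem integral_sq_le_of_mean_edge_eq_zero (hbc : LinearIndependent ℝ ![b, c])
    (hw : ContDiff ℝ 1 w) (hN : Continuous N) (hN0 : ∀ z, 0 ≤ N z) (hk : 0 ≤ k)
    (hb : ∀ z ∈ cornerTriangle A b c, |fderiv ℝ w z b| ≤ k * N z)
    (hc : ∀ s ∈ Set.Icc (0 : ℝ) 1, ∀ z ∈ cornerTriangle A b c,
      |fderiv ℝ w z (c - s • b)| ≤ k * N z)
    (hmean : ∫ s in (0 : ℝ)..1, w (A + s • b) = 0) :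
    ∫ z in cornerTriangle A b c, w z ^ 2 ≤ 3 * k ^ 2 * ∫ z in cornerTriangle A b c, N z ^ 2 := by
  obtain ⟨J, hJ0, hJ⟩ := exists_integral_cornerTriangle A hbc
  rw [hJ (fun z => w z ^ 2) (hw.continuous.pow 2), hJ (fun z => N z ^ 2) (hN.pow 2)]
  have hdc := continuous_duffy A b c
  have hNc : Continuous fun p : ℝ × ℝ => N (duffy A b c p.1 p.2) := hN.comp hdc
  have hN2 : Continuous fun p : ℝ × ℝ => N (duffy A b c p.1 p.2) ^ 2 := hNc.pow 2
  set S : ℝ → ℝ := fun y => ∫ s in (0 : ℝ)..1, N (duffy A b c s y) ^ 2 with hS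
  have hSc : Continuous S :=
    intervalIntegral.continuous_parametric_intervalIntegral_of_continuous'
      (f := fun y s => N (duffy A b c s y) ^ 2) (hN2.comp continuous_swap) 0 1
  set Q := ∫ y in (0 : ℝ)..1, (1 - y) * S y with hQ
  have hSn : ∀ y, 0 ≤ S y := fun y =>
    intervalIntegral.integral_nonneg zero_le_one fun _ _ => sq_nonneg _
  have hpt : ∀ y ∈ Set.Icc (0 : ℝ) 1, (1 - y) * ∫ s in (0 : ℝ)..1, w (duffy A b c s y) ^ 2 ≤
      2 * k ^ 2 * ((1 - y) * S y + y * Q) := by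
    intro y hy
    have h1y : 0 ≤ 1 - y := by linarith [hy.2]
    set P := ∫ s' in (0 : ℝ)..1, N (duffy A b c s' y) with hP
    set R := ∫ s' in (0 : ℝ)..1, ∫ η in (0 : ℝ)..y, N (duffy A b c s' η) with hR
    have hP2 : P ^ 2 ≤ S y := by
      have := sq_intervalIntegral_le (f := fun s => N (duffy A b c s y))
        (hNc.comp (continuous_id.prodMk continuous_const)) zero_le_one
      simpa using this
    have hR2 : (1 - y) * R ^ 2 ≤ y * Q := by
      refine (sq_integral_strip_le (n := fun s η => N (duffy A b c s η)) hNc hy).trans_eq ?_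
      simp only [hQ, hS, ← intervalIntegral.integral_const_mul]
    have hW : ∀ s ∈ Set.Icc (0 : ℝ) 1,
        w (duffy A b c s y) ^ 2 ≤ 2 * k ^ 2 * (((1 - y) * P) ^ 2 + R ^ 2) := by
      intro s hs
      have := abs_duffy_le hw hN hN0 hk hb hc hmean hs hy
      rw [← sq_abs]
      calc |w (duffy A b c s y)| ^ 2 ≤ (k * ((1 - y) * P) + k * R) ^ 2 :=
            pow_le_pow_left₀ (abs_nonneg _) this 2
        _ ≤ _ := by nlinarith [sq_nonneg (k * ((1 - y) * P) - k * R)]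
    have hInt : ∫ s in (0 : ℝ)..1, w (duffy A b c s y) ^ 2 ≤
        2 * k ^ 2 * (((1 - y) * P) ^ 2 + R ^ 2) := by
      have hwc : Continuous fun s => w (duffy A b c s y) ^ 2 :=
        (hw.continuous.comp (hdc.comp (continuous_id.prodMk continuous_const))).pow 2
      have := intervalIntegral.integral_mono_on zero_le_one (hwc.intervalIntegrable _ _)
        (continuous_const.intervalIntegrable (μ := volume) (0 : ℝ) 1) hW
      simpa using this
    calc (1 - y) * ∫ s in (0 : ℝ)..1, w (duffy A b c s y) ^ 2
        ≤ (1 - y) * (2 * k ^ 2 * (((1 - y) * P) ^ 2 + R ^ 2)) :=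
          mul_le_mul_of_nonneg_left hInt h1y
      _ = 2 * k ^ 2 * ((1 - y) * (((1 - y) * P) ^ 2) + (1 - y) * R ^ 2) := by ring
      _ ≤ _ := by
          refine mul_le_mul_of_nonneg_left ?_ (by positivity)
          refine add_le_add (mul_le_mul_of_nonneg_left ?_ h1y) hR2
          rw [mul_pow]
          have : (1 - y) ^ 2 ≤ 1 := by nlinarith [hy.1]
          nlinarith [sq_nonneg P, hSn y]
  have hw2 : Continuous fun p : ℝ × ℝ => w (duffy A b c p.1 p.2) ^ 2 :=
    (hw.continuous.comp hdc).pow 2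
  have hwS : Continuous fun y => ∫ s in (0 : ℝ)..1, w (duffy A b c s y) ^ 2 :=
    intervalIntegral.continuous_parametric_intervalIntegral_of_continuous'
      (f := fun y s => w (duffy A b c s y) ^ 2)
      (hw2.comp continuous_swap) 0 1
  have hfin := intervalIntegral.integral_mono_on zero_le_one
    (Continuous.intervalIntegrable (μ := volume) (by fun_prop) (0 : ℝ) 1)
    (Continuous.intervalIntegrable (by fun_prop) (0 : ℝ) 1) hpt
  rw [intervalIntegral.integral_const_mul, intervalIntegral.integral_add
    (Continuous.intervalIntegrable (by fun_prop) _ _)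
    (Continuous.intervalIntegrable (by fun_prop) _ _), intervalIntegral.integral_mul_const,
    integral_id, ← hQ] at hfin
  have h3 : 2 * k ^ 2 * (Q + (1 ^ 2 - 0 ^ 2) / 2 * Q) = 3 * k ^ 2 * Q := by ring
  rw [h3] at hfin
  calc _ ≤ J * (3 * k ^ 2 * Q) := mul_le_mul_of_nonneg_left hfin hJ0
    _ = 3 * k ^ 2 * (J * Q) := by ring

/-- The data of the interpolation estimate for a smooth function `φ` on the triangle with vertices
`A`, `A + b`, `A + c`: `q` is the interpolant, `N` dominates the second derivatives, `h` the side
lengths, and `κ` bounds a vector by its components along the two sides at `A`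
(the inverse sine of the angle at `A` will do). -/
structure SmoothInterpolation (A b c : Plane) (φ N : Plane → ℝ) (q : Plane →ᵃ[ℝ] ℝ) (h κ : ℝ) :
    Prop where
  smooth : ContDiff ℝ ∞ φ
  cont : Continuous N
  nonneg : ∀ z, 0 ≤ N z
  bound : ∀ z ∈ cornerTriangle A b c, ∀ e d : Plane,
    |fderiv ℝ (fun y => fderiv ℝ φ y e) z d| ≤ N z * ‖e‖ * ‖d‖
  interp : q A = φ A
  interp_b : q (A + b) = φ (A + b)
  interp_c : q (A + c) = φ (A + c)
  b_ne : b ≠ 0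
  c_ne : c ≠ 0
  b_le : ‖b‖ ≤ h
  c_le : ‖c‖ ≤ h
  sub_le : ‖c - b‖ ≤ h
  κ_nonneg : 0 ≤ κ
  comp : ∀ p : Plane, ‖p‖ ≤ κ * (|inner ℝ p b| / ‖b‖ + |inner ℝ p c| / ‖c‖)

namespace SmoothInterpolation

variable {φ : Plane → ℝ} {q : Plane →ᵃ[ℝ] ℝ} {h κ : ℝ}

theorem symm (H : SmoothInterpolation A b c φ N q h κ) : SmoothInterpolation A c b φ N q h κ where
  smooth := H.smooth
  cont := H.cont
  nonneg := H.nonneg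
  bound := by rw [cornerTriangle_swap]; exact H.bound
  interp := H.interp
  interp_b := H.interp_c
  interp_c := H.interp_b
  b_ne := H.c_ne
  c_ne := H.b_ne
  b_le := H.c_le
  c_le := H.b_le
  sub_le := by rw [norm_sub_rev]; exact H.sub_le
  κ_nonneg := H.κ_nonneg
  comp := fun p => by rw [add_comm]; exact H.comp p

theorem h_nonneg (H : SmoothInterpolation A b c φ N q h κ) : 0 ≤ h :=
  (norm_nonneg b).trans H.b_le

theorem linearIndependent (H : SmoothInterpolation A b c φ N q h κ) :
    LinearIndependent ℝ ![b, c] := by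
  rw [LinearIndependent.pair_iff' H.b_ne]
  intro a ha
  -- a vector orthogonal to `b` would be orthogonal to both sides
  set p : Plane := WithLp.toLp 2 ![- b 1, b 0] with hp
  have hpb : inner ℝ p b = 0 := by
    simp [hp, PiLp.inner_apply, Fin.sum_univ_two]; ring
  have hpc : inner ℝ p c = 0 := by rw [← ha, inner_smul_right, hpb, mul_zero]
  have h0 := H.comp p
  rw [hpb, hpc] at h0
  have hp0 : p = 0 := norm_le_zero_iff.mp (by simpa using h0)
  apply H.b_ne
  have e0 : p 0 = 0 := by rw [hp0]; rfl
  have e1 : p 1 = 0 := by rw [hp0]; rfl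
  simp only [hp, Matrix.cons_val_zero, Matrix.cons_val_one] at e0 e1
  ext i
  fin_cases i
  · simpa using e1
  · simpa using e0

/-- The derivative of the interpolation error along the side `b`. -/
theorem edge (H : SmoothInterpolation A b c φ N q h κ) :
    let w : Plane → ℝ := fun z => fderiv ℝ φ z b - q.linear b
    ContDiff ℝ 1 w ∧
    (∀ z ∈ cornerTriangle A b c, |fderiv ℝ w z b| ≤ (‖b‖ * h) * N z) ∧
    (∀ s ∈ Set.Icc (0 : ℝ) 1, ∀ z ∈ cornerTriangle A b c,
      |fderiv ℝ w z (c - s • b)| ≤ (‖b‖ * h) * N z) ∧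
    ∫ s in (0 : ℝ)..1, w (A + s • b) = 0 := by
  intro w
  have hφb : ContDiff ℝ 1 (fun z => fderiv ℝ φ z b) :=
    (H.smooth.fderiv_right (m := 1) (by norm_cast)).clm_apply contDiff_const
  have hwd : ∀ z, fderiv ℝ w z = fderiv ℝ (fun z => fderiv ℝ φ z b) z := fun z =>
    fderiv_sub_const _
  have hbd : ∀ z ∈ cornerTriangle A b c, ∀ d : Plane, ‖d‖ ≤ h →
      |fderiv ℝ w z d| ≤ (‖b‖ * h) * N z := by
    intro z hz d hd
    rw [hwd]
    refine (H.bound z hz b d).trans ?_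
    have := mul_nonneg (H.nonneg z) (norm_nonneg b)
    nlinarith
  refine ⟨hφb.sub contDiff_const, fun z hz => hbd z hz b H.b_le, fun s hs z hz => hbd z hz _ ?_, ?_⟩
  · have e : c - s • b = (1 - s) • c + s • (c - b) := by module
    have h1 : 0 ≤ 1 - s := by linarith [hs.2]
    rw [e]
    refine (norm_add_le _ _).trans ?_
    rw [norm_smul, norm_smul, Real.norm_of_nonneg h1, Real.norm_of_nonneg hs.1]
    nlinarith [H.c_le, H.sub_le, hs.1]
  · -- the integral is the increment of the interpolation error between two vertices
    have hder : ∀ s : ℝ,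
        HasDerivAt (fun s : ℝ => φ (A + s • b) - q (A + s • b)) (w (A + s • b)) s := by
      intro s
      have hl : HasDerivAt (fun s : ℝ => A + s • b) b s := by
        simpa using ((hasDerivAt_id s).smul_const b).const_add A
      have h1 : HasFDerivAt φ (fderiv ℝ φ (A + s • b)) (A + s • b) :=
        (H.smooth.differentiable (by simp) _).hasFDerivAt
      exact (h1.comp_hasDerivAt s hl).sub ((q.hasFDerivAt _).comp_hasDerivAt s hl)
    have hcont : Continuous fun s : ℝ => w (A + s • b) :=
      (hφb.sub contDiff_const).continuous.comp (by fun_prop)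
    rw [intervalIntegral.integral_eq_sub_of_hasDerivAt (fun s _ => hder s)
      (hcont.intervalIntegrable _ _)]
    simp [H.interp, H.interp_b]

theorem norm_grad_le (H : SmoothInterpolation A b c φ N q h κ) (z : Plane) :
    ‖classicalGrad φ z - q.grad‖ ≤
      κ * (|fderiv ℝ φ z b - q.linear b| / ‖b‖ + |fderiv ℝ φ z c - q.linear c| / ‖c‖) := by
  have := H.comp (classicalGrad φ z - q.grad)
  simpa only [inner_sub_left, inner_classicalGrad, AffineMap.inner_grad] using this

theorem norm_grad_le_of_le (H : SmoothInterpolation A b c φ N q h κ) {M : ℝ}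
    (hM : ∀ z ∈ cornerTriangle A b c, N z ≤ M) {z : Plane} (hz : z ∈ cornerTriangle A b c) :
    ‖classicalGrad φ z - q.grad‖ ≤ 4 * κ * h * M := by
  have hM0 : 0 ≤ M := (H.nonneg z).trans (hM z hz)
  have hh := H.h_nonneg
  have key : ∀ {b c : Plane}, SmoothInterpolation A b c φ N q h κ →
      z ∈ cornerTriangle A b c → (∀ z ∈ cornerTriangle A b c, N z ≤ M) →
      |fderiv ℝ φ z b - q.linear b| / ‖b‖ ≤ 2 * h * M := by
    intro b c H hz hM
    obtain ⟨hw, h1, h2, h3⟩ := H.edge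
    have hk : 0 ≤ ‖b‖ * h := by positivity
    obtain ⟨⟨x, y⟩, ⟨hx, hy, hxy⟩, rfl⟩ := hz
    simp only at hx hy hxy
    -- invert the Duffy parametrization away from its degenerate side
    have hpar : ∃ s ∈ Set.Icc (0 : ℝ) 1, s * (1 - y) = x := by
      rcases (by linarith : y ≤ 1).eq_or_lt with rfl | hlt
      · exact ⟨0, by simp, by linarith⟩
      · have : 0 < 1 - y := by linarith
        exact ⟨x / (1 - y), ⟨by positivity, (div_le_one this).mpr (by linarith)⟩,
          div_mul_cancel₀ _ this.ne'⟩
    obtain ⟨s, hs, rfl⟩ := hpar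
    have hy' : y ∈ Set.Icc (0 : ℝ) 1 := ⟨hy, by nlinarith [hs.1]⟩
    have := abs_duffy_le (N := fun _ => M) hw continuous_const (fun _ => hM0) hk
      (fun z hz => (h1 z hz).trans (mul_le_mul_of_nonneg_left (hM z hz) hk))
      (fun s hs z hz => (h2 s hs z hz).trans (mul_le_mul_of_nonneg_left (hM z hz) hk)) h3 hs hy'
    simp only [intervalIntegral.integral_const, smul_eq_mul, sub_zero, one_mul] at this
    rw [div_le_iff₀ (norm_pos_iff.mpr H.b_ne)]
    calc _ ≤ ‖b‖ * h * ((1 - y) * M) + ‖b‖ * h * (y * M) := this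
      _ ≤ _ := by nlinarith [mul_nonneg hk hM0]
  have k1 := key H hz hM
  have k2 := key H.symm (cornerTriangle_swap A b c ▸ hz) (cornerTriangle_swap A b c ▸ hM)
  calc _ ≤ _ := H.norm_grad_le z
    _ ≤ κ * (2 * h * M + 2 * h * M) := mul_le_mul_of_nonneg_left (add_le_add k1 k2) H.κ_nonneg
    _ = _ := by ring

theorem integral_sq_grad_le (H : SmoothInterpolation A b c φ N q h κ) :
    ∫ z in cornerTriangle A b c, ‖classicalGrad φ z - q.grad‖ ^ 2 ≤
      (4 * κ * h) ^ 2 * ∫ z in cornerTriangle A b c, N z ^ 2 := by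
  have hKc := isCompact_cornerTriangle A b c
  have hh := H.h_nonneg
  set I := ∫ z in cornerTriangle A b c, N z ^ 2 with hI
  have hI0 : 0 ≤ I := integral_nonneg fun _ => sq_nonneg _
  have key : ∀ {b c : Plane}, SmoothInterpolation A b c φ N q h κ →
      ∫ z in cornerTriangle A b c, (|fderiv ℝ φ z b - q.linear b| / ‖b‖) ^ 2 ≤
        3 * h ^ 2 * ∫ z in cornerTriangle A b c, N z ^ 2 := by
    intro b c H
    obtain ⟨hw, h1, h2, h3⟩ := H.edge
    have := integral_sq_le_of_mean_edge_eq_zero H.linearIndependent hw H.cont H.nonneg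
      (mul_nonneg (norm_nonneg b) hh) h1 h2 h3
    have hb : 0 < ‖b‖ := norm_pos_iff.mpr H.b_ne
    simp_rw [div_pow, sq_abs, div_eq_mul_inv]
    rw [integral_mul_const, ← div_eq_mul_inv, div_le_iff₀ (by positivity)]
    refine this.trans_eq ?_
    ring
  have k1 := key H
  have k2 := key H.symm
  rw [cornerTriangle_swap A c b] at k2
  have hcb : ∀ e : Plane, Continuous fun z => (|fderiv ℝ φ z e - q.linear e| / ‖e‖) ^ 2 := by
    intro e
    have : Continuous fun z => fderiv ℝ φ z e :=
      (H.smooth.continuous_fderiv (by simp)).clm_apply continuous_const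
    fun_prop
  have hle : ∀ z, ‖classicalGrad φ z - q.grad‖ ^ 2 ≤
      2 * κ ^ 2 * ((|fderiv ℝ φ z b - q.linear b| / ‖b‖) ^ 2 +
        (|fderiv ℝ φ z c - q.linear c| / ‖c‖) ^ 2) := by
    intro z
    refine (pow_le_pow_left₀ (norm_nonneg _) (H.norm_grad_le z) 2).trans ?_
    rw [mul_pow]
    nlinarith [sq_nonneg (κ * (|fderiv ℝ φ z b - q.linear b| / ‖b‖ -
      |fderiv ℝ φ z c - q.linear c| / ‖c‖))]
  have hint : ∀ e : Plane, IntegrableOn (fun z => (|fderiv ℝ φ z e - q.linear e| / ‖e‖) ^ 2)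
      (cornerTriangle A b c) := fun e => (hcb e).continuousOn.integrableOn_compact hKc
  calc _ ≤ ∫ z in cornerTriangle A b c, 2 * κ ^ 2 *
        ((|fderiv ℝ φ z b - q.linear b| / ‖b‖) ^ 2 +
        (|fderiv ℝ φ z c - q.linear c| / ‖c‖) ^ 2) :=
        integral_mono_of_nonneg (ae_of_all _ fun _ => sq_nonneg _)
          (((hint b).add (hint c)).const_mul _) (ae_of_all _ hle)
    _ = 2 * κ ^ 2 * ((∫ z in cornerTriangle A b c, (|fderiv ℝ φ z b - q.linear b| / ‖b‖) ^ 2) +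
        ∫ z in cornerTriangle A b c, (|fderiv ℝ φ z c - q.linear c| / ‖c‖) ^ 2) := by
        rw [integral_const_mul, integral_add (hint b) (hint c)]
    _ ≤ 2 * κ ^ 2 * (3 * h ^ 2 * I + 3 * h ^ 2 * I) :=
        mul_le_mul_of_nonneg_left (add_le_add k1 k2) (by positivity)
    _ ≤ _ := by nlinarith [mul_nonneg (sq_nonneg (κ * h)) hI0]

theorem continuous_classicalGrad {φ : Plane → ℝ} (hφ : ContDiff ℝ ∞ φ) :
    Continuous (classicalGrad φ) := by
  refine (PiLp.continuous_toLp 2 _).comp (continuous_pi fun i => ?_)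
  exact (hφ.continuous_fderiv (by simp)).clm_apply continuous_const

theorem eLpNorm_two_grad_le (H : SmoothInterpolation A b c φ N q h κ) :
    eLpNorm (fun z => classicalGrad φ z - q.grad) 2 (volume.restrict (cornerTriangle A b c)) ≤
      ENNReal.ofReal (4 * κ * h) * eLpNorm N 2 (volume.restrict (cornerTriangle A b c)) := by
  have hKc := isCompact_cornerTriangle A b c
  have hh := H.h_nonneg
  have hκ := H.κ_nonneg
  have hgc : Continuous fun z => classicalGrad φ z - q.grad :=
    (continuous_classicalGrad H.smooth).sub continuous_const
  rw [← ENNReal.pow_le_pow_left_iff two_ne_zero, mul_pow, eLpNorm_two_sq, eLpNorm_two_sq]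
  have e : ∀ {E : Type} [NormedAddCommGroup E] {f : Plane → E}, Continuous f →
      ∫⁻ x in cornerTriangle A b c, ‖f x‖ₑ ^ 2 =
        ENNReal.ofReal (∫ x in cornerTriangle A b c, ‖f x‖ ^ 2) := by
    intro E _ f hf
    have hf2 : Continuous fun x => ‖f x‖ ^ 2 := hf.norm.pow 2
    rw [ofReal_integral_eq_lintegral_ofReal
      (hf2.continuousOn.integrableOn_compact hKc) (ae_of_all _ fun _ => sq_nonneg _)]
    refine lintegral_congr fun x => ?_
    rw [ENNReal.ofReal_pow (norm_nonneg _), ofReal_norm]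
  rw [e hgc, e H.cont, ← ENNReal.ofReal_pow (by positivity), ← ENNReal.ofReal_mul (by positivity)]
  refine ENNReal.ofReal_le_ofReal ?_
  simpa using H.integral_sq_grad_le

theorem eLpNorm_top_grad_le (H : SmoothInterpolation A b c φ N q h κ) {M : ℝ≥0∞} (hM : M ≠ ⊤)
    (hN : ∀ z, ‖N z‖ₑ ≤ M) :
    eLpNorm (fun z => classicalGrad φ z - q.grad) ⊤ (volume.restrict (cornerTriangle A b c)) ≤
      ENNReal.ofReal (4 * κ * h) * M := by
  have hh := H.h_nonneg
  have hκ := H.κ_nonneg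
  have hNM : ∀ z, N z ≤ M.toReal := fun z => by
    have := (ENNReal.toReal_le_toReal enorm_ne_top hM).mpr (hN z)
    rw [toReal_enorm] at this
    exact (le_abs_self _).trans this
  rw [eLpNorm_exponent_top]
  refine essSup_le_of_ae_le _ ?_
  filter_upwards [ae_restrict_mem (isCompact_cornerTriangle A b c).isClosed.measurableSet]
    with z hz
  have := H.norm_grad_le_of_le (fun z _ => hNM z) hz
  rw [← ENNReal.ofReal_toReal hM, ← ENNReal.ofReal_mul (by positivity), ← ofReal_norm]
  exact ENNReal.ofReal_le_ofReal this

end SmoothInterpolation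

end SmoothEstimate

/-! ### From smooth functions to Sobolev functions -/

section Reduction

theorem exists_affineMap_of_linearIndependent (A : Plane) {b c : Plane}
    (hbc : LinearIndependent ℝ ![b, c]) (α β γ : ℝ) :
    ∃ q : Plane →ᵃ[ℝ] ℝ, q A = α ∧ q (A + b) = β ∧ q (A + c) = γ := by
  let B := basisOfLinearIndependentOfCardEqFinrank hbc (by simp)
  let l : Plane →ₗ[ℝ] ℝ := B.constr ℝ ![β - α, γ - α]
  have hB : ∀ i, B i = ![b, c] i := fun i => by
    simp [B]
  have hb : l b = β - α := by
    have := B.constr_basis ℝ ![β - α, γ - α] 0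
    rwa [hB] at this
  have hc : l c = γ - α := by
    have := B.constr_basis ℝ ![β - α, γ - α] 1
    rwa [hB] at this
  refine ⟨l.toAffineMap + AffineMap.const ℝ Plane (α - l A), ?_, ?_, ?_⟩
  · simp
  · simp [hb]
    ring
  · simp [hc]
    ring

theorem convex_cornerTriangle (A b c : Plane) : Convex ℝ (cornerTriangle A b c) := by
  rintro _ ⟨p, ⟨h1, h2, h3⟩, rfl⟩ _ ⟨p', ⟨h1', h2', h3'⟩, rfl⟩ s t hs ht hst
  refine ⟨s • p + t • p', ⟨?_, ?_, ?_⟩, ?_⟩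
  · simp only [Prod.fst_add, Prod.smul_fst, smul_eq_mul]; positivity
  · simp only [Prod.snd_add, Prod.smul_snd, smul_eq_mul]; positivity
  · simp only [Prod.fst_add, Prod.smul_fst, smul_eq_mul, Prod.snd_add, Prod.smul_snd]
    nlinarith
  · have ht' : t = 1 - s := by linarith
    simp only [Prod.fst_add, Prod.smul_fst, smul_eq_mul, Prod.snd_add, Prod.smul_snd, ht']
    module

theorem vertices_mem_cornerTriangle (A b c : Plane) :
    A ∈ cornerTriangle A b c ∧ A + b ∈ cornerTriangle A b c ∧ A + c ∈ cornerTriangle A b c :=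
  ⟨⟨(0, 0), by simp, by simp⟩, ⟨(1, 0), by simp, by simp⟩, ⟨(0, 1), by simp, by simp⟩⟩

variable {A b c : Plane}

theorem mem_shrink_iff {g : Plane} {t : ℝ} {z : Plane} :
    z ∈ cornerTriangle ((1 - t) • g + t • A) (t • b) (t • c) ↔
      ∃ z' ∈ cornerTriangle A b c, z = (1 - t) • g + t • z' := by
  constructor
  · rintro ⟨p, hp, rfl⟩
    exact ⟨_, ⟨p, hp, rfl⟩, by simp only; module⟩
  · rintro ⟨_, ⟨p, hp, rfl⟩, rfl⟩
    exact ⟨p, hp, by simp only; module⟩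

/-- The triangle shrunk towards an interior point lies in the interior. -/
theorem shrink_subset_interior {g : Plane} (hg : g ∈ interior (cornerTriangle A b c)) {t : ℝ}
    (ht0 : 0 ≤ t) (ht1 : t < 1) :
    cornerTriangle ((1 - t) • g + t • A) (t • b) (t • c) ⊆ interior (cornerTriangle A b c) := by
  intro z hz
  obtain ⟨z', hz', rfl⟩ := mem_shrink_iff.mp hz
  exact (convex_cornerTriangle A b c).combo_interior_self_mem_interior hg hz' (by linarith) ht0
    (by ring)

theorem eventually_mem_shrink {g : Plane} {t : ℕ → ℝ} (ht0 : ∀ n, 0 < t n)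
    (ht : Tendsto t atTop (𝓝 1)) {z : Plane} (hz : z ∈ interior (cornerTriangle A b c)) :
    ∀ᶠ n in atTop, z ∈ cornerTriangle ((1 - t n) • g + t n • A) (t n • b) (t n • c) := by
  have h1 : Tendsto (fun n => g + (t n)⁻¹ • (z - g)) atTop (𝓝 (g + (1 : ℝ)⁻¹ • (z - g))) :=
    tendsto_const_nhds.add ((ht.inv₀ one_ne_zero).smul_const _)
  rw [inv_one, one_smul, add_sub_cancel] at h1
  filter_upwards [h1.eventually (mem_interior_iff_mem_nhds.mp hz)] with n hn
  refine mem_shrink_iff.mpr ⟨_, hn, ?_⟩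
  rw [smul_add, smul_smul, mul_inv_cancel₀ (ht0 n).ne']
  module

theorem norm_sum_smul_le (d : Plane) (H : Grad Plane) :
    ‖d 0 • H 0 + d 1 • H 1‖ ≤ ‖H‖ * ‖d‖ := by
  have h1 : ‖d 0 • H 0 + d 1 • H 1‖ ≤ |d 0| * ‖H 0‖ + |d 1| * ‖H 1‖ := by
    refine (norm_add_le _ _).trans ?_
    rw [norm_smul, norm_smul, Real.norm_eq_abs, Real.norm_eq_abs]
  have hd : ‖d‖ ^ 2 = |d 0| ^ 2 + |d 1| ^ 2 := by
    rw [EuclideanSpace.norm_sq_eq, Fin.sum_univ_two, Real.norm_eq_abs, Real.norm_eq_abs]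
  have hH : ‖H‖ ^ 2 = ‖H 0‖ ^ 2 + ‖H 1‖ ^ 2 := by
    rw [PiLp.norm_sq_eq_of_L2, Fin.sum_univ_two]
  refine h1.trans ((sq_le_sq₀ (by positivity) (by positivity)).mp ?_)
  rw [mul_pow, hd, hH]
  nlinarith [sq_nonneg (|d 0| * ‖H 1‖ - |d 1| * ‖H 0‖)]

/-- Second derivatives of a mollification are dominated by the mollified weak Hessian. -/
theorem abs_second_deriv_mollify_le {U : Set Plane} (hU : IsOpen U) {v : Plane → ℝ}
    {G : Plane → Grad ℝ} {H : Plane → Grad Plane} (hG : IsWeakGrad U v G) (hH : IsWeakGrad U G H)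
    (hvi : IntegrableOn v U) (hGi : IntegrableOn G U) (hHi : IntegrableOn H U) {m : ℕ} {z : Plane}
    {δ : ℝ} (hm : 1 / (m + 1 : ℝ) < δ) (hδ : Metric.closedBall z δ ⊆ U) (e d : Plane) :
    |fderiv ℝ (fun y => fderiv ℝ (mollify m (U.indicator v)) y e) z d| ≤
      ‖mollify m (U.indicator H) z‖ * ‖e‖ * ‖d‖ := by
  have hloc : (fun y => fderiv ℝ (mollify m (U.indicator v)) y e) =ᶠ[𝓝 z]
      fun y => inner ℝ (mollify m (U.indicator G) y) e := by
    filter_upwards [Metric.ball_mem_nhds z (sub_pos.mpr hm)] with y hy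
    rw [← inner_classicalGrad, classicalGrad_mollify hU hG hvi hGi]
    refine (Metric.closedBall_subset_closedBall' ?_).trans hδ
    linarith [Metric.mem_ball.mp hy]
  have hGl : LocallyIntegrable (U.indicator G) :=
    (hGi.integrable_indicator hU.measurableSet).locallyIntegrable
  have hd : DifferentiableAt ℝ (mollify m (U.indicator G)) z :=
    (contDiff_mollify m hGl).differentiable (by simp) z
  have hz : Metric.closedBall z (1 / (m + 1 : ℝ)) ⊆ U :=
    (Metric.closedBall_subset_closedBall hm.le).trans hδ
  rw [hloc.fderiv_eq, fderiv_inner_apply ℝ hd (differentiableAt_const e)]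
  simp only [fderiv_const_apply, zero_apply, inner_zero_right, zero_add]
  have hdz : fderiv ℝ (mollify m (U.indicator G)) z d =
      d 0 • mollify m (U.indicator H) z 0 + d 1 • mollify m (U.indicator H) z 1 := by
    conv_lhs => rw [plane_eq_sum_single d]
    rw [map_add, map_smul, map_smul, fderiv_mollify hU hH hGi hHi hz,
      fderiv_mollify hU hH hGi hHi hz]
  rw [hdz]
  refine (abs_real_inner_le_norm _ _).trans ?_
  have := mul_le_mul_of_nonneg_right (norm_sum_smul_le d (mollify m (U.indicator H) z))
    (norm_nonneg e)
  linarith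

theorem continuous_mollify {F : Type} [NormedAddCommGroup F] [NormedSpace ℝ F] [CompleteSpace F]
    (n : ℕ) {g : Plane → F} (hg : LocallyIntegrable g) : Continuous (mollify n g) :=
  (contDiff_mollify n hg).continuous

/-- The interpolation estimate for Sobolev functions on a triangle. The triangle is shrunk into
its interior, where `v` can be mollified, and the limit is taken with Fatou's lemma. -/
theorem seminorm1_sub_interpolant_le {v : Plane → ℝ} {q : Plane →ᵃ[ℝ] ℝ} {h κ : ℝ} {p : ℝ≥0∞}
    (hp : p = 2 ∨ p = ⊤) (hne : (interior (cornerTriangle A b c)).Nonempty)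
    (hbc : LinearIndependent ℝ ![b, c])
    (hbh : ‖b‖ ≤ h) (hch : ‖c‖ ≤ h) (hcbh : ‖c - b‖ ≤ h) (hκ : 0 ≤ κ)
    (hcomp : ∀ p : Plane, ‖p‖ ≤ κ * (|inner ℝ p b| / ‖b‖ + |inner ℝ p c| / ‖c‖))
    (hv : ContinuousOn v (cornerTriangle A b c))
    (hW : MemW2 (interior (cornerTriangle A b c)) p v)
    (hqA : q A = v A) (hqb : q (A + b) = v (A + b)) (hqc : q (A + c) = v (A + c)) :
    seminorm1 (interior (cornerTriangle A b c)) (interior (cornerTriangle A b c)) p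
        (fun x => v x - q x) ≤
      ENNReal.ofReal (4 * κ * h) *
        seminorm2 (interior (cornerTriangle A b c)) (interior (cornerTriangle A b c)) p v := by
  set K := cornerTriangle A b c with hK
  set U := interior K with hUdef
  have hU : IsOpen U := isOpen_interior
  have hUm := hU.measurableSet
  have hKc : IsCompact K := isCompact_cornerTriangle A b c
  have hUfin : volume U < ⊤ := (measure_mono interior_subset).trans_lt hKc.measure_lt_top
  have : IsFiniteMeasure (volume.restrict U) := ⟨by simpa using hUfin⟩
  have hp1 : 1 ≤ p := by rcases hp with rfl | rfl <;> norm_num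
  have hb0 : b ≠ 0 := hbc.ne_zero 0
  have hc0 : c ≠ 0 := hbc.ne_zero 1
  set G := weakGrad U v with hGdef
  set Hs := weakGrad U G with hHdef
  have hG : IsWeakGrad U v G := hW.1.1.isWeakGrad
  have hH : IsWeakGrad U G Hs := hW.2.1.isWeakGrad
  have hvi : IntegrableOn v U := hW.1.2.1.integrable hp1
  have hGi : IntegrableOn G U := hW.1.2.2.integrable hp1
  have hHi : IntegrableOn Hs U := MemLp.integrable hp1 hW.2.2
  have hVi : Integrable (U.indicator v) := hvi.integrable_indicator hUm
  have hGI : Integrable (U.indicator G) := hGi.integrable_indicator hUm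
  have hHI : Integrable (U.indicator Hs) := hHi.integrable_indicator hUm
  obtain ⟨g, hg⟩ := hne
  -- the shrunk triangles
  set t : ℕ → ℝ := fun n => 1 - 1 / (n + 2 : ℝ) with ht
  have ht0 : ∀ n, 0 < t n := fun n => by
    simp only [ht, sub_pos]
    rw [div_lt_one (by positivity)]
    have : (0 : ℝ) ≤ n := n.cast_nonneg
    linarith
  have ht1 : ∀ n, t n < 1 := fun n => by
    simp only [ht, sub_lt_self_iff]
    positivity
  have htl : Tendsto t atTop (𝓝 1) := by
    have h1 : Tendsto (fun n : ℕ => 1 / ((n : ℝ) + 2)) atTop (𝓝 0) := by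
      refine tendsto_const_nhds.div_atTop ?_
      exact tendsto_atTop_add_const_right _ _ tendsto_natCast_atTop_atTop
    simpa [ht] using h1.const_sub 1
  set A' : ℕ → Plane := fun n => (1 - t n) • g + t n • A with hA'
  set Kn : ℕ → Set Plane := fun n => cornerTriangle (A' n) (t n • b) (t n • c) with hKn
  have hKnU : ∀ n, Kn n ⊆ U := fun n => shrink_subset_interior hg (ht0 n).le (ht1 n)
  -- the vertices of the shrunk triangles tend to those of the triangle
  have hvert : ∀ e : Plane, A + e ∈ K → (∀ n, A' n + t n • e ∈ U) ∧
      Tendsto (fun n => v (A' n + t n • e)) atTop (𝓝 (v (A + e))) := by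
    intro e he
    have hmem : ∀ n, A' n + t n • e ∈ U := fun n => by
      have : A' n + t n • e = (1 - t n) • g + t n • (A + e) := by simp only [hA']; module
      rw [this]
      exact (convex_cornerTriangle A b c).combo_interior_self_mem_interior hg he
        (by linarith [ht1 n]) (ht0 n).le (by ring)
    refine ⟨hmem, (hv _ he).tendsto.comp (tendsto_nhdsWithin_iff.mpr
      ⟨?_, Eventually.of_forall fun n => interior_subset (hmem n)⟩)⟩
    have : Tendsto (fun n => (1 - t n) • g + t n • A + t n • e) atTop
        (𝓝 (((1 : ℝ) - 1) • g + (1 : ℝ) • A + (1 : ℝ) • e)) :=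
      (((htl.const_sub 1).smul_const g).add (htl.smul_const A)).add (htl.smul_const e)
    simpa using this
  obtain ⟨hKA, hKb, hKcc⟩ := vertices_mem_cornerTriangle A b c
  have hcontAt : ∀ z ∈ U, ContinuousAt (U.indicator v) z := by
    intro z hz
    have h1 : ContinuousAt v z := (hv z (interior_subset hz)).continuousAt
      (mem_interior_iff_mem_nhds.mp hz)
    refine h1.congr ?_
    filter_upwards [hU.mem_nhds hz] with y hy
    rw [Set.indicator_of_mem hy]
  -- mollification indices adapted to the shrunk triangles
  have hex : ∀ n, ∃ m : ℕ, n ≤ m ∧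
      (∃ δ, 1 / (m + 1 : ℝ) < δ ∧ ∀ z ∈ Kn n, Metric.closedBall z δ ⊆ U) ∧
      ∀ e ∈ ({0, b, c} : Set Plane),
        |mollify m (U.indicator v) (A' n + t n • e) - v (A' n + t n • e)| < 1 / (n + 1 : ℝ) := by
    intro n
    obtain ⟨δ, hδ0, hδ⟩ :=
      (isCompact_cornerTriangle (A' n) (t n • b) (t n • c)).exists_cthickening_subset_open
      hU (hKnU n)
    have ev1 : ∀ᶠ m : ℕ in atTop, 1 / (m + 1 : ℝ) < δ :=
      tendsto_one_div_add_atTop_nhds_zero_nat.eventually_lt_const hδ0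
    have ev2 : ∀ e ∈ ({0, b, c} : Set Plane), ∀ᶠ m : ℕ in atTop,
        |mollify m (U.indicator v) (A' n + t n • e) - v (A' n + t n • e)| < 1 / (n + 1 : ℝ) := by
      intro e he
      have heK : A + e ∈ K := by
        rcases he with rfl | rfl | rfl
        · simpa using hKA
        · exact hKb
        · exact hKcc
      have hm := (hvert e heK).1 n
      have h1 := tendsto_mollify_of_continuousAt hVi.aestronglyMeasurable (hcontAt _ hm)
      rw [Set.indicator_of_mem hm] at h1
      have h2 := Metric.tendsto_nhds.mp h1 (1 / (n + 1 : ℝ)) (by positivity)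
      simpa only [Real.dist_eq] using h2
    have ev3 := (Set.toFinite ({0, b, c} : Set Plane)).eventually_all.mpr ev2
    obtain ⟨m, h1, h2, h3⟩ := (ev1.and (ev3.and (eventually_ge_atTop n))).exists
    refine ⟨m, h3, ⟨δ, h1, fun z hz => ?_⟩, h2⟩
    exact (Metric.closedBall_subset_cthickening hz δ).trans hδ
  choose m hmn hmδ hmv using hex
  have hmtop : Tendsto m atTop atTop := tendsto_atTop_mono hmn tendsto_id
  set φ : ℕ → Plane → ℝ := fun n => mollify (m n) (U.indicator v) with hφ
  have hind : ∀ n, LinearIndependent ℝ ![t n • b, t n • c] := by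
    intro n
    rw [LinearIndependent.pair_iff] at hbc ⊢
    intro x y hxy
    rw [smul_smul, smul_smul] at hxy
    have := hbc _ _ hxy
    simpa [(ht0 n).ne'] using this
  have hqn : ∀ n, ∃ qn : Plane →ᵃ[ℝ] ℝ, qn (A' n) = φ n (A' n) ∧
      qn (A' n + t n • b) = φ n (A' n + t n • b) ∧ qn (A' n + t n • c) = φ n (A' n + t n • c) :=
    fun n => exists_affineMap_of_linearIndependent (A' n) (hind n) _ _ _
  choose qn hqnA hqnb hqnc using hqn
  -- the smooth estimate on the shrunk triangles
  have hSI : ∀ n, SmoothInterpolation (A' n) (t n • b) (t n • c) (φ n)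
      (fun z => ‖mollify (m n) (U.indicator Hs) z‖) (qn n) h κ := by
    intro n
    have hnorm : ∀ e : Plane, ‖t n • e‖ ≤ ‖e‖ := fun e => by
      rw [norm_smul, Real.norm_of_nonneg (ht0 n).le]
      nlinarith [norm_nonneg e, ht1 n]
    have hquot : ∀ p e : Plane, |inner ℝ p (t n • e)| / ‖t n • e‖ = |inner ℝ p e| / ‖e‖ := by
      intro p e
      rw [inner_smul_right, abs_mul, norm_smul, Real.norm_eq_abs,
        mul_div_mul_left _ _ (abs_pos.mpr (ht0 n).ne').ne']
    obtain ⟨δ, hδ1, hδ2⟩ := hmδ n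
    exact
      { smooth := contDiff_mollify _ hVi.locallyIntegrable
        cont := (continuous_mollify _ hHI.locallyIntegrable).norm
        nonneg := fun _ => norm_nonneg _
        bound := fun z hz e d =>
          abs_second_deriv_mollify_le hU hG hH hvi hGi hHi hδ1 (hδ2 z hz) e d
        interp := hqnA n
        interp_b := hqnb n
        interp_c := hqnc n
        b_ne := smul_ne_zero (ht0 n).ne' hb0
        c_ne := smul_ne_zero (ht0 n).ne' hc0
        b_le := (hnorm b).trans hbh
        c_le := (hnorm c).trans hch
        sub_le := by rw [← smul_sub]; exact (hnorm _).trans hcbh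
        κ_nonneg := hκ
        comp := fun p => by rw [hquot, hquot]; exact hcomp p }
  set S := eLpNorm Hs p (volume.restrict U) with hS
  have hSI_ind : eLpNorm (U.indicator Hs) p volume = S := eLpNorm_indicator_eq_eLpNorm_restrict hUm
  have hStop : S ≠ ⊤ := hW.2.2.2.ne
  have hest : ∀ n, eLpNorm (fun z => classicalGrad (φ n) z - (qn n).grad) p
      (volume.restrict (Kn n)) ≤ ENNReal.ofReal (4 * κ * h) * S := by
    intro n
    rcases hp with rfl | rfl
    · refine (hSI n).eLpNorm_two_grad_le.trans ?_
      gcongr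
      rw [eLpNorm_norm, ← hSI_ind]
      exact (eLpNorm_mono_measure _ Measure.restrict_le_self).trans
        (eLpNorm_mollify_le _ (Or.inl rfl) hHI.aestronglyMeasurable)
    · refine (hSI n).eLpNorm_top_grad_le hStop fun z => ?_
      rw [enorm_norm]
      refine enorm_mollify_le_of_ae _ ?_ z
      rw [← hSI_ind, eLpNorm_exponent_top]
      exact ae_le_eLpNormEssSup
  -- convergence of the interpolants
  have hφv : ∀ e ∈ ({0, b, c} : Set Plane), A + e ∈ K →
      Tendsto (fun n => φ n (A' n + t n • e)) atTop (𝓝 (v (A + e))) := by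
    intro e he heK
    have h1 : Tendsto (fun n => φ n (A' n + t n • e) - v (A' n + t n • e)) atTop (𝓝 0) :=
      squeeze_zero_norm (fun n => (hmv n e he).le) tendsto_one_div_add_atTop_nhds_zero_nat
    simpa using h1.add (hvert e heK).2
  have hgrad_e : ∀ e ∈ ({b, c} : Set Plane), A + e ∈ K →
      (∀ n, qn n (A' n + t n • e) = φ n (A' n + t n • e)) → q (A + e) = v (A + e) →
      Tendsto (fun n => inner ℝ ((qn n).grad - q.grad) e) atTop (𝓝 0) := by
    intro e he heK hqe hqe'
    have h0 := hφv 0 (by simp) (by simpa using hKA)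
    have h1 := hφv e (Or.inr he) heK
    have h2 : Tendsto (fun n => (t n)⁻¹ * (φ n (A' n + t n • e) - φ n (A' n + t n • (0 : Plane))))
        atTop (𝓝 ((1 : ℝ)⁻¹ * (v (A + e) - v (A + 0)))) :=
      (htl.inv₀ one_ne_zero).mul (h1.sub h0)
    have e1 : ∀ n, inner ℝ ((qn n).grad - q.grad) e =
        (t n)⁻¹ * (φ n (A' n + t n • e) - φ n (A' n + t n • (0 : Plane))) -
          (1 : ℝ)⁻¹ * (v (A + e) - v (A + 0)) := by
      intro n
      have l1 : (qn n) (A' n + t n • e) - (qn n) (A' n) = t n * (qn n).linear e := by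
        have := (qn n).linearMap_vsub (A' n + t n • e) (A' n)
        simpa using this.symm
      have l2 : q (A + e) - q A = q.linear e := by
        have := q.linearMap_vsub (A + e) A
        simpa using this.symm
      rw [inner_sub_left, AffineMap.inner_grad, AffineMap.inner_grad, smul_zero, add_zero, add_zero,
        ← hqe, ← hqnA, l1, ← hqe', ← hqA, l2, inv_mul_cancel_left₀ (ht0 n).ne', inv_one, one_mul]
    simp_rw [e1]
    simpa using h2.sub_const ((1 : ℝ)⁻¹ * (v (A + e) - v (A + 0)))
  have hgrad : Tendsto (fun n => (qn n).grad) atTop (𝓝 q.grad) := by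
    rw [tendsto_iff_norm_sub_tendsto_zero]
    refine squeeze_zero (fun _ => norm_nonneg _) (fun n => hcomp ((qn n).grad - q.grad)) ?_
    have h1 := (hgrad_e b (by simp) hKb hqnb hqb).abs.div_const ‖b‖
    have h2 := (hgrad_e c (by simp) hKcc hqnc hqc).abs.div_const ‖c‖
    simpa using (h1.add h2).const_mul κ
  -- Fatou's lemma
  have hae : ∀ᵐ x, Tendsto (fun n => (Kn n).indicator
      (fun z => classicalGrad (φ n) z - (qn n).grad) x) atTop
      (𝓝 (U.indicator (fun z => G z - q.grad) x)) := by
    filter_upwards [ae_tendsto_mollify hGI.locallyIntegrable] with x hx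
    by_cases hxU : x ∈ U
    · rw [Set.indicator_of_mem hxU] at hx ⊢
      have h1 := (hx.comp hmtop).sub hgrad
      refine h1.congr' ?_
      filter_upwards [eventually_mem_shrink (g := g) ht0 htl hxU] with n hn
      rw [Set.indicator_of_mem hn]
      obtain ⟨δ, hδ1, hδ2⟩ := hmδ n
      rw [hφ, classicalGrad_mollify hU hG hvi hGi
        ((Metric.closedBall_subset_closedBall hδ1.le).trans (hδ2 x hn))]
      rfl
    · rw [Set.indicator_of_notMem hxU]
      refine tendsto_const_nhds.congr fun n => ?_
      rw [Set.indicator_of_notMem fun h => hxU (hKnU n h)]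
  have hKnm : ∀ n, MeasurableSet (Kn n) := fun n =>
    (isCompact_cornerTriangle _ _ _).isClosed.measurableSet
  have hfatou := Lp.eLpNorm_lim_le_liminf_eLpNorm (p := p) (μ := volume)
    (f := fun n => (Kn n).indicator (fun z => classicalGrad (φ n) z - (qn n).grad))
    (fun n => ((((measurable_classicalGrad (φ n)).sub_const _).aestronglyMeasurable).indicator
      (hKnm n))) _ hae
  have hlim : eLpNorm (fun z => G z - q.grad) p (volume.restrict U) ≤
      ENNReal.ofReal (4 * κ * h) * S := by
    rw [← eLpNorm_indicator_eq_eLpNorm_restrict hUm]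
    refine hfatou.trans ?_
    refine liminf_le_of_le (by isBoundedDefault) fun a ha => ?_
    obtain ⟨n, hn⟩ := ha.exists
    refine hn.trans ?_
    rw [eLpNorm_indicator_eq_eLpNorm_restrict (hKnm n)]
    exact hest n
  have hsub : weakGrad U (fun x => v x - q x) =ᵐ[volume.restrict U] fun z => G z - q.grad :=
    (hG.sub q.isWeakGrad).weakGrad_ae_eq hU
  rw [seminorm1, eLpNorm_congr_ae hsub]
  exact hlim

end Reduction

/-! ### The circumradius constant and the maximum-angle constant -/

section Constants

theorem range_points_eq (T : Affine.Triangle ℝ Plane) {i j k : Fin 3} (hij : i ≠ j) (hjk : j ≠ k)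
    (hik : i ≠ k) : Set.range T.points = {T.points i, T.points j, T.points k} := by
  have h : ∀ i j k m : Fin 3, i ≠ j → j ≠ k → i ≠ k → m = i ∨ m = j ∨ m = k := by decide
  ext x
  constructor
  · rintro ⟨m, rfl⟩
    rcases h i j k m hij hjk hik with rfl | rfl | rfl <;> simp
  · rintro (rfl | rfl | rfl) <;> exact ⟨_, rfl⟩

theorem closedInterior_eq_cornerTriangle (T : Affine.Triangle ℝ Plane) {i j k : Fin 3}
    (hij : i ≠ j) (hjk : j ≠ k) (hik : i ≠ k) :
    T.closedInterior =
      cornerTriangle (T.points i) (T.points j - T.points i) (T.points k - T.points i) := by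
  rw [← Affine.Simplex.convexHull_eq_closedInterior, range_points_eq T hij hjk hik]
  obtain ⟨h1, h2, h3⟩ := vertices_mem_cornerTriangle (T.points i) (T.points j - T.points i)
    (T.points k - T.points i)
  rw [add_sub_cancel] at h2 h3
  refine (convexHull_min ?_ (convex_cornerTriangle _ _ _)).antisymm ?_
  · rintro x (rfl | rfl | rfl)
    exacts [h1, h2, h3]
  · rintro _ ⟨⟨x, y⟩, ⟨hx, hy, hxy⟩, rfl⟩
    simp only at hx hy hxy
    have hc := convex_convexHull ℝ ({T.points i, T.points j, T.points k} : Set Plane)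
    have hs := subset_convexHull ℝ ({T.points i, T.points j, T.points k} : Set Plane)
    have := hc.sum_mem (t := Finset.univ) (w := ![1 - x - y, x, y])
      (z := ![T.points i, T.points j, T.points k])
      (by intro m _; fin_cases m <;> simp <;> linarith)
      (by simp [Fin.sum_univ_three]; ring)
      (by intro m _; fin_cases m <;> apply hs <;> simp)
    convert this using 1
    simp only [Fin.sum_univ_three, Matrix.cons_val_zero, Matrix.cons_val_one, Matrix.cons_val]
    module

theorem linearIndependent_sides (T : Affine.Triangle ℝ Plane) {i j k : Fin 3}
    (hij : i ≠ j) (hjk : j ≠ k) (hik : i ≠ k) :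
    LinearIndependent ℝ ![T.points j - T.points i, T.points k - T.points i] := by
  have h := (affineIndependent_iff_linearIndependent_vsub ℝ T.points i).mp T.independent
  have h2 := h.comp (![⟨j, hij.symm⟩, ⟨k, hik.symm⟩] : Fin 2 → {x : Fin 3 // x ≠ i}) (by
    intro a b hab
    fin_cases a <;> fin_cases b <;> simp_all)
  have e : ![T.points j - T.points i, T.points k - T.points i] =
      ((fun m : {x : Fin 3 // x ≠ i} => T.points m -ᵥ T.points i) ∘
        ![⟨j, hij.symm⟩, ⟨k, hik.symm⟩]) := by
    ext m
    fin_cases m <;> simp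
  rw [e]
  exact h2

theorem affineSpan_range_points (T : Affine.Triangle ℝ Plane) :
    affineSpan ℝ (Set.range T.points) = ⊤ :=
  T.independent.affineSpan_eq_top_iff_card_eq_finrank_add_one.mpr (by simp)

theorem interior_closedInterior_nonempty (T : Affine.Triangle ℝ Plane) :
    (interior T.closedInterior).Nonempty := by
  rw [← Affine.Simplex.convexHull_eq_closedInterior,
    interior_convexHull_nonempty_iff_affineSpan_eq_top]
  exact affineSpan_range_points T

/-- A plane vector is bounded by its components along two directions at an angle `θ`, up to the
factor `1 / sin θ`. -/
theorem norm_le_inv_sin_mul {b c : Plane} (hb : b ≠ 0) (hc : c ≠ 0)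
    (hs : 0 < Real.sin (InnerProductGeometry.angle b c)) (p : Plane) :
    ‖p‖ ≤ (Real.sin (InnerProductGeometry.angle b c))⁻¹ *
      (|inner ℝ p b| / ‖b‖ + |inner ℝ p c| / ‖c‖) := by
  set s := Real.sin (InnerProductGeometry.angle b c) with hsdef
  have hb' : 0 < ‖b‖ := norm_pos_iff.mpr hb
  have hc' : 0 < ‖c‖ := norm_pos_iff.mpr hc
  have hsin := InnerProductGeometry.sin_angle_mul_norm_mul_norm b c
  rw [← hsdef] at hsin
  have hge : 0 ≤ inner ℝ b b * inner ℝ c c - inner ℝ b c * inner ℝ b c :=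
    sub_nonneg.mpr (real_inner_mul_inner_self_le b c)
  have hsq : (s * (‖b‖ * ‖c‖)) ^ 2 = ‖b‖ ^ 2 * ‖c‖ ^ 2 - inner ℝ b c ^ 2 := by
    rw [hsin, Real.sq_sqrt hge, real_inner_self_eq_norm_sq, real_inner_self_eq_norm_sq]
    ring
  -- the Gram identity for three vectors in the plane
  have hid : ‖p‖ ^ 2 * (‖b‖ ^ 2 * ‖c‖ ^ 2 - inner ℝ b c ^ 2) =
      (inner ℝ p b * ‖c‖) ^ 2 + (inner ℝ p c * ‖b‖) ^ 2 -
        2 * inner ℝ p b * inner ℝ p c * inner ℝ b c := by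
    simp only [mul_pow, EuclideanSpace.norm_sq_eq, Fin.sum_univ_two, PiLp.inner_apply,
      Real.norm_eq_abs, sq_abs, RCLike.inner_apply, conj_trivial]
    ring
  have hcs : - (2 * inner ℝ p b * inner ℝ p c * inner ℝ b c) ≤
      2 * (|inner ℝ p b| * ‖c‖) * (|inner ℝ p c| * ‖b‖) := by
    refine (neg_le_abs _).trans ?_
    rw [abs_mul, abs_mul, abs_mul, abs_two]
    have := abs_real_inner_le_norm b c
    have h0 : 0 ≤ |inner ℝ p b| * |inner ℝ p c| := by positivity
    nlinarith
  have hfin : ‖p‖ * (s * (‖b‖ * ‖c‖)) ≤ |inner ℝ p b| * ‖c‖ + |inner ℝ p c| * ‖b‖ := by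
    refine (sq_le_sq₀ (by positivity) (by positivity)).mp ?_
    rw [mul_pow, hsq, hid, add_sq, mul_pow |inner ℝ p b|, mul_pow |inner ℝ p c|, sq_abs, sq_abs,
      mul_pow, mul_pow]
    linarith
  rw [inv_mul_eq_div, le_div_iff₀ hs]
  have e : |inner ℝ p b| / ‖b‖ + |inner ℝ p c| / ‖c‖ =
      (|inner ℝ p b| * ‖c‖ + |inner ℝ p c| * ‖b‖) / (‖b‖ * ‖c‖) := by
    field_simp
  rw [e, le_div_iff₀ (by positivity)]
  linarith

variable (T : Affine.Triangle ℝ Plane) {i j k : Fin 3}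

theorem angle_points_eq :
    EuclideanGeometry.angle (T.points j) (T.points i) (T.points k) =
      InnerProductGeometry.angle (T.points j - T.points i) (T.points k - T.points i) := rfl

theorem sin_angle_pos (hij : i ≠ j) (hjk : j ≠ k) (hik : i ≠ k) :
    0 < Real.sin (EuclideanGeometry.angle (T.points j) (T.points i) (T.points k)) := by
  refine lt_of_le_of_ne (InnerProductGeometry.sin_angle_nonneg _ _) fun h => ?_
  have h1 := T.dist_div_sin_angle_eq_two_mul_circumradius hij.symm hjk hik
  rw [← h, div_zero] at h1
  linarith [T.circumradius_pos]

theorem norm_sub_points_le_diam (i j : Fin 3) :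
    ‖T.points j - T.points i‖ ≤ Metric.diam T.closedInterior := by
  rw [← dist_eq_norm]
  exact Metric.dist_le_diam_of_mem T.isCompact_closedInterior.isBounded
    (T.point_mem_closedInterior j) (T.point_mem_closedInterior i)

/-- The interpolation estimate in terms of one angle of the triangle. -/
theorem seminorm1_sub_le_of_angle (hij : i ≠ j) (hjk : j ≠ k) (hik : i ≠ k) {v : Plane → ℝ}
    {q : Plane →ᵃ[ℝ] ℝ} {p : ℝ≥0∞} (hp : p = 2 ∨ p = ⊤) {h : ℝ}
    (hh : ∀ m n, ‖T.points m - T.points n‖ ≤ h)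
    (hv : ContinuousOn v T.closedInterior) (hW : MemW2 (interior T.closedInterior) p v)
    (hq : IsInterpolant T v q) :
    seminorm1 (interior T.closedInterior) (interior T.closedInterior) p (fun x => v x - q x) ≤
      ENNReal.ofReal (4 *
        (Real.sin (EuclideanGeometry.angle (T.points j) (T.points i) (T.points k)))⁻¹ * h) *
        seminorm2 (interior T.closedInterior) (interior T.closedInterior) p v := by
  have hne := interior_closedInterior_nonempty T
  have hs := sin_angle_pos T hij hjk hik
  have hli := linearIndependent_sides T hij hjk hik
  rw [closedInterior_eq_cornerTriangle T hij hjk hik] at hv hW hne ⊢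
  refine seminorm1_sub_interpolant_le hp hne hli (hh _ _) (hh _ _) ?_ (inv_nonneg.mpr hs.le)
    (fun p => norm_le_inv_sin_mul (hli.ne_zero 0) (hli.ne_zero 1) hs p) hv hW (hq i) ?_ ?_
  · rw [sub_sub_sub_cancel_right]; exact hh _ _
  · rw [add_sub_cancel]; exact hq j
  · rw [add_sub_cancel]; exact hq k

theorem exists_isCircumradiusConstant : ∃ C : ℝ, 0 < C ∧ IsCircumradiusConstant C := by
  refine ⟨8, by norm_num, fun K v q hv hW hq => ?_⟩
  -- the vertex opposite to a longest side
  obtain ⟨⟨j, k⟩, hmax⟩ := Finite.exists_max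
    fun m : Fin 3 × Fin 3 => dist (K.points m.1) (K.points m.2)
  have hjk : j ≠ k := by
    rintro rfl
    have := hmax (0, 1)
    simp only [dist_self] at this
    have h01 : K.points 0 = K.points 1 := dist_le_zero.mp this
    exact absurd (K.independent.injective h01) (by decide)
  obtain ⟨i, hij, hik⟩ : ∃ i : Fin 3, i ≠ j ∧ i ≠ k := by
    have h : ∀ j k : Fin 3, ∃ i : Fin 3, i ≠ j ∧ i ≠ k := by decide
    exact h j k
  have h1 := K.dist_div_sin_angle_eq_two_mul_circumradius hij.symm hjk hik
  have key := seminorm1_sub_le_of_angle K hij hjk hik (Or.inr rfl)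
    (h := dist (K.points j) (K.points k))
    (fun m n => by rw [← dist_eq_norm]; exact hmax (m, n)) hv hW hq
  -- by the law of sines, `h_K / sin θ = 2 R_K`
  refine key.trans_eq ?_
  congr 2
  rw [div_eq_inv_mul] at h1
  rw [mul_assoc, h1]
  ring

theorem exists_isMaxAngleConstant {α : ℝ} (hα : α < Real.pi) :
    ∃ C : ℝ, 0 < C ∧ IsMaxAngleConstant α C := by
  -- a triangle has an angle of at least `π / 3`
  have hang : ∀ K : Affine.Triangle ℝ Plane, ∃ i j k : Fin 3, i ≠ j ∧ j ≠ k ∧ i ≠ k ∧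
      Real.pi / 3 ≤ EuclideanGeometry.angle (K.points j) (K.points i) (K.points k) := by
    intro K
    have hsum := EuclideanGeometry.angle_add_angle_add_angle_eq_pi (K.points 2)
      (K.independent.injective.ne (show (1 : Fin 3) ≠ 0 by decide))
    by_contra! hcon
    have h1 := hcon 1 0 2 (by decide) (by decide) (by decide)
    have h2 := hcon 2 1 0 (by decide) (by decide) (by decide)
    have h3 := hcon 0 2 1 (by decide) (by decide) (by decide)
    linarith
  rcases lt_or_ge α (Real.pi / 3) with hlt | hge
  · refine ⟨1, one_pos, fun K v q hK => ?_⟩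
    obtain ⟨i, j, k, hij, hjk, hik, h⟩ := hang K
    exact absurd (h.trans (hK j i k hij.symm hik hjk)) (not_le.mpr hlt)
  · have hpi := Real.pi_pos
    set s := min (Real.sin (Real.pi / 3)) (Real.sin α) with hs
    have hs0 : 0 < s := lt_min (Real.sin_pos_of_pos_of_lt_pi (by linarith) (by linarith))
      (Real.sin_pos_of_pos_of_lt_pi (by linarith) hα)
    refine ⟨4 * s⁻¹, by positivity, fun K v q hK hv hW hq => ?_⟩
    obtain ⟨i, j, k, hij, hjk, hik, h⟩ := hang K
    have hle := hK j i k hij.symm hik hjk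
    -- the sine is concave, so on `[π / 3, α]` it is smallest at an endpoint
    have hsin : s ≤ Real.sin (EuclideanGeometry.angle (K.points j) (K.points i) (K.points k)) :=
      strictConcaveOn_sin_Icc.concaveOn.min_le_of_mem_Icc ⟨by linarith, by linarith⟩
        ⟨by linarith, hα.le⟩ ⟨h, hle⟩
    refine (seminorm1_sub_le_of_angle K hij hjk hik (Or.inl rfl)
      (fun m n => norm_sub_points_le_diam K n m) hv hW hq).trans ?_
    gcongr

/-- The altitudes of a triangle with sides at most `h` bound its circumradius. -/
theorem circumradius_le_of_height {h hbar : ℝ} (hbar0 : 0 < hbar)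
    (hh : Metric.diam T.closedInterior ≤ h) (hT : ∀ m, hbar ≤ T.height m) :
    T.circumradius ≤ h ^ 2 / (2 * hbar) := by
  have h01 : (0 : Fin 3) ≠ 1 := by decide
  have h12 : (1 : Fin 3) ≠ 2 := by decide
  have h02 : (0 : Fin 3) ≠ 2 := by decide
  have hs := sin_angle_pos T h01 h12 h02
  have hlaw := T.dist_div_sin_angle_eq_two_mul_circumradius h01.symm h12 h02
  set b := T.points 1 - T.points 0 with hb
  set c := T.points 2 - T.points 0 with hc
  have hli : LinearIndependent ℝ ![b, c] := linearIndependent_sides T h01 h12 h02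
  have hc0 : 0 < ‖c‖ := norm_pos_iff.mpr (hli.ne_zero 1)
  have hb0 : 0 < ‖b‖ := norm_pos_iff.mpr (hli.ne_zero 0)
  rw [angle_points_eq, ← hb, ← hc] at hs hlaw
  set s := Real.sin (InnerProductGeometry.angle b c) with hsdef
  -- the altitude at vertex `1` is at most its distance to the foot of the perpendicular
  have hht : T.height 1 ≤ ‖b‖ * s := by
    set y : Plane := T.points 0 + (inner ℝ b c / ‖c‖ ^ 2) • c with hy
    have hymem : y ∈ affineSpan ℝ (Set.range (T.faceOpposite 1).points) := by
      rw [Affine.Simplex.range_faceOpposite_points]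
      have m0 := subset_affineSpan ℝ _ (Set.mem_image_of_mem T.points
        (show (0 : Fin 3) ∈ ({1} : Set (Fin 3))ᶜ by simp))
      have m2 := subset_affineSpan ℝ _ (Set.mem_image_of_mem T.points
        (show (2 : Fin 3) ∈ ({1} : Set (Fin 3))ᶜ by simp))
      have := AffineMap.lineMap_mem (inner ℝ b c / ‖c‖ ^ 2) m0 m2
      rwa [AffineMap.lineMap_apply, vsub_eq_sub, vadd_eq_add, add_comm (_ • _) (T.points 0)] at this
    have hd : T.height 1 ≤ dist (T.points 1) y := by
      have := EuclideanGeometry.dist_orthogonalProjection_eq_infDist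
        (affineSpan ℝ (Set.range (T.faceOpposite 1).points)) (T.points 1)
      exact this.trans_le (Metric.infDist_le_dist_of_mem hymem)
    have hsin := InnerProductGeometry.sin_angle_mul_norm_mul_norm b c
    have hge : 0 ≤ inner ℝ b b * inner ℝ c c - inner ℝ b c * inner ℝ b c :=
      sub_nonneg.mpr (real_inner_mul_inner_self_le b c)
    have hsq : (s * (‖b‖ * ‖c‖)) ^ 2 = ‖b‖ ^ 2 * ‖c‖ ^ 2 - inner ℝ b c ^ 2 := by
      rw [hsin, Real.sq_sqrt hge, real_inner_self_eq_norm_sq, real_inner_self_eq_norm_sq]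
      ring
    have hdist : dist (T.points 1) y = ‖b - (inner ℝ b c / ‖c‖ ^ 2) • c‖ := by
      rw [dist_eq_norm, hy, hb]
      congr 1
      abel
    refine hd.trans ((sq_le_sq₀ dist_nonneg (by positivity)).mp ?_)
    rw [hdist, norm_sub_sq_real, inner_smul_right, norm_smul, mul_pow, Real.norm_eq_abs, sq_abs]
    have e : (‖b‖ * s) ^ 2 = (‖b‖ ^ 2 * ‖c‖ ^ 2 - inner ℝ b c ^ 2) / ‖c‖ ^ 2 := by
      rw [← hsq]; field_simp
    rw [e]
    apply le_of_eq
    field_simp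
    ring
  have ha : dist (T.points 1) (T.points 2) ≤ h := by
    rw [dist_eq_norm]; exact (norm_sub_points_le_diam T 2 1).trans hh
  have hbh : ‖b‖ ≤ h := (norm_sub_points_le_diam T 0 1).trans hh
  have hbs : hbar ≤ h * s := (hT 1).trans (hht.trans (by gcongr))
  have hh0 : 0 ≤ h := (norm_nonneg b).trans hbh
  have h2 : 2 * T.circumradius ≤ h ^ 2 / hbar := by
    rw [← hlaw, div_le_div_iff₀ hs hbar0]
    calc _ ≤ h * (h * s) := mul_le_mul ha hbs hbar0.le hh0
      _ = _ := by ring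
  have e : h ^ 2 / (2 * hbar) = (h ^ 2 / hbar) / 2 := by field_simp
  rw [e]
  linarith

end Constants

/-! ### The space `H¹₀` -/

section HOneZero

variable {U : Set Plane}

theorem tendsto_zero_of_sq_tendsto_zero {ι : Type*} {l : Filter ι} {a : ι → ℝ≥0∞}
    (h : Tendsto (fun n => a n ^ 2) l (𝓝 0)) : Tendsto a l (𝓝 0) := by
  have h1 : Tendsto (fun n => (a n ^ 2) ^ (1 / 2 : ℝ)) l (𝓝 ((0 : ℝ≥0∞) ^ (1 / 2 : ℝ))) :=
    (ENNReal.continuous_rpow_const.tendsto 0).comp h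
  rw [ENNReal.zero_rpow_of_pos (by norm_num)] at h1
  refine h1.congr fun n => ?_
  rw [← ENNReal.rpow_natCast, ← ENNReal.rpow_mul]
  norm_num

/-- Bounded pointwise convergence implies `L²` convergence on a set of finite measure. -/
theorem tendsto_eLpNorm_two_of_bounded {E : Type*} [NormedAddCommGroup E] (hU : volume U ≠ ⊤)
    {f : ℕ → Plane → E} {g : Plane → E} (hf : ∀ n, AEStronglyMeasurable (f n) (volume.restrict U))
    (hg : AEStronglyMeasurable g (volume.restrict U)) {M : ℝ} (hM : ∀ n x, ‖f n x‖ ≤ M)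
    (h : ∀ᵐ x ∂(volume.restrict U), Tendsto (fun n => f n x) atTop (𝓝 (g x))) :
    Tendsto (fun n => eLpNorm (fun x => f n x - g x) 2 (volume.restrict U)) atTop (𝓝 0) := by
  refine tendsto_zero_of_sq_tendsto_zero ?_
  simp_rw [eLpNorm_two_sq]
  have h0 : ∫⁻ _ in U, (0 : ℝ≥0∞) = 0 := by simp
  rw [← h0]
  refine tendsto_lintegral_of_dominated_convergence' (fun _ => ENNReal.ofReal (2 * M) ^ 2)
    (fun n => ((hf n).sub hg).enorm.pow_const 2) (fun n => ?_) ?_ ?_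
  · filter_upwards [h] with x hx
    have hgM : ‖g x‖ ≤ M := le_of_tendsto' hx.norm fun n => hM n x
    gcongr
    rw [← ofReal_norm]
    refine ENNReal.ofReal_le_ofReal ((norm_sub_le _ _).trans ?_)
    linarith [hM n x]
  · rw [lintegral_const]
    exact ENNReal.mul_ne_top (ENNReal.pow_ne_top ENNReal.ofReal_ne_top) (by simpa using hU)
  · filter_upwards [h] with x hx
    have h1 : Tendsto (fun n => ‖f n x - g x‖ₑ ^ 2) atTop (𝓝 (‖g x - g x‖ₑ ^ 2)) :=
      ENNReal.Tendsto.pow ((continuous_enorm.tendsto _).comp (hx.sub_const _))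
    simpa using h1

theorem MemW1.sub {p : ℝ≥0∞} (hU : IsOpen U) {v w : Plane → ℝ} (hv : MemW1 U p v)
    (hw : MemW1 U p w) : MemW1 U p (fun x => v x - w x) := by
  have h := hv.1.isWeakGrad.sub hw.1.isWeakGrad
  exact ⟨h.hasWeakGrad, hv.2.1.sub hw.2.1,
    (memLp_congr_ae (h.weakGrad_ae_eq hU)).mpr (hv.2.2.sub hw.2.2)⟩

theorem IsTestFunction.memLp {E : Type*} [NormedAddCommGroup E] {p : ℝ≥0∞} {f : Plane → E}
    (hf : Continuous f) (hc : HasCompactSupport f) : MemLp f p (volume.restrict U) :=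
  (hf.memLp_of_hasCompactSupport hc).restrict _

theorem MemH10.sub (hU : IsOpen U) {v w : Plane → ℝ} (hv : MemH10 U v) (hw : MemH10 U w) :
    MemH10 U (fun x => v x - w x) := by
  obtain ⟨hv1, φ, hφ, hφ1, hφ2⟩ := hv
  obtain ⟨hw1, ψ, hψ, hψ1, hψ2⟩ := hw
  have hmem : ∀ {χ : Plane → ℝ}, IsTestFunction U χ → AEStronglyMeasurable χ (volume.restrict U) :=
    fun hχ => hχ.1.continuous.aestronglyMeasurable
  refine ⟨hv1.sub hU hw1, fun n x => φ n x - ψ n x, fun n => ⟨(hφ n).1.sub (hψ n).1,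
    (hφ n).2.1.sub (hψ n).2.1, (tsupport_sub _ _).trans (Set.union_subset (hφ n).2.2 (hψ n).2.2)⟩,
    ?_, ?_⟩
  · have hlim := hφ1.add hψ1
    rw [add_zero] at hlim
    refine tendsto_of_tendsto_of_tendsto_of_le_of_le tendsto_const_nhds hlim
      (fun _ => zero_le) fun n => ?_
    have e : (fun x => φ n x - ψ n x - (v x - w x)) =
        (fun x => φ n x - v x) - fun x => ψ n x - w x := by
      ext x; simp only [Pi.sub_apply]; ring
    rw [e]
    exact eLpNorm_sub_le ((hmem (hφ n)).sub hv1.2.1.1) ((hmem (hψ n)).sub hw1.2.1.1) (by norm_num)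
  · have hlim := hφ2.add hψ2
    rw [add_zero] at hlim
    refine tendsto_of_tendsto_of_tendsto_of_le_of_le tendsto_const_nhds hlim
      (fun _ => zero_le) fun n => ?_
    have a1 := (hφ n).isWeakGrad.sub hv1.1.isWeakGrad
    have a2 := (hψ n).isWeakGrad.sub hw1.1.isWeakGrad
    have a3 := ((a1.sub a2).congr (v' := fun x => φ n x - ψ n x - (v x - w x))
      (ae_of_all _ fun x => by ring) (ae_eq_refl _)).weakGrad_ae_eq hU
    rw [seminorm1, eLpNorm_congr_ae a3, seminorm1, seminorm1,
      eLpNorm_congr_ae (a1.weakGrad_ae_eq hU), eLpNorm_congr_ae (a2.weakGrad_ae_eq hU)]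
    have hm : ∀ χ : Plane → ℝ, AEStronglyMeasurable (classicalGrad χ) (volume.restrict U) :=
      fun χ => (measurable_classicalGrad χ).aestronglyMeasurable
    exact eLpNorm_sub_le ((hm _).sub hv1.2.2.1) ((hm _).sub hw1.2.2.1) (by norm_num)

/-- A member of `H¹` that test functions approximate arbitrarily well is in `H¹₀`. -/
theorem memH10_of_forall_exists (hU : IsOpen U) {v : Plane → ℝ} {G : Plane → Grad ℝ}
    (hW : MemW1 U 2 v) (hG : IsWeakGrad U v G)
    (h : ∀ η : ℝ≥0∞, 0 < η → ∃ φ, IsTestFunction U φ ∧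
      eLpNorm (fun x => φ x - v x) 2 (volume.restrict U) ≤ η ∧
      eLpNorm (fun x => classicalGrad φ x - G x) 2 (volume.restrict U) ≤ η) : MemH10 U v := by
  choose φ h1 h2 h3 using fun n : ℕ => h ((n : ℝ≥0∞)⁻¹) (by simp)
  have hl : Tendsto (fun n : ℕ => (n : ℝ≥0∞)⁻¹) atTop (𝓝 0) :=
    ENNReal.tendsto_inv_nat_nhds_zero
  refine ⟨hW, φ, h1, tendsto_of_tendsto_of_tendsto_of_le_of_le tendsto_const_nhds hl
    (fun _ => zero_le) h2, tendsto_of_tendsto_of_tendsto_of_le_of_le tendsto_const_nhds hl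
    (fun _ => zero_le) fun n => ?_⟩
  rw [seminorm1, eLpNorm_congr_ae (((h1 n).isWeakGrad.sub hG).weakGrad_ae_eq hU)]
  exact h3 n

theorem LipschitzWith.memW1 {v : Plane → ℝ} {C : NNReal} (hv : LipschitzWith C v) (hU : IsOpen U)
    (hb : Bornology.IsBounded U) {p : ℝ≥0∞} : MemW1 U p v := by
  have hfin : volume U < ⊤ := hb.measure_lt_top
  have : IsFiniteMeasure (volume.restrict U) := ⟨by simpa using hfin⟩
  obtain ⟨M, hM⟩ := (hb.isCompact_closure.image hv.continuous).isBounded.exists_norm_le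
  refine ⟨hv.isWeakGrad.hasWeakGrad, ?_, ?_⟩
  · refine MemLp.of_bound hv.continuous.aestronglyMeasurable M ?_
    filter_upwards [ae_restrict_mem hU.measurableSet] with x hx
    exact hM _ ⟨x, subset_closure hx, rfl⟩
  · refine (memLp_congr_ae (hv.isWeakGrad.weakGrad_ae_eq hU)).mpr ?_
    exact MemLp.of_bound (measurable_classicalGrad v).aestronglyMeasurable C
      (ae_of_all _ hv.norm_classicalGrad_le)

/-- A Lipschitz function with compact support in `U` is approximated by its mollifications. -/
theorem LipschitzWith.exists_testFunction_approx {v : Plane → ℝ} {C : NNReal}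
    (hv : LipschitzWith C v) (hU : IsOpen U) (hb : Bornology.IsBounded U)
    (hc : HasCompactSupport v) (hs : tsupport v ⊆ U) {η : ℝ≥0∞} (hη : 0 < η) :
    ∃ φ, IsTestFunction U φ ∧ eLpNorm (fun x => φ x - v x) 2 (volume.restrict U) ≤ η ∧
      eLpNorm (fun x => classicalGrad φ x - classicalGrad v x) 2 (volume.restrict U) ≤ η := by
  have hfin : volume U ≠ ⊤ := hb.measure_lt_top.ne
  have hvi : Integrable v := hv.continuous.integrable_of_hasCompactSupport hc
  have hGm := measurable_classicalGrad v
  have hGi : Integrable (classicalGrad v) := by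
    rw [← integrableOn_iff_integrable_of_support_subset (s := tsupport v)]
    · exact Measure.integrableOn_of_bounded hc.measure_lt_top.ne hGm.aestronglyMeasurable
        (ae_of_all _ hv.norm_classicalGrad_le)
    · intro x hx
      by_contra hxs
      apply hx
      have : fderiv ℝ v x = 0 := by
        by_contra h'
        exact hxs (support_fderiv_subset ℝ h')
      ext i
      simp [classicalGrad_apply, this]
  have hgrad : ∀ n, classicalGrad (mollify n v) = mollify n (classicalGrad v) := fun n => by
    ext1 x
    have := classicalGrad_mollify (n := n) (x := x) isOpen_univ hv.isWeakGrad
      hvi.integrableOn hGi.integrableOn (Set.subset_univ _)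
    simpa only [Set.indicator_univ] using this
  obtain ⟨M, hM⟩ := hc.exists_bound_of_continuous hv.continuous
  have hM0 : 0 ≤ M := (norm_nonneg _).trans (hM 0)
  have hbd : ∀ n x, ‖mollify n v x‖ ≤ M := fun n x => by
    have := enorm_mollify_le_of_ae n (g := v) (M := ENNReal.ofReal M)
      (ae_of_all _ fun y => by rw [← ofReal_norm]; exact ENNReal.ofReal_le_ofReal (hM y)) x
    rw [← ofReal_norm] at this
    exact (ENNReal.ofReal_le_ofReal_iff hM0).mp this
  have hbd' : ∀ n x, ‖classicalGrad (mollify n v) x‖ ≤ C := fun n x => by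
    have := enorm_mollify_le_of_ae n (g := classicalGrad v) (M := ENNReal.ofReal C)
      (ae_of_all _ fun y => by
        rw [← ofReal_norm]; exact ENNReal.ofReal_le_ofReal (hv.norm_classicalGrad_le y)) x
    rw [← ofReal_norm] at this
    rw [hgrad]
    exact (ENNReal.ofReal_le_ofReal_iff C.2).mp this
  have hsm : ∀ n, ContDiff ℝ ∞ (mollify n v) := fun n => contDiff_mollify n hvi.locallyIntegrable
  have l1 := tendsto_eLpNorm_two_of_bounded hfin (f := fun n => mollify n v) (g := v)
    (fun n => (hsm n).continuous.aestronglyMeasurable) hv.continuous.aestronglyMeasurable hbd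
    (ae_of_all _ fun x => tendsto_mollify_of_continuousAt hv.continuous.aestronglyMeasurable
      hv.continuous.continuousAt)
  have l2 := tendsto_eLpNorm_two_of_bounded hfin (f := fun n => classicalGrad (mollify n v))
    (g := classicalGrad v) (fun n => (measurable_classicalGrad _).aestronglyMeasurable)
    hGm.aestronglyMeasurable hbd' (ae_restrict_of_ae (by
      simp_rw [hgrad]; exact ae_tendsto_mollify hGi.locallyIntegrable))
  obtain ⟨δ, hδ0, hδ⟩ := hc.isCompact.exists_cthickening_subset_open hU hs
  have l3 : ∀ᶠ n : ℕ in atTop, 1 / (n + 1 : ℝ) < δ :=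
    tendsto_one_div_add_atTop_nhds_zero_nat.eventually_lt_const hδ0
  obtain ⟨n, h1, h2, h3⟩ := ((l1.eventually_le_const hη).and
    ((l2.eventually_le_const hη).and l3)).exists
  have hts : tsupport (mollify n v) ⊆ Metric.cthickening (1 / (n + 1 : ℝ)) (tsupport v) :=
    closure_minimal (support_mollify_subset n v) Metric.isClosed_cthickening
  refine ⟨mollify n v, ⟨hsm n, ?_, ?_⟩, h1, h2⟩
  · exact (hc.isCompact.cthickening).of_isClosed_subset (isClosed_tsupport _) hts
  · exact hts.trans ((Metric.cthickening_mono h3.le _).trans hδ)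

/-- A Lipschitz function that vanishes off a bounded open set, and whose gradient vanishes a.e. on
its zero set, belongs to `H¹₀`. It is approximated by `v - max (-δ) (min δ v)`, which has compact
support in the open set. -/
theorem LipschitzWith.memH10 {v : Plane → ℝ} {C : NNReal} (hv : LipschitzWith C v) (hU : IsOpen U)
    (hb : Bornology.IsBounded U) (h0 : ∀ x ∉ U, v x = 0)
    (hgrad0 : ∀ᵐ x, v x = 0 → classicalGrad v x = 0) : MemH10 U v := by
  have hfin : volume U ≠ ⊤ := hb.measure_lt_top.ne
  refine memH10_of_forall_exists hU (hv.memW1 hU hb) hv.isWeakGrad fun η hη => ?_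
  set δ : ℕ → ℝ := fun n => 1 / (n + 1 : ℝ) with hδ
  have hδ0 : ∀ n, 0 < δ n := fun n => by positivity
  have hδl : Tendsto δ atTop (𝓝 0) := tendsto_one_div_add_atTop_nhds_zero_nat
  set w : ℕ → Plane → ℝ := fun n x => v x - max (-δ n) (min (δ n) (v x)) with hw
  have hwL : ∀ n, LipschitzWith (C + C) (w n) := fun n =>
    hv.sub ((hv.const_min (δ n)).const_max (-δ n))
  have hw0 : ∀ n x, |v x| ≤ δ n → w n x = 0 := fun n x hx => by
    have := abs_le.mp hx
    simp only [hw, min_eq_right this.2, max_eq_right this.1, sub_self]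
  have hwv : ∀ n x, |w n x - v x| ≤ δ n := fun n x => by
    have e : w n x - v x = - max (-δ n) (min (δ n) (v x)) := by simp [hw]
    rw [e, abs_neg, abs_le]
    exact ⟨le_max_left _ _, max_le (by linarith [hδ0 n]) (min_le_left _ _)⟩
  have hKcl : ∀ n, IsClosed {x | δ n ≤ |v x|} := fun n =>
    isClosed_le continuous_const hv.continuous.abs
  have hKU : ∀ n, {x | δ n ≤ |v x|} ⊆ U := fun n x hx => by
    by_contra hxU
    have hx' : δ n ≤ |v x| := hx
    rw [h0 x hxU, abs_zero] at hx'
    linarith [hδ0 n]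
  have hts : ∀ n, tsupport (w n) ⊆ {x | δ n ≤ |v x|} := fun n => by
    refine closure_minimal (fun x hx => ?_) (hKcl n)
    by_contra hlt
    exact hx (hw0 n x (not_le.mp hlt).le)
  have hwc : ∀ n, HasCompactSupport (w n) := fun n =>
    (Metric.isCompact_of_isClosed_isBounded (hKcl n) (hb.subset (hKU n))).of_isClosed_subset
      (isClosed_tsupport _) (hts n)
  -- bound of `v`, for dominated convergence
  obtain ⟨M, hM⟩ : ∃ M, ∀ x, ‖v x‖ ≤ M := by
    obtain ⟨M, hM⟩ := (hb.isCompact_closure.image hv.continuous).isBounded.exists_norm_le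
    refine ⟨max M 0, fun x => ?_⟩
    by_cases hx : x ∈ U
    · exact (hM _ ⟨x, subset_closure hx, rfl⟩).trans (le_max_left _ _)
    · simp [h0 x hx]
  have hwb : ∀ n x, ‖w n x‖ ≤ M + 1 := fun n x => by
    have h1 : δ n ≤ 1 := by
      simp only [hδ]
      rw [div_le_one (by positivity)]
      have : (0 : ℝ) ≤ n := n.cast_nonneg
      linarith
    calc ‖w n x‖ = ‖v x + (w n x - v x)‖ := by ring_nf
      _ ≤ ‖v x‖ + ‖w n x - v x‖ := norm_add_le _ _
      _ ≤ _ := add_le_add (hM x) ((hwv n x).trans h1)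
  have l1 := tendsto_eLpNorm_two_of_bounded hfin (f := w) (g := v)
    (fun n => (hwL n).continuous.aestronglyMeasurable) hv.continuous.aestronglyMeasurable hwb
    (ae_of_all _ fun x => by
      rw [tendsto_iff_norm_sub_tendsto_zero]
      exact squeeze_zero (fun _ => norm_nonneg _) (fun n => hwv n x) hδl)
  have l2 := tendsto_eLpNorm_two_of_bounded hfin (f := fun n => classicalGrad (w n))
    (g := classicalGrad v) (fun n => (measurable_classicalGrad _).aestronglyMeasurable)
    (measurable_classicalGrad _).aestronglyMeasurable (fun n => (hwL n).norm_classicalGrad_le)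
    (ae_restrict_of_ae (by
      filter_upwards [hgrad0] with x hx
      by_cases hvx : v x = 0
      · rw [hx hvx]
        refine tendsto_const_nhds.congr fun n => ?_
        -- the truncation vanishes near a zero of `v`
        have : w n =ᶠ[𝓝 x] fun _ => 0 := by
          have h1 : ∀ᶠ y in 𝓝 x, |v y| < δ n := by
            refine hv.continuous.abs.continuousAt.eventually_lt_const ?_
            simpa [hvx] using hδ0 n
          filter_upwards [h1] with y hy
          exact hw0 n y hy.le
        ext i
        rw [classicalGrad_apply, this.fderiv_eq]
        simp
      · -- near any other point it differs from `v` by a constant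
        refine tendsto_const_nhds.congr' ?_
        filter_upwards [hδl.eventually_lt_const (abs_pos.mpr hvx)] with n hn
        have : ∃ k : ℝ, w n =ᶠ[𝓝 x] fun y => v y - k := by
          rcases lt_or_gt_of_ne hvx with hneg | hpos
          · refine ⟨-δ n, ?_⟩
            have h1 : ∀ᶠ y in 𝓝 x, v y < -δ n := by
              refine hv.continuous.continuousAt.eventually_lt_const ?_
              rw [abs_of_neg hneg] at hn
              linarith
            filter_upwards [h1] with y hy
            simp only [hw]
            rw [min_eq_right (by linarith [hδ0 n]), max_eq_left hy.le]
          · refine ⟨δ n, ?_⟩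
            have h1 : ∀ᶠ y in 𝓝 x, δ n < v y := by
              refine hv.continuous.continuousAt.eventually_const_lt ?_
              rwa [abs_of_pos hpos] at hn
            filter_upwards [h1] with y hy
            simp only [hw]
            rw [min_eq_left hy.le, max_eq_right (by linarith [hδ0 n])]
        obtain ⟨k, hk⟩ := this
        ext i
        rw [classicalGrad_apply, classicalGrad_apply, hk.fderiv_eq, fderiv_sub_const]))
  have hη2 : 0 < η / 2 := ENNReal.half_pos hη.ne'
  obtain ⟨n, h1, h2⟩ := ((l1.eventually_le_const hη2).and (l2.eventually_le_const hη2)).exists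
  obtain ⟨φ, hφ, h3, h4⟩ := (hwL n).exists_testFunction_approx hU hb (hwc n)
    ((hts n).trans (hKU n)) hη2
  refine ⟨φ, hφ, ?_, ?_⟩
  · have e : (fun x => φ x - v x) = (fun x => φ x - w n x) + fun x => w n x - v x := by
      ext x; simp
    rw [e, ← ENNReal.add_halves η]
    refine (eLpNorm_add_le ?_ ?_ (by norm_num)).trans (add_le_add h3 h1)
    · exact (hφ.1.continuous.sub (hwL n).continuous).aestronglyMeasurable
    · exact ((hwL n).continuous.sub hv.continuous).aestronglyMeasurable
  · have e : (fun x => classicalGrad φ x - classicalGrad v x) =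
        (fun x => classicalGrad φ x - classicalGrad (w n) x) +
          fun x => classicalGrad (w n) x - classicalGrad v x := by
      ext1 x; simp
    rw [e, ← ENNReal.add_halves η]
    refine (eLpNorm_add_le ?_ ?_ (by norm_num)).trans (add_le_add h4 h2)
    · exact ((measurable_classicalGrad _).sub (measurable_classicalGrad _)).aestronglyMeasurable
    · exact ((measurable_classicalGrad _).sub (measurable_classicalGrad _)).aestronglyMeasurable

theorem tendsto_integral_mul_of_eLpNorm_two {f : ℕ → Plane → ℝ}
    {g ψ : Plane → ℝ} (hf : ∀ n, MemLp (f n) 2 (volume.restrict U))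
    (hg : MemLp g 2 (volume.restrict U)) (hψ : MemLp ψ 2 (volume.restrict U))
    (h : Tendsto (fun n => eLpNorm (fun x => f n x - g x) 2 (volume.restrict U)) atTop (𝓝 0)) :
    Tendsto (fun n => ∫ x in U, ψ x • f n x) atTop (𝓝 (∫ x in U, ψ x • g x)) := by
  refine tendsto_integral_of_L1' _ (hψ.integrable_mul hg).1
    (Eventually.of_forall fun n => hψ.integrable_mul (hf n)) ?_
  have hlim : Tendsto (fun n => eLpNorm ψ 2 (volume.restrict U) *
      eLpNorm (fun x => f n x - g x) 2 (volume.restrict U)) atTop (𝓝 0) := by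
    have := ENNReal.Tendsto.const_mul (a := eLpNorm ψ 2 (volume.restrict U)) h
      (Or.inr hψ.2.ne)
    simpa using this
  refine tendsto_of_tendsto_of_tendsto_of_le_of_le tendsto_const_nhds hlim
    (fun _ => zero_le) fun n => ?_
  have e : ((fun x => ψ x • f n x) - fun x => ψ x • g x) = ψ • fun x => f n x - g x := by
    ext x; simp [mul_sub]
  have := eLpNorm_smul_le_mul_eLpNorm (p := 2) (q := 2) (r := 1) ((hf n).sub hg).1 hψ.1
  exact e ▸ this

/-- The extension by zero of a member of `H¹₀(U)` has a weak gradient on the whole plane: this is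
clear for test functions and passes to limits in `H¹(U)`. -/
theorem MemH10.isWeakGrad_indicator (hU : IsOpen U) (hfin : volume U ≠ ⊤) {u : Plane → ℝ}
    (hu : MemH10 U u) :
    IsWeakGrad Set.univ (U.indicator u) (U.indicator (weakGrad U u)) := by
  obtain ⟨hu1, φ, hφ, hφ1, hφ2⟩ := hu
  have : IsFiniteMeasure (volume.restrict U) := ⟨by simpa using hfin.lt_top⟩
  have hUm := hU.measurableSet
  have hui : Integrable (U.indicator u) :=
    IntegrableOn.integrable_indicator (hu1.2.1.integrable (by norm_num)) hUm
  have hGi : Integrable (U.indicator (weakGrad U u)) :=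
    IntegrableOn.integrable_indicator (hu1.2.2.integrable (by norm_num)) hUm
  refine ⟨hui.locallyIntegrable.locallyIntegrableOn _, hGi.locallyIntegrable.locallyIntegrableOn _,
    fun ψ hψ i => ?_⟩
  set G := weakGrad U u with hG
  have hψm : MemLp ψ 2 (volume.restrict U) := IsTestFunction.memLp hψ.1.continuous hψ.2.1
  have hdc : HasCompactSupport fun x => fderiv ℝ ψ x (EuclideanSpace.single i 1) :=
    hψ.2.1.of_isClosed_subset (isClosed_tsupport _) (tsupport_partial_subset ψ _)
  have hψm' : MemLp (fun x => fderiv ℝ ψ x (EuclideanSpace.single i 1)) 2 (volume.restrict U) :=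
    IsTestFunction.memLp (hψ.continuous_partial _) hdc
  have hφm : ∀ n, MemLp (φ n) 2 (volume.restrict U) := fun n =>
    IsTestFunction.memLp (hφ n).1.continuous (hφ n).2.1
  have hφm' : ∀ n, MemLp (fun x => classicalGrad (φ n) x i) 2 (volume.restrict U) := fun n =>
    IsTestFunction.memLp ((hφ n).continuous_partial _)
      ((hφ n).2.1.of_isClosed_subset (isClosed_tsupport _) (tsupport_partial_subset _ _))
  have hGm : MemLp (fun x => G x i) 2 (volume.restrict U) :=
    (PiLp.proj 2 (fun _ : Fin 2 => ℝ) i : Grad ℝ →L[ℝ] ℝ).comp_memLp' hu1.2.2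
  have hφ2' : Tendsto (fun n => eLpNorm (fun x => classicalGrad (φ n) x i - G x i) 2
      (volume.restrict U)) atTop (𝓝 0) := by
    refine tendsto_of_tendsto_of_tendsto_of_le_of_le tendsto_const_nhds hφ2
      (fun _ => zero_le) fun n => ?_
    rw [seminorm1, eLpNorm_congr_ae (((hφ n).isWeakGrad.sub hu1.1.isWeakGrad).weakGrad_ae_eq hU)]
    refine eLpNorm_mono fun x => ?_
    exact PiLp.norm_apply_le (classicalGrad (φ n) x - G x) i
  have L1 := tendsto_integral_mul_of_eLpNorm_two hφm hu1.2.1 hψm' hφ1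
  have L2 := (tendsto_integral_mul_of_eLpNorm_two hφm' hGm hψm hφ2').neg
  have hparts : ∀ n, ∫ x in U, fderiv ℝ ψ x (EuclideanSpace.single i 1) • φ n x =
      - ∫ x in U, ψ x • classicalGrad (φ n) x i := by
    intro n
    have key := ((hφ n).isWeakGrad (U := Set.univ)).2.2 ψ hψ i
    rw [setIntegral_univ, setIntegral_univ] at key
    rw [setIntegral_eq_integral_of_forall_compl_eq_zero,
      setIntegral_eq_integral_of_forall_compl_eq_zero, key]
    · intro x hx
      have : classicalGrad (φ n) x i = 0 := image_eq_zero_of_notMem_tsupport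
        (f := fun x => fderiv ℝ (φ n) x (EuclideanSpace.single i 1))
        fun h => hx ((hφ n).2.2 (tsupport_partial_subset _ _ h))
      simp [this]
    · intro x hx
      have : φ n x = 0 := image_eq_zero_of_notMem_tsupport fun h => hx ((hφ n).2.2 h)
      simp [this]
  simp_rw [hparts] at L1
  have hlim := tendsto_nhds_unique L1 L2
  rw [setIntegral_univ, setIntegral_univ]
  rw [← integral_indicator hUm, ← integral_indicator hUm] at hlim
  refine Eq.trans (integral_congr_ae (ae_of_all _ fun x => ?_))
    (hlim.trans (congrArg _ (integral_congr_ae (ae_of_all _ fun x => ?_)))) <;>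
  by_cases hx : x ∈ U <;> simp [hx]

theorem norm_fderiv_le_norm_classicalGrad (v : Plane → ℝ) (x : Plane) :
    ‖fderiv ℝ v x‖ ≤ ‖classicalGrad v x‖ := by
  refine ContinuousLinearMap.opNorm_le_bound _ (norm_nonneg _) fun d => ?_
  rw [← inner_classicalGrad]
  exact norm_inner_le_norm _ _

/-- An integrable function on the plane with bounded weak gradient has a Lipschitz
representative. -/
theorem exists_lipschitzWith_ae_eq {V : Plane → ℝ} {G : Plane → Grad ℝ} (hV : Integrable V)
    (hG : Integrable G) (h : IsWeakGrad Set.univ V G) {M : NNReal} (hM : ∀ᵐ x, ‖G x‖ₑ ≤ M) :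
    ∃ g : Plane → ℝ, LipschitzWith M g ∧ V =ᵐ[volume] g := by
  have hL : ∀ n, LipschitzWith M (mollify n V) := by
    intro n
    have hsm := contDiff_mollify n hV.locallyIntegrable
    refine lipschitzWith_of_nnnorm_fderiv_le (𝕜 := ℝ) (hsm.differentiable (by simp)) fun x => ?_
    have h1 := classicalGrad_mollify (n := n) (x := x) isOpen_univ h hV.integrableOn
      hG.integrableOn (Set.subset_univ _)
    simp only [Set.indicator_univ] at h1
    have h2 := enorm_mollify_le_of_ae n hM x
    rw [← h1] at h2
    have h3 := (norm_fderiv_le_norm_classicalGrad (mollify n V) x)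
    have h4 : ‖classicalGrad (mollify n V) x‖₊ ≤ M := by exact_mod_cast h2
    exact le_trans (by exact_mod_cast h3) h4
  have hae := ae_tendsto_mollify hV.locallyIntegrable
  set E : Set Plane := {x | Tendsto (fun n => mollify n V x) atTop (𝓝 (V x))} with hE
  have hLE : LipschitzOnWith M V E := by
    refine LipschitzOnWith.of_dist_le_mul fun x hx y hy => ?_
    exact le_of_tendsto' (Tendsto.dist hx hy) fun n => (hL n).dist_le_mul x y
  obtain ⟨g, hg, hgE⟩ := hLE.extend_real
  exact ⟨g, hg, by filter_upwards [hae] with x hx using hgE hx⟩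

/-- A member of `H¹₀` with bounded gradient, on the interior of a bounded closed set, has a
Lipschitz representative that vanishes outside of the domain. -/
theorem MemH10.exists_lipschitz {R : Set Plane} (hR : IsCompact R) {u : Plane → ℝ}
    (hu : MemH10 (interior R) u)
    (hgrad : MemLp (weakGrad (interior R) u) ∞ (volume.restrict (interior R))) :
    ∃ (C : NNReal) (g : Plane → ℝ), LipschitzWith C g ∧
      u =ᵐ[volume.restrict (interior R)] g ∧ ∀ x ∉ interior R, g x = 0 := by
  set U := interior R with hUdef
  have hU : IsOpen U := isOpen_interior
  have hUm := hU.measurableSet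
  have hfin : volume U < ⊤ := (measure_mono interior_subset).trans_lt hR.measure_lt_top
  have : IsFiniteMeasure (volume.restrict U) := ⟨by simpa using hfin⟩
  set G := weakGrad U u with hG
  have hui : Integrable (U.indicator u) :=
    IntegrableOn.integrable_indicator (hu.1.2.1.integrable (by norm_num)) hUm
  have hGi : Integrable (U.indicator G) :=
    IntegrableOn.integrable_indicator (hu.1.2.2.integrable (by norm_num)) hUm
  set M := (eLpNorm G ⊤ (volume.restrict U)).toNNReal with hMdef
  have hM : ∀ᵐ x, ‖U.indicator G x‖ₑ ≤ M := by
    rw [hMdef, ENNReal.coe_toNNReal hgrad.2.ne, ← eLpNorm_indicator_eq_eLpNorm_restrict hUm,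
      eLpNorm_exponent_top]
    exact ae_le_eLpNormEssSup
  obtain ⟨g, hg, hgu⟩ := exists_lipschitzWith_ae_eq hui hGi
    (hu.isWeakGrad_indicator hU hfin.ne) hM
  refine ⟨M, g, hg, ?_, ?_⟩
  · filter_upwards [ae_restrict_of_ae hgu, ae_restrict_mem hUm] with x hx hxU
    rwa [Set.indicator_of_mem hxU] at hx
  · -- `g` vanishes a.e. off `R`, hence everywhere off `R`, and off the interior by density
    have h1 : ∀ x ∈ Rᶜ, g x = 0 := by
      intro x hx
      have hO : IsOpen (Rᶜ ∩ {x | g x ≠ 0}) :=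
        hR.isClosed.isOpen_compl.inter (isOpen_ne_fun hg.continuous continuous_const)
      have hnull : volume (Rᶜ ∩ {x | g x ≠ 0}) = 0 := by
        rw [measure_eq_zero_iff_ae_notMem]
        filter_upwards [hgu] with y hy ⟨hyR, hy0⟩
        rw [Set.indicator_of_notMem fun h => hyR (interior_subset h)] at hy
        exact hy0 hy.symm
      have hempty := hO.measure_eq_zero_iff volume |>.mp hnull
      by_contra hne
      exact (hempty ▸ (⟨hx, hne⟩ : x ∈ Rᶜ ∩ {x | g x ≠ 0}) : x ∈ (∅ : Set Plane))
    intro x hx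
    have hx' : x ∈ closure Rᶜ := by rw [closure_compl]; exact hx
    exact closure_minimal h1 (isClosed_eq hg.continuous continuous_const) hx'

end HOneZero

/-! ### The nodal interpolant on a mesh -/

section Mesh

/-- The vertices of a triangle as an affine basis of the plane; its coordinates are the barycentric
coordinates. -/
noncomputable def triangleBasis (T : Affine.Triangle ℝ Plane) : AffineBasis (Fin 3) ℝ Plane :=
  ⟨T.points, T.independent, affineSpan_range_points T⟩

theorem triangleBasis_apply (T : Affine.Triangle ℝ Plane) (i : Fin 3) :
    triangleBasis T i = T.points i := rfl

theorem mem_closedInterior_iff_coord (T : Affine.Triangle ℝ Plane) (x : Plane) :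
    x ∈ T.closedInterior ↔ ∀ i, 0 ≤ (triangleBasis T).coord i x := by
  rw [← Affine.Simplex.convexHull_eq_closedInterior]
  change x ∈ convexHull ℝ (Set.range (triangleBasis T)) ↔ _
  rw [AffineBasis.convexHull_eq_nonneg_coord]
  rfl

theorem mem_interior_iff_coord (T : Affine.Triangle ℝ Plane) (x : Plane) :
    x ∈ interior T.closedInterior ↔ ∀ i, 0 < (triangleBasis T).coord i x := by
  rw [← Affine.Simplex.convexHull_eq_closedInterior]
  change x ∈ interior (convexHull ℝ (Set.range (triangleBasis T))) ↔ _
  rw [AffineBasis.interior_convexHull]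
  rfl

theorem AffineMap.apply_eq_sum_coord {ι : Type*} [Fintype ι] (B : AffineBasis ι ℝ Plane)
    (q : Plane →ᵃ[ℝ] ℝ) (x : Plane) : q x = ∑ i, B.coord i x * q (B i) := by
  have h1 : ∑ i, B.coord i x = 1 := B.sum_coord_apply_eq_one x
  conv_lhs => rw [← B.affineCombination_coord_eq_self x]
  rw [Finset.map_affineCombination _ _ _ h1,
    Finset.affineCombination_eq_linear_combination _ _ _ h1]
  rfl

/-- The affine function with the vertex values of `g`. -/
noncomputable def nodalAffine (T : Affine.Triangle ℝ Plane) (g : Plane → ℝ) : Plane →ᵃ[ℝ] ℝ :=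
  ∑ i, g (T.points i) • (triangleBasis T).coord i

theorem nodalAffine_apply (T : Affine.Triangle ℝ Plane) (g : Plane → ℝ) (x : Plane) :
    nodalAffine T g x = ∑ i, g (T.points i) * (triangleBasis T).coord i x := by
  simp [nodalAffine, Fin.sum_univ_three]

theorem nodalAffine_isInterpolant (T : Affine.Triangle ℝ Plane) (g : Plane → ℝ) :
    IsInterpolant T g (nodalAffine T g) := by
  intro i
  rw [nodalAffine_apply, Finset.sum_eq_single i]
  · rw [← triangleBasis_apply, AffineBasis.coord_apply_eq, mul_one]
  · intro j _ hj
    rw [← triangleBasis_apply T i, AffineBasis.coord_apply_ne _ hj, mul_zero]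
  · simp

theorem continuous_coord (T : Affine.Triangle ℝ Plane) (i : Fin 3) :
    Continuous ((triangleBasis T).coord i) :=
  ((triangleBasis T).coord i).continuous_of_finiteDimensional

/-- Two triangles with disjoint interiors and a common edge cover a neighbourhood of every
relatively interior point of the edge. -/
theorem union_mem_nhds_of_common_edge {S T : Affine.Triangle ℝ Plane}
    (hdisj : Disjoint (interior S.closedInterior) (interior T.closedInterior))
    {i j k : Fin 3} (hij : i ≠ j) (hjk : j ≠ k) (hik : i ≠ k)
    (hi : T.points i ∈ Set.range S.points) (hj : T.points j ∈ Set.range S.points) {x : Plane}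
    (hxi : 0 < (triangleBasis T).coord i x) (hxj : 0 < (triangleBasis T).coord j x)
    (hxk : (triangleBasis T).coord k x = 0) :
    S.closedInterior ∪ T.closedInterior ∈ 𝓝 x := by
  obtain ⟨i', hi'⟩ := hi
  obtain ⟨j', hj'⟩ := hj
  have hij' : i' ≠ j' := by
    rintro rfl
    exact hij (T.independent.injective (hi'.symm.trans hj'))
  obtain ⟨k', hik', hjk'⟩ : ∃ k' : Fin 3, i' ≠ k' ∧ j' ≠ k' := by
    have h : ∀ a b : Fin 3, ∃ c : Fin 3, a ≠ c ∧ b ≠ c := by decide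
    exact h i' j'
  have hall : ∀ a b c m : Fin 3, a ≠ b → b ≠ c → a ≠ c → m = a ∨ m = b ∨ m = c := by decide
  have hsum : ∀ (f : Fin 3 → ℝ) (a b c : Fin 3), a ≠ b → b ≠ c → a ≠ c →
      ∑ m, f m = f a + f b + f c := by
    intro f a b c hab hbc hac
    have : (Finset.univ : Finset (Fin 3)) = {a, b, c} := by
      ext m; simpa using hall a b c m hab hbc hac
    rw [this, Finset.sum_insert (by simp [hab, hac]), Finset.sum_pair hbc, add_assoc]
  set l := fun m => (triangleBasis T).coord m with hl
  set μ := fun m => (triangleBasis S).coord m with hμ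
  have hexp : ∀ (m : Fin 3) (z : Plane), μ m z =
      l i z * μ m (T.points i) + l j z * μ m (T.points j) + l k z * μ m (T.points k) := by
    intro m z
    rw [AffineMap.apply_eq_sum_coord (triangleBasis T) (μ m) z, hsum _ i j k hij hjk hik]
    rfl
  have e1 : ∀ m, μ m (T.points i) = if m = i' then 1 else 0 := fun m => by
    rw [← hi', ← triangleBasis_apply S, hμ]; simp only [AffineBasis.coord_apply]
  have e2 : ∀ m, μ m (T.points j) = if m = j' then 1 else 0 := fun m => by
    rw [← hj', ← triangleBasis_apply S, hμ]; simp only [AffineBasis.coord_apply]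
  have hk' : ∀ z, μ k' z = l k z * μ k' (T.points k) := fun z => by
    rw [hexp, e1, e2, if_neg hik'.symm, if_neg hjk'.symm]; ring
  have hxi' : 0 < μ i' x := by
    rw [hexp, e1, e2, if_pos rfl, if_neg hij', show l k x = 0 from hxk]; simpa using hxi
  have hxj' : 0 < μ j' x := by
    rw [hexp, e1, e2, if_pos rfl, if_neg hij'.symm, show l k x = 0 from hxk]; simpa using hxj
  have hnear : ∀ᶠ z in 𝓝 x, 0 < l i z ∧ 0 < l j z ∧ 0 < μ i' z ∧ 0 < μ j' z :=
    ((continuous_coord T i).continuousAt.eventually_const_lt hxi).and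
      (((continuous_coord T j).continuousAt.eventually_const_lt hxj).and
        (((continuous_coord S i').continuousAt.eventually_const_lt hxi').and
          ((continuous_coord S j').continuousAt.eventually_const_lt hxj')))
  -- the third vertices lie on opposite sides of the edge, since the interiors are disjoint
  have hκ : μ k' (T.points k) ≤ 0 := by
    by_contra! hpos
    have hline : Tendsto (fun t : ℝ => AffineMap.lineMap x (T.points k) t) (𝓝[>] 0) (𝓝 x) := by
      have : Continuous fun t : ℝ => (AffineMap.lineMap x (T.points k) t : Plane) :=
        AffineMap.lineMap_continuous
      have h0 := (this.tendsto 0).mono_left (nhdsWithin_le_nhds (s := Set.Ioi 0))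
      simpa using h0
    obtain ⟨t, ⟨h1, h2, h3, h4⟩, ht⟩ :=
      ((hline.eventually hnear).and (self_mem_nhdsWithin (a := (0 : ℝ)) (s := Set.Ioi 0))).exists
    set z : Plane := AffineMap.lineMap x (T.points k) t with hz
    have hlk : l k z = t := by
      have h5 : l k z = AffineMap.lineMap (l k x) (l k (T.points k)) t :=
        AffineMap.apply_lineMap _ _ _ _
      have h6 : l k (T.points k) = 1 := AffineBasis.coord_apply_eq (triangleBasis T) k
      rw [h5, h6, show l k x = 0 from hxk]
      simp [AffineMap.lineMap_apply]
    have ht0 : 0 < t := ht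
    have hzT : z ∈ interior T.closedInterior := by
      rw [mem_interior_iff_coord]
      intro m
      rcases hall i j k m hij hjk hik with rfl | rfl | rfl
      exacts [h1, h2, hlk ▸ ht0]
    have hzS : z ∈ interior S.closedInterior := by
      rw [mem_interior_iff_coord]
      intro m
      rcases hall i' j' k' m hij' hjk' hik' with rfl | rfl | rfl
      · exact h3
      · exact h4
      · have := hk' z
        rw [hlk] at this
        exact this ▸ mul_pos ht0 hpos
    exact Set.disjoint_left.mp hdisj hzS hzT
  -- so near `x` the sign of the coordinate `l k` decides between `T` and `S`
  filter_upwards [hnear] with z ⟨h1, h2, h3, h4⟩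
  rcases le_total 0 (l k z) with h | h
  · right
    rw [mem_closedInterior_iff_coord]
    intro m
    rcases hall i j k m hij hjk hik with rfl | rfl | rfl
    exacts [h1.le, h2.le, h]
  · left
    rw [mem_closedInterior_iff_coord]
    intro m
    rcases hall i' j' k' m hij' hjk' hik' with rfl | rfl | rfl
    · exact h3.le
    · exact h4.le
    · exact (hk' z).symm ▸ mul_nonneg_of_nonpos_of_nonpos h hκ

theorem isClosed_region (B : Finset (Affine.Triangle ℝ Plane)) : IsClosed (region B) :=
  B.finite_toSet.isClosed_biUnion fun T _ => T.isClosed_closedInterior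

theorem isCompact_region (B : Finset (Affine.Triangle ℝ Plane)) : IsCompact (region B) :=
  B.finite_toSet.isCompact_biUnion fun T _ => T.isCompact_closedInterior

theorem closedInterior_subset_region {B : Finset (Affine.Triangle ℝ Plane)}
    {T : Affine.Triangle ℝ Plane} (hT : T ∈ B) : T.closedInterior ⊆ region B :=
  Set.subset_biUnion_of_mem (u := fun T : Affine.Triangle ℝ Plane => T.closedInterior) hT

namespace TriMesh

variable (M : TriMesh)

theorem coord_eq_zero_of_mem_inter {S T : Affine.Triangle ℝ Plane} (hS : S ∈ M.triangles)
    (hT : T ∈ M.triangles) (hST : S ≠ T) {y : Plane} (hyS : y ∈ S.closedInterior)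
    (hyT : y ∈ T.closedInterior) {m : Fin 3} (hm : T.points m ∉ Set.range S.points) :
    (triangleBasis T).coord m y = 0 := by
  have hy : y ∈ convexHull ℝ (Set.range S.points ∩ Set.range T.points) := by
    rw [← M.conforming S hS T hT hST]; exact ⟨hyS, hyT⟩
  have hsub : Set.range S.points ∩ Set.range T.points ⊆ (triangleBasis T).coord m ⁻¹' {0} := by
    rintro _ ⟨h1, n, rfl⟩
    have hmn : m ≠ n := by rintro rfl; exact hm h1
    exact AffineBasis.coord_apply_ne (triangleBasis T) hmn
  exact convexHull_min hsub ((convex_singleton (0 : ℝ)).affine_preimage _) hy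

/-- If a point of a triangle is not in the open domain, then neither are the vertices to which it
has a positive barycentric coordinate: the face that carries the point lies on the boundary. -/
theorem vertex_notMem_domain {T : Affine.Triangle ℝ Plane} (hT : T ∈ M.triangles) {x : Plane}
    (hxT : x ∈ T.closedInterior) (hx : x ∉ M.domain) {i : Fin 3}
    (hxi : (triangleBasis T).coord i x ≠ 0) : T.points i ∉ M.domain := by
  intro hiΩ
  have hx0 := (mem_closedInterior_iff_coord T x).mp hxT
  have hxi' : 0 < (triangleBasis T).coord i x := lt_of_le_of_ne (hx0 i) hxi.symm
  obtain ⟨k, hk⟩ : ∃ k, (triangleBasis T).coord k x = 0 := by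
    by_contra! hcon
    apply hx
    refine interior_mono (closedInterior_subset_region hT) ?_
    rw [mem_interior_iff_coord]
    exact fun m => lt_of_le_of_ne (hx0 m) (hcon m).symm
  have hik : i ≠ k := by rintro rfl; exact hxi hk
  obtain ⟨j, hij, hjk⟩ : ∃ j : Fin 3, i ≠ j ∧ j ≠ k := by
    have h : ∀ a b : Fin 3, ∃ c : Fin 3, a ≠ c ∧ c ≠ b := by decide
    exact h i k
  have hall : ∀ a b c m : Fin 3, a ≠ b → b ≠ c → a ≠ c → m = a ∨ m = b ∨ m = c := by decide
  rcases (hx0 j).eq_or_lt with hj | hxj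
  · -- `x` is the vertex `i` itself
    apply hx
    have : x = T.points i := by
      refine (triangleBasis T).ext_elem fun m => ?_
      rw [← triangleBasis_apply T i]
      have hone : ∑ m, (triangleBasis T).coord m x = 1 := (triangleBasis T).sum_coord_apply_eq_one x
      have hone' : (triangleBasis T).coord i x = 1 := by
        rw [← hone, eq_comm]
        refine Finset.sum_eq_single i (fun m _ hm => ?_) (by simp)
        rcases hall i j k m hij hjk hik with rfl | rfl | rfl
        exacts [absurd rfl hm, hj.symm, hk]
      rcases hall i j k m hij hjk hik with rfl | rfl | rfl
      · rw [hone', AffineBasis.coord_apply_eq]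
      · rw [← hj, AffineBasis.coord_apply_ne _ hij.symm]
      · rw [hk, AffineBasis.coord_apply_ne _ hik.symm]
    rwa [this]
  · -- a point `y` of the open edge close to the vertex `i` lies in the domain
    have hline : Tendsto (fun t : ℝ => AffineMap.lineMap (T.points i) (T.points j) t) (𝓝[>] 0)
        (𝓝 (T.points i)) := by
      have : Continuous fun t : ℝ => (AffineMap.lineMap (T.points i) (T.points j) t : Plane) :=
        AffineMap.lineMap_continuous
      have h0 := (this.tendsto 0).mono_left (nhdsWithin_le_nhds (s := Set.Ioi 0))
      simpa using h0
    obtain ⟨t, hyΩ, ht⟩ := ((hline.eventually (isOpen_interior.mem_nhds hiΩ)).and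
      (Ioo_mem_nhdsGT (show (0 : ℝ) < 1 from one_pos))).exists
    set y : Plane := AffineMap.lineMap (T.points i) (T.points j) t with hy
    have hcoord : ∀ m, (triangleBasis T).coord m y =
        (1 - t) * (triangleBasis T).coord m (T.points i) +
          t * (triangleBasis T).coord m (T.points j) := fun m => by
      rw [hy, AffineMap.apply_lineMap, AffineMap.lineMap_apply]
      simp only [vsub_eq_sub, smul_eq_mul, vadd_eq_add]
      ring
    simp only [← triangleBasis_apply T] at hcoord
    have hyi : 0 < (triangleBasis T).coord i y := by
      rw [hcoord, AffineBasis.coord_apply_eq, AffineBasis.coord_apply_ne _ hij]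
      linarith [ht.2]
    have hyj : 0 < (triangleBasis T).coord j y := by
      rw [hcoord, AffineBasis.coord_apply_eq, AffineBasis.coord_apply_ne _ hij.symm]
      linarith [ht.1]
    have hyk : (triangleBasis T).coord k y = 0 := by
      rw [hcoord, AffineBasis.coord_apply_ne _ hik.symm, AffineBasis.coord_apply_ne _ hjk.symm]
      ring
    have hyT : y ∈ T.closedInterior := by
      rw [mem_closedInterior_iff_coord]
      intro m
      rcases hall i j k m hij hjk hik with rfl | rfl | rfl
      exacts [hyi.le, hyj.le, hyk.ge]
    -- so another triangle contains `y`, and this triangle has the same edge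
    obtain ⟨S, hS, hST, hyS⟩ : ∃ S ∈ M.triangles, S ≠ T ∧ y ∈ S.closedInterior := by
      by_contra! hcon
      have hy' : y ∈ interior T.closedInterior := by
        classical
        have hcl : IsClosed (region (M.triangles.erase T)) := isClosed_region _
        have hyn : y ∉ region (M.triangles.erase T) := by
          simp only [region, Set.mem_iUnion, not_exists]
          intro S hS
          exact hcon S (Finset.mem_of_mem_erase hS) (Finset.ne_of_mem_erase hS)
        rw [mem_interior_iff_mem_nhds]
        filter_upwards [mem_interior_iff_mem_nhds.mp hyΩ, hcl.isOpen_compl.mem_nhds hyn]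
          with z hz hzn
        simp only [region, Set.mem_iUnion, Set.mem_compl_iff, not_exists] at hz hzn
        obtain ⟨S, hS, hzS⟩ := hz
        by_cases hST : S = T
        · exact hST ▸ hzS
        · exact absurd hzS (hzn S (Finset.mem_erase.mpr ⟨hST, hS⟩))
      rw [mem_interior_iff_coord] at hy'
      exact (hy' k).ne' hyk
    have hiS : T.points i ∈ Set.range S.points := by
      by_contra h
      exact hyi.ne' (M.coord_eq_zero_of_mem_inter hS hT hST hyS hyT h)
    have hjS : T.points j ∈ Set.range S.points := by
      by_contra h
      exact hyj.ne' (M.coord_eq_zero_of_mem_inter hS hT hST hyS hyT h)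
    apply hx
    rw [TriMesh.domain, mem_interior_iff_mem_nhds]
    refine mem_of_superset (union_mem_nhds_of_common_edge (M.disjoint_interior S hS T hT hST)
      hij hjk hik hiS hjS hxi' hxj hk) ?_
    exact Set.union_subset (closedInterior_subset_region hS) (closedInterior_subset_region hT)

/-- On the common face of two triangles, the hull of their common vertices, the two affine functions
agree. -/
theorem nodalAffine_eq_of_mem_inter {S T : Affine.Triangle ℝ Plane} (hS : S ∈ M.triangles)
    (hT : T ∈ M.triangles) (g : Plane → ℝ) {x : Plane} (hxS : x ∈ S.closedInterior)
    (hxT : x ∈ T.closedInterior) : nodalAffine S g x = nodalAffine T g x := by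
  by_cases hST : S = T
  · rw [hST]
  · have hx : x ∈ convexHull ℝ (Set.range S.points ∩ Set.range T.points) := by
      rw [← M.conforming S hS T hT hST]; exact ⟨hxS, hxT⟩
    have hsub : Set.range S.points ∩ Set.range T.points ⊆
        (nodalAffine S g - nodalAffine T g) ⁻¹' {0} := by
      rintro z ⟨⟨m, rfl⟩, n, hn⟩
      have h1 := nodalAffine_isInterpolant S g m
      have h2 := nodalAffine_isInterpolant T g n
      rw [hn] at h2
      simp [h1, h2]
    have := convexHull_min hsub ((convex_singleton (0 : ℝ)).affine_preimage _) hx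
    simpa [sub_eq_zero] using this

open Classical in
/-- The continuous piecewise linear function with the vertex values of `g`, extended by zero. Which
triangle is chosen does not matter, by `nodalAffine_eq_of_mem_inter`. -/
noncomputable def nodalInterpolant (g : Plane → ℝ) (x : Plane) : ℝ :=
  if h : ∃ T ∈ M.triangles, x ∈ T.closedInterior then nodalAffine h.choose g x else 0

theorem nodalInterpolant_eq {T : Affine.Triangle ℝ Plane} (hT : T ∈ M.triangles) (g : Plane → ℝ)
    {x : Plane} (hx : x ∈ T.closedInterior) : M.nodalInterpolant g x = nodalAffine T g x := by
  have h : ∃ T ∈ M.triangles, x ∈ T.closedInterior := ⟨T, hT, hx⟩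
  rw [nodalInterpolant, dif_pos h]
  exact M.nodalAffine_eq_of_mem_inter h.choose_spec.1 hT g h.choose_spec.2 hx

theorem nodalInterpolant_eq_zero_of_notMem {g : Plane → ℝ} (hg : ∀ x ∉ M.domain, g x = 0)
    {x : Plane} (hx : x ∉ M.domain) : M.nodalInterpolant g x = 0 := by
  by_cases h : ∃ T ∈ M.triangles, x ∈ T.closedInterior
  · obtain ⟨T, hT, hxT⟩ := h
    rw [M.nodalInterpolant_eq hT g hxT, nodalAffine_apply]
    refine Finset.sum_eq_zero fun i _ => ?_
    by_cases hi : (triangleBasis T).coord i x = 0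
    · rw [hi, mul_zero]
    · rw [hg _ (M.vertex_notMem_domain hT hxT hx hi), zero_mul]
  · rw [nodalInterpolant, dif_neg h]

end TriMesh

/-- A function on a normed space that is Lipschitz on each of finitely many closed sets that
cover the space is Lipschitz, with the same constant. -/
theorem lipschitzWith_of_finite_closed_cover {E ι : Type*} [NormedAddCommGroup E]
    [NormedSpace ℝ E] [Finite ι] {P : ι → Set E} (hP : ∀ i, IsClosed (P i))
    (hcov : ∀ x, ∃ i, x ∈ P i) {f : E → ℝ} {L : NNReal} (hf : ∀ i, LipschitzOnWith L f (P i)) :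
    LipschitzWith L f := by
  -- near a point only the sets that contain it matter
  have hloc : ∀ x, ∀ᶠ y in 𝓝 x, |f y - f x| ≤ L * ‖y - x‖ := by
    intro x
    have h1 : ∀ᶠ y in 𝓝 x, ∀ i, x ∉ P i → y ∉ P i := by
      rw [eventually_all]
      intro i
      by_cases hx : x ∈ P i
      · exact Eventually.of_forall fun _ h => absurd hx h
      · filter_upwards [(hP i).isOpen_compl.mem_nhds hx] with y hy _ using hy
    filter_upwards [h1] with y hy
    obtain ⟨i, hi⟩ := hcov y
    have hxi : x ∈ P i := by
      by_contra h
      exact hy i h hi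
    have := (hf i).dist_le_mul y hi x hxi
    rwa [Real.dist_eq, dist_eq_norm] at this
  have hcont : Continuous f := by
    rw [continuous_iff_continuousAt]
    intro x
    rw [ContinuousAt, tendsto_iff_norm_sub_tendsto_zero]
    have h0 : Tendsto (fun y => (L : ℝ) * ‖y - x‖) (𝓝 x) (𝓝 0) := by
      have : Continuous fun y : E => (L : ℝ) * ‖y - x‖ := by fun_prop
      simpa using this.tendsto x
    exact squeeze_zero' (Eventually.of_forall fun _ => norm_nonneg _) (hloc x) h0
  refine LipschitzWith.of_dist_le_mul fun x y => ?_
  rw [Real.dist_eq, dist_eq_norm, abs_sub_comm, norm_sub_rev]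
  set l : ℝ → E := fun t => x + t • (y - x) with hl
  have hlc : Continuous l := by fun_prop
  -- the local bound integrates along segments; `ε` makes room for the strict slope inequality
  have key : ∀ ε : ℝ, 0 < ε → |f y - f x| ≤ L * ‖y - x‖ + ε := by
    intro ε hε
    have := image_norm_le_of_liminf_right_slope_norm_lt_deriv_boundary
      (f := fun t => f (l t) - f x) (f' := fun _ => L * ‖y - x‖) (a := 0) (b := 1)
      (B := fun t => (L * ‖y - x‖ + ε) * t) (B' := fun _ => L * ‖y - x‖ + ε)
      ((hcont.comp hlc).sub continuous_const).continuousOn ?_ (by simp [hl]) ?_ ?_ ?_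
      (Set.right_mem_Icc.mpr zero_le_one)
    · simpa [hl] using this
    · intro t _ r hr
      refine Eventually.frequently ?_
      have hev : ∀ᶠ z in 𝓝[>] t, |f (l z) - f (l t)| ≤ L * ‖l z - l t‖ :=
        (hlc.continuousAt.tendsto.eventually (hloc (l t))).filter_mono nhdsWithin_le_nhds
      filter_upwards [hev, self_mem_nhdsWithin] with z hz hzt
      have hzt' : 0 < z - t := sub_pos.mpr hzt
      have hlz : ‖l z - l t‖ = (z - t) * ‖y - x‖ := by
        have : l z - l t = (z - t) • (y - x) := by simp only [hl]; module
        rw [this, norm_smul, Real.norm_of_nonneg hzt'.le]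
      refine lt_of_le_of_lt ?_ hr
      rw [slope_def_field, div_le_iff₀ hzt']
      simp only [Function.comp, Real.norm_eq_abs]
      have h3 := abs_abs_sub_abs_le_abs_sub (f (l z) - f x) (f (l t) - f x)
      rw [sub_sub_sub_cancel_right] at h3
      rw [hlz] at hz
      linarith [le_abs_self (|f (l z) - f x| - |f (l t) - f x|)]
    · fun_prop
    · intro t _
      have h := (hasDerivAt_id t).const_mul (L * ‖y - x‖ + ε)
      rw [mul_one] at h
      exact h.hasDerivWithinAt
    · intro t _ _
      linarith
  exact le_of_forall_pos_le_add key

theorem ae_ne_zero_of_grad_ne_zero {q : Plane →ᵃ[ℝ] ℝ} (hq : q.grad ≠ 0) : ∀ᵐ x, q x ≠ 0 := by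
  set Z : AffineSubspace ℝ Plane := (AffineSubspace.mk' (0 : ℝ) ⊥).comap q with hZ
  have hmem : ∀ x, x ∈ Z ↔ q x = 0 := fun x => by
    simp [hZ]
  have hne : Z ≠ ⊤ := by
    intro htop
    apply hq
    have hz : ∀ x, q x = 0 := fun x => (hmem x).mp (htop ▸ AffineSubspace.mem_top ℝ Plane x)
    have : (q : Plane → ℝ) = fun _ => 0 := funext hz
    rw [← q.classicalGrad_eq 0]
    ext i
    rw [classicalGrad_apply, this]
    simp
  have := Measure.addHaar_affineSubspace (volume : Measure Plane) Z hne
  rw [measure_eq_zero_iff_ae_notMem] at this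
  filter_upwards [this] with x hx h0
  exact hx ((hmem x).mpr h0)

theorem classicalGrad_congr {v w : Plane → ℝ} {x : Plane} (h : v =ᶠ[𝓝 x] w) :
    classicalGrad v x = classicalGrad w x := by
  ext i
  rw [classicalGrad_apply, classicalGrad_apply, h.fderiv_eq]

theorem convex_closedInterior (T : Affine.Triangle ℝ Plane) : Convex ℝ T.closedInterior := by
  rw [← Affine.Simplex.convexHull_eq_closedInterior]
  exact convex_convexHull ℝ _

theorem ae_mem_interior_of_mem (T : Affine.Triangle ℝ Plane) :
    ∀ᵐ x, x ∈ T.closedInterior → x ∈ interior T.closedInterior := by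
  have := (convex_closedInterior T).addHaar_frontier (volume : Measure Plane)
  rw [measure_eq_zero_iff_ae_notMem] at this
  filter_upwards [this] with x hx hxT
  by_contra h
  exact hx ⟨subset_closure hxT, h⟩

namespace TriMesh

variable (M : TriMesh) {g : Plane → ℝ}

/-- The closed triangles and the complement of the domain cover the plane, and on each of them the
interpolant is affine or zero. -/
theorem exists_lipschitzWith_nodalInterpolant (hg : ∀ x ∉ M.domain, g x = 0) :
    ∃ L, LipschitzWith L (M.nodalInterpolant g) := by
  choose C hC using fun T : Affine.Triangle ℝ Plane => (nodalAffine T g).exists_lipschitzWith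
  set L := M.triangles.sup C with hL
  refine ⟨L, lipschitzWith_of_finite_closed_cover (ι := Option M.triangles)
    (P := fun o => o.elim M.domainᶜ fun T => T.1.closedInterior) ?_ ?_ ?_⟩
  · rintro (_ | T)
    · exact isOpen_interior.isClosed_compl
    · exact T.1.isClosed_closedInterior
  · intro x
    by_cases hx : x ∈ M.domain
    · have := interior_subset hx
      simp only [region, Set.mem_iUnion] at this
      obtain ⟨T, hT, hxT⟩ := this
      exact ⟨some ⟨T, hT⟩, hxT⟩
    · exact ⟨none, hx⟩
  · rintro (_ | ⟨T, hT⟩)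
    · refine LipschitzOnWith.of_dist_le_mul fun x hx y hy => ?_
      rw [M.nodalInterpolant_eq_zero_of_notMem hg hx, M.nodalInterpolant_eq_zero_of_notMem hg hy,
        dist_self]
      positivity
    · refine LipschitzOnWith.of_dist_le_mul fun x hx y hy => ?_
      rw [M.nodalInterpolant_eq hT g hx, M.nodalInterpolant_eq hT g hy]
      refine ((hC T).dist_le_mul x y).trans ?_
      have : C T ≤ L := Finset.le_sup hT
      gcongr

theorem nodalInterpolant_eventuallyEq {T : Affine.Triangle ℝ Plane} (hT : T ∈ M.triangles)
    {x : Plane} (hx : x ∈ interior T.closedInterior) :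
    M.nodalInterpolant g =ᶠ[𝓝 x] nodalAffine T g := by
  filter_upwards [mem_interior_iff_mem_nhds.mp hx] with y hy
  exact M.nodalInterpolant_eq hT g hy

theorem domain_isBounded : Bornology.IsBounded M.domain :=
  (isCompact_region M.triangles).isBounded.subset interior_subset

/-- The gradient of the interpolant vanishes a.e. on its zero set, as `LipschitzWith.memH10`
requires, because a nonconstant affine function vanishes on a line only. -/
theorem nodalInterpolant_memV (hg : ∀ x ∉ M.domain, g x = 0) :
    M.MemV (M.nodalInterpolant g) := by
  obtain ⟨L, hL⟩ := M.exists_lipschitzWith_nodalInterpolant hg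
  refine ⟨⟨hL.continuous.continuousOn, fun T hT => ⟨nodalAffine T g, fun x hx =>
    M.nodalInterpolant_eq hT g hx⟩⟩, ?_⟩
  refine hL.memH10 isOpen_interior M.domain_isBounded
    (fun x hx => M.nodalInterpolant_eq_zero_of_notMem hg hx) ?_
  have h1 : ∀ᵐ x, ∀ T ∈ M.triangles, x ∈ T.closedInterior → x ∈ interior T.closedInterior :=
    (ae_ball_iff M.triangles.countable_toSet).mpr fun T _ => ae_mem_interior_of_mem T
  have h2 : ∀ᵐ x, ∀ T ∈ M.triangles, (nodalAffine T g).grad ≠ 0 → nodalAffine T g x ≠ 0 := by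
    refine (ae_ball_iff M.triangles.countable_toSet).mpr fun T _ => ?_
    by_cases h : (nodalAffine T g).grad = 0
    · exact ae_of_all _ fun _ h' => absurd h h'
    · filter_upwards [ae_ne_zero_of_grad_ne_zero h] with x hx _ using hx
  filter_upwards [h1, h2] with x hx1 hx2 hx0
  by_cases hx : ∃ T ∈ M.triangles, x ∈ T.closedInterior
  · obtain ⟨T, hT, hxT⟩ := hx
    rw [classicalGrad_congr (M.nodalInterpolant_eventuallyEq hT (hx1 T hT hxT)),
      AffineMap.classicalGrad_eq]
    by_contra hne
    rw [M.nodalInterpolant_eq hT g hxT] at hx0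
    exact hx2 T hT hne hx0
  · have hxr : x ∉ region M.triangles := by
      simpa only [region, Set.mem_iUnion, exists_prop] using hx
    have : M.nodalInterpolant g =ᶠ[𝓝 x] fun _ => 0 := by
      filter_upwards [(isClosed_region M.triangles).isOpen_compl.mem_nhds hxr] with y hy
      exact M.nodalInterpolant_eq_zero_of_notMem hg fun h => hy (interior_subset h)
    rw [classicalGrad_congr this]
    ext i
    rw [classicalGrad_apply]
    simp

end TriMesh

end Mesh

/-! ### The energy estimate -/

section Energy

theorem MeasureTheory.MemLp.integrable_inner_grad {μ : Measure Plane} {f g : Plane → Grad ℝ}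
    (hf : MemLp f 2 μ) (hg : MemLp g 2 μ) : Integrable (fun x => inner ℝ (f x) (g x)) μ := by
  have h := (hf.norm.integrable_mul hg.norm)
  refine h.mono' (hf.1.inner hg.1) (ae_of_all _ fun x => ?_)
  exact norm_inner_le_norm _ _

/-- The pointwise form of the energy estimate, with `e = G - w` the error, `η = G - q` the
interpolation error and `d ∈ {D, 1}` the coefficient. -/
theorem energy_pointwise {D : ℝ} (hD : 0 < D) (hD1 : D ≤ 1) (G w q : Grad ℝ) :
    D * ‖G - w‖ ^ 2 ≤ 4 / D * ‖G‖ ^ 2 + 5 / 2 * D * ‖G - q‖ ^ 2 +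
      2 * (inner ℝ G (q - w) - D * inner ℝ w (q - w)) := by
  set e := G - w with he
  set η := G - q with hη
  have hid : D * ‖e‖ ^ 2 = D * inner ℝ e η - (1 - D) * inner ℝ G e + (1 - D) * inner ℝ G η +
      (inner ℝ G (q - w) - D * inner ℝ w (q - w)) := by
    have h1 : q - w = e - η := by simp [he, hη]
    have h2 : inner ℝ G (q - w) = inner ℝ G e - inner ℝ G η := by rw [h1, inner_sub_right]
    have h3 : inner ℝ w (q - w) = inner ℝ G e - inner ℝ G η - (‖e‖ ^ 2 - inner ℝ e η) := by
      have h4 : inner ℝ w (q - w) = inner ℝ G (q - w) - inner ℝ e (q - w) := by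
        rw [he, inner_sub_left]
        ring
      have h5 : inner ℝ e (q - w) = ‖e‖ ^ 2 - inner ℝ e η := by
        rw [h1, inner_sub_right, real_inner_self_eq_norm_sq]
      rw [h4, h5, h2]
    rw [h2, h3]
    ring
  have b1 : inner ℝ e η ≤ ‖e‖ ^ 2 / 4 + ‖η‖ ^ 2 := by
    nlinarith [real_inner_le_norm e η, sq_nonneg (‖e‖ / 2 - ‖η‖)]
  -- Young's inequality with the weight `D`
  have hy : ∀ z : Grad ℝ, (1 - D) * (‖G‖ * ‖z‖) ≤ D * ‖z‖ ^ 2 / 4 + ‖G‖ ^ 2 / D := by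
    intro z
    have h0 : 0 ≤ (D * ‖z‖ / 2 - ‖G‖) ^ 2 / D := by positivity
    have h1 : (D * ‖z‖ / 2 - ‖G‖) ^ 2 / D = D * ‖z‖ ^ 2 / 4 + ‖G‖ ^ 2 / D - ‖G‖ * ‖z‖ := by
      field_simp; ring
    have h2 : 0 ≤ ‖G‖ * ‖z‖ := by positivity
    nlinarith
  have b2 : -((1 - D) * inner ℝ G e) ≤ D * ‖e‖ ^ 2 / 4 + ‖G‖ ^ 2 / D := by
    refine le_trans ?_ (hy e)
    have := neg_le_of_abs_le (abs_real_inner_le_norm G e)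
    nlinarith
  have b3 : (1 - D) * inner ℝ G η ≤ D * ‖η‖ ^ 2 / 4 + ‖G‖ ^ 2 / D :=
    (mul_le_mul_of_nonneg_left (real_inner_le_norm G η) (by linarith)).trans (hy η)
  have e4 : 4 / D * ‖G‖ ^ 2 = 4 * (‖G‖ ^ 2 / D) := by ring
  rw [e4]
  nlinarith

/-- The error of a perturbed Galerkin method, on a domain `Ω` with band `R`: `G`, `w`, `q` are the
gradients of the solution, of the discrete solution and of the interpolant, and the hypothesis is
the difference of the two variational equations, tested with the discrete function whose gradient
is `q - w`. -/
theorem energy_le {Ω R : Set Plane} (hR : MeasurableSet R) (hΩ : MeasurableSet Ω)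
    {D : ℝ} (hD : 0 < D) (hD1 : D ≤ 1) {G w q : Plane → Grad ℝ}
    (hG : MemLp G 2 (volume.restrict Ω)) (hw : MemLp w 2 (volume.restrict Ω))
    (hq : MemLp q 2 (volume.restrict Ω)) {d : Plane → ℝ} (hdR : ∀ x ∈ R, d x = D)
    (hdR' : ∀ x ∉ R, d x = 1)
    (hvar : ∫ x in Ω, d x * inner ℝ (w x) (q x - w x) = ∫ x in Ω, inner ℝ (G x) (q x - w x)) :
    (∫⁻ x in Ω \ R, ‖G x - w x‖ₑ ^ 2) + ENNReal.ofReal D * (∫⁻ x in Ω ∩ R, ‖G x - w x‖ₑ ^ 2) ≤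
      ENNReal.ofReal 4 * (∫⁻ x in Ω \ R, ‖G x - q x‖ₑ ^ 2) +
        (ENNReal.ofReal (4 / D) * (∫⁻ x in Ω ∩ R, ‖G x‖ₑ ^ 2) +
          ENNReal.ofReal (5 / 2 * D) * (∫⁻ x in Ω ∩ R, ‖G x - q x‖ₑ ^ 2)) := by
  have hdm : Measurable d := by
    have : d = fun x => R.indicator (fun _ => D - 1) x + 1 := by
      ext x
      by_cases hx : x ∈ R
      · simp [hx, hdR x hx]
      · simp [hx, hdR' x hx]
    rw [this]
    exact (measurable_const.indicator hR).add_const 1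
  have hd1 : ∀ x, ‖d x‖ ≤ 1 := fun x => by
    by_cases hx : x ∈ R
    · rw [hdR x hx, Real.norm_of_nonneg hD.le]; exact hD1
    · simp [hdR' x hx]
  have hdpos : ∀ x, 0 < d x := fun x => by
    by_cases hx : x ∈ R
    · rwa [hdR x hx]
    · simp [hdR' x hx]
  have hdint : ∀ {φ : Plane → ℝ}, Integrable φ (volume.restrict Ω) →
      Integrable (fun x => d x * φ x) (volume.restrict Ω) := fun hφ =>
    hφ.bdd_mul hdm.aestronglyMeasurable (ae_of_all _ hd1)
  have hsq : ∀ {f : Plane → Grad ℝ}, MemLp f 2 (volume.restrict Ω) →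
      Integrable (fun x => ‖f x‖ ^ 2) (volume.restrict Ω) := fun hf => by
    simpa only [real_inner_self_eq_norm_sq] using hf.integrable_inner_grad hf
  have hθ : MemLp (fun x => q x - w x) 2 (volume.restrict Ω) := hq.sub hw
  have i1 := hdint (hw.integrable_inner_grad hθ)
  have i2 := hG.integrable_inner_grad hθ
  have i3 : Integrable (fun x => d x * ‖G x - w x‖ ^ 2) (volume.restrict Ω) :=
    hdint (hsq (hG.sub hw))
  have i4 : Integrable (fun x => ‖G x - q x‖ ^ 2) (volume.restrict Ω) := hsq (hG.sub hq)
  -- the pointwise bound without the terms in `q - w`, whose integral vanishes by `hvar`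
  set X : Plane → ℝ := fun x =>
    R.indicator (fun x => 4 / D * ‖G x‖ ^ 2 + 5 / 2 * D * ‖G x - q x‖ ^ 2) x +
    Rᶜ.indicator (fun x => 4 * ‖G x - q x‖ ^ 2) x with hX
  have iX : Integrable X (volume.restrict Ω) :=
    ((((hsq hG).const_mul _).add (i4.const_mul _)).indicator hR).add
      ((i4.const_mul _).indicator hR.compl)
  have hX0 : ∀ x, 0 ≤ X x := fun x => by
    refine add_nonneg (Set.indicator_nonneg (fun x _ => by positivity) x)
      (Set.indicator_nonneg (fun x _ => by positivity) x)
  have hpt : ∀ x, d x * ‖G x - w x‖ ^ 2 ≤ X x +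
      2 * (inner ℝ (G x) (q x - w x) - d x * inner ℝ (w x) (q x - w x)) := by
    intro x
    by_cases hx : x ∈ R
    · have := energy_pointwise hD hD1 (G x) (w x) (q x)
      simpa [hX, hx, hdR x hx] using this
    · -- off the band `‖e‖² = ⟪e, η⟫ + ⟪e, q - w⟫`
      have h := inner_sub_right (𝕜 := ℝ) (G x - w x) (G x - w x) (G x - q x)
      have h1 : (G x - w x) - (G x - q x) = q x - w x := by abel
      rw [h1, inner_sub_left, real_inner_self_eq_norm_sq] at h
      have h2 := real_inner_le_norm (G x - w x) (G x - q x)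
      simp only [hX, hdR' x hx, Set.indicator_of_notMem hx,
        Set.indicator_of_mem (show x ∈ Rᶜ from hx)]
      nlinarith [sq_nonneg (‖G x - w x‖ / 2 - ‖G x - q x‖), sq_nonneg (‖G x - q x‖),
        sq_nonneg (‖G x - w x‖)]
  have hint : ∫ x in Ω, d x * ‖G x - w x‖ ^ 2 ≤ ∫ x in Ω, X x := by
    have h := integral_mono i3 (iX.add ((i2.sub i1).const_mul 2)) hpt
    have h' : ∫ x in Ω, (X + fun x => 2 * (inner ℝ (G x) (q x - w x) -
        d x * inner ℝ (w x) (q x - w x))) x = ∫ x in Ω, X x := by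
      have h0 := integral_sub i2 i1
      rw [hvar, sub_self] at h0
      have h1 := integral_add iX ((i2.sub i1).const_mul 2)
      rw [integral_const_mul] at h1
      refine h1.trans ?_
      simp only [Pi.sub_apply]
      rw [h0]
      simp
    exact h.trans_eq h'
  have hlin : ∫⁻ x in Ω, ENNReal.ofReal (d x * ‖G x - w x‖ ^ 2) ≤
      ∫⁻ x in Ω, ENNReal.ofReal (X x) := by
    rw [← ofReal_integral_eq_lintegral_ofReal i3 (ae_of_all _ fun x =>
      mul_nonneg (hdpos x).le (sq_nonneg _)),
      ← ofReal_integral_eq_lintegral_ofReal iX (ae_of_all _ hX0)]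
    exact ENNReal.ofReal_le_ofReal hint
  rw [← lintegral_inter_add_sdiff _ Ω hR,
    ← lintegral_inter_add_sdiff (fun x => ENNReal.ofReal (X x)) Ω hR] at hlin
  have hn : ∀ (a : ℝ) (z : Grad ℝ), 0 ≤ a →
      ENNReal.ofReal (a * ‖z‖ ^ 2) = ENNReal.ofReal a * ‖z‖ₑ ^ 2 := fun a z ha => by
    rw [ENNReal.ofReal_mul ha, ENNReal.ofReal_pow (norm_nonneg _), ofReal_norm]
  have e1 : ∫⁻ x in Ω ∩ R, ENNReal.ofReal (d x * ‖G x - w x‖ ^ 2) =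
      ENNReal.ofReal D * ∫⁻ x in Ω ∩ R, ‖G x - w x‖ₑ ^ 2 := by
    rw [← lintegral_const_mul' _ _ ENNReal.ofReal_ne_top]
    refine setLIntegral_congr_fun (hΩ.inter hR) fun x hx => ?_
    rw [hdR x hx.2, hn _ _ hD.le]
  have e2 : ∫⁻ x in Ω \ R, ENNReal.ofReal (d x * ‖G x - w x‖ ^ 2) =
      ∫⁻ x in Ω \ R, ‖G x - w x‖ₑ ^ 2 := by
    refine setLIntegral_congr_fun (hΩ.diff hR) fun x hx => ?_
    rw [hdR' x hx.2, hn _ _ zero_le_one, ENNReal.ofReal_one, one_mul]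
  have e3 : ∫⁻ x in Ω ∩ R, ENNReal.ofReal (X x) =
      ENNReal.ofReal (4 / D) * (∫⁻ x in Ω ∩ R, ‖G x‖ₑ ^ 2) +
          ENNReal.ofReal (5 / 2 * D) * (∫⁻ x in Ω ∩ R, ‖G x - q x‖ₑ ^ 2) := by
    rw [← lintegral_const_mul' _ _ ENNReal.ofReal_ne_top,
      ← lintegral_const_mul' _ _ ENNReal.ofReal_ne_top, ← lintegral_add_left']
    · refine setLIntegral_congr_fun (hΩ.inter hR) fun x hx => ?_
      simp only [hX, Set.indicator_of_mem hx.2,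
        Set.indicator_of_notMem (show x ∉ Rᶜ from fun h => h hx.2), add_zero]
      rw [ENNReal.ofReal_add (by positivity) (by positivity), hn _ _ (by positivity),
        hn _ _ (by positivity)]
    · exact ((hG.1.mono_measure (Measure.restrict_mono Set.inter_subset_left le_rfl)).enorm
        |>.pow_const 2).const_mul _
  have e4 : ∫⁻ x in Ω \ R, ENNReal.ofReal (X x) =
      ENNReal.ofReal 4 * ∫⁻ x in Ω \ R, ‖G x - q x‖ₑ ^ 2 := by
    rw [← lintegral_const_mul' _ _ ENNReal.ofReal_ne_top]
    refine setLIntegral_congr_fun (hΩ.diff hR) fun x hx => ?_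
    simp only [hX, Set.indicator_of_notMem hx.2,
      Set.indicator_of_mem (show x ∈ Rᶜ from hx.2), zero_add]
    exact hn _ _ (by norm_num)
  rw [e1, e2, e3, e4] at hlin
  rw [add_comm, add_comm (ENNReal.ofReal 4 * _)]
  exact hlin

end Energy

/-! ### Interpolation on the mesh -/

section MeshInterpolation

/-- A bounded-derivative function on `Ω`, replaced by another representative, on a subset of finite
measure: its derivatives there are those on `Ω`. -/
theorem MemW2.restrict_triangle {Ω K : Set Plane} (hΩ : IsOpen Ω) (hK : IsOpen K) (hKΩ : K ⊆ Ω)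
    (hfin : volume K ≠ ⊤) {u g : Plane → ℝ} (hu : MemW2 Ω ∞ u) (hug : u =ᵐ[volume.restrict Ω] g)
    (p : ℝ≥0∞) :
    MemW2 K p g ∧ weakGrad K g =ᵐ[volume.restrict K] weakGrad Ω u ∧
      weakHess K g =ᵐ[volume.restrict K] weakHess Ω u := by
  have : IsFiniteMeasure (volume.restrict K) := ⟨by simpa using hfin.lt_top⟩
  have hac : volume.restrict K ≤ volume.restrict Ω := Measure.restrict_mono hKΩ le_rfl
  have hLp : ∀ {E : Type} [NormedAddCommGroup E] {f f' : Plane → E},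
      MemLp f ∞ (volume.restrict Ω) → f' =ᵐ[volume.restrict K] f → MemLp f' p (volume.restrict K) :=
    fun hf hff => (memLp_congr_ae hff).mpr ((hf.mono_measure hac).mono_exponent le_top)
  have hugK : u =ᵐ[volume.restrict K] g := ae_mono hac hug
  have hG : IsWeakGrad K g (weakGrad Ω u) :=
    (hu.1.1.isWeakGrad.mono hΩ hKΩ).congr hugK (ae_eq_refl _)
  have hGae := hG.weakGrad_ae_eq hK
  have hH : IsWeakGrad K (weakGrad K g) (weakHess Ω u) :=
    (hu.2.1.isWeakGrad.mono hΩ hKΩ).congr hGae.symm (ae_eq_refl _)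
  have hHae := hH.weakGrad_ae_eq hK
  exact ⟨⟨⟨hG.hasWeakGrad, hLp hu.1.2.1 hugK.symm, hLp hu.1.2.2 hGae⟩, hH.hasWeakGrad,
    hLp hu.2.2 hHae⟩, hGae, hHae⟩

theorem region_ae_eq (B : Finset (Affine.Triangle ℝ Plane)) :
    region B =ᵐ[volume] ⋃ T ∈ B, interior T.closedInterior := by
  have h : ∀ᵐ x, ∀ T ∈ B, x ∈ T.closedInterior → x ∈ interior T.closedInterior :=
    (ae_ball_iff B.countable_toSet).mpr fun T _ => ae_mem_interior_of_mem T
  refine eventuallyEq_set.mpr ?_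
  filter_upwards [h] with x hx
  simp only [region, Set.mem_iUnion, exists_prop]
  exact ⟨fun ⟨T, hT, hxT⟩ => ⟨T, hT, hx T hT hxT⟩, fun ⟨T, hT, hxT⟩ => ⟨T, hT, interior_subset hxT⟩⟩

namespace TriMesh

variable (M : TriMesh)

theorem interior_subset_domain {T : Affine.Triangle ℝ Plane} (hT : T ∈ M.triangles) :
    interior T.closedInterior ⊆ M.domain :=
  interior_mono (closedInterior_subset_region hT)

theorem domain_inter_region_ae_eq {B : Finset (Affine.Triangle ℝ Plane)} (hB : B ⊆ M.triangles) :
    (M.domain ∩ region B : Set Plane) =ᵐ[volume] region B := by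
  refine eventuallyEq_set.mpr ?_
  filter_upwards [eventuallyEq_set.mp (region_ae_eq B)] with x hx
  refine ⟨fun h => h.2, fun h => ⟨?_, h⟩⟩
  have := hx.mp h
  simp only [Set.mem_iUnion, exists_prop] at this
  obtain ⟨T, hT, hxT⟩ := this
  exact M.interior_subset_domain (hB hT) hxT

open Classical in
theorem domain_diff_region_ae_eq {B : Finset (Affine.Triangle ℝ Plane)} (hB : B ⊆ M.triangles) :
    (M.domain \ region B : Set Plane) =ᵐ[volume]
      ⋃ T ∈ M.triangles \ B, interior T.closedInterior := by
  have h : ∀ᵐ x, ∀ T ∈ M.triangles, x ∈ T.closedInterior → x ∈ interior T.closedInterior :=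
    (ae_ball_iff M.triangles.countable_toSet).mpr fun T _ => ae_mem_interior_of_mem T
  refine eventuallyEq_set.mpr ?_
  filter_upwards [h] with x hx
  simp only [Set.mem_sdiff, region, Set.mem_iUnion, exists_prop, Finset.mem_sdiff,
    not_exists, not_and]
  constructor
  · rintro ⟨hxΩ, hxB⟩
    have := interior_subset hxΩ
    simp only [region, Set.mem_iUnion, exists_prop] at this
    obtain ⟨T, hT, hxT⟩ := this
    exact ⟨T, ⟨hT, fun hTB => hxB T hTB hxT⟩, hx T hT hxT⟩
  · rintro ⟨T, ⟨hT, hTB⟩, hxT⟩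
    refine ⟨M.interior_subset_domain hT hxT, fun S hS hxS => ?_⟩
    have hne : S ≠ T := by rintro rfl; exact hTB hS
    exact Set.disjoint_left.mp (M.disjoint_interior S (hB hS) T hT hne) (hx S (hB hS) hxS) hxT

theorem lintegral_biUnion_interior {E : Finset (Affine.Triangle ℝ Plane)} (hE : E ⊆ M.triangles)
    (f : Plane → ℝ≥0∞) :
    ∫⁻ x in ⋃ T ∈ E, interior T.closedInterior, f x =
      ∑ T ∈ E, ∫⁻ x in interior T.closedInterior, f x :=
  lintegral_biUnion_finset (fun S hS T hT hST => M.disjoint_interior S (hE hS) T (hE hT) hST)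
    (fun _ _ => isOpen_interior.measurableSet) f

/-- The interpolation error of the representative `g` of `u` on one triangle, in terms of the
derivatives of `u` on the whole domain. -/
theorem seminorm1_sub_nodalAffine_eq {u g : Plane → ℝ}
    (hu : MemW2 M.domain ∞ u)
    (hug : u =ᵐ[volume.restrict M.domain] g) {T : Affine.Triangle ℝ Plane} (hT : T ∈ M.triangles)
    (p : ℝ≥0∞) :
    MemW2 (interior T.closedInterior) p g ∧
    seminorm1 (interior T.closedInterior) (interior T.closedInterior) p
        (fun x => g x - nodalAffine T g x) =
      eLpNorm (fun x => weakGrad M.domain u x - classicalGrad (M.nodalInterpolant g) x) p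
        (volume.restrict (interior T.closedInterior)) ∧
    seminorm2 (interior T.closedInterior) (interior T.closedInterior) p g =
      eLpNorm (weakHess M.domain u) p (volume.restrict (interior T.closedInterior)) := by
  have hK : IsOpen (interior T.closedInterior) := isOpen_interior
  have hfin : volume (interior T.closedInterior) ≠ ⊤ :=
    ((measure_mono interior_subset).trans_lt T.isCompact_closedInterior.measure_lt_top).ne
  obtain ⟨h1, h2, h3⟩ := hu.restrict_triangle (Ω := M.domain) isOpen_interior hK
    (M.interior_subset_domain hT) hfin hug p
  refine ⟨h1, ?_, eLpNorm_congr_ae h3⟩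
  refine eLpNorm_congr_ae ?_
  filter_upwards [(h1.1.1.isWeakGrad.sub (nodalAffine T g).isWeakGrad).weakGrad_ae_eq hK, h2,
    ae_restrict_mem hK.measurableSet] with x hx1 hx2 hx3
  rw [hx1, hx2, classicalGrad_congr (M.nodalInterpolant_eventuallyEq hT hx3),
    AffineMap.classicalGrad_eq]

end TriMesh

end MeshInterpolation

/-! ### The error of the tempered method -/

section ErrorEstimate

theorem setLIntegral_enorm_sq_le {E : Type*} [NormedAddCommGroup E] {S : Set Plane}
    {f : Plane → E} {c : ℝ≥0∞} (h : ∀ᵐ x ∂volume.restrict S, ‖f x‖ₑ ≤ c) :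
    ∫⁻ x in S, ‖f x‖ₑ ^ 2 ≤ volume S * c ^ 2 := by
  calc ∫⁻ x in S, ‖f x‖ₑ ^ 2 ≤ ∫⁻ _ in S, c ^ 2 := by
        refine lintegral_mono_ae ?_
        filter_upwards [h] with x hx
        gcongr
    _ = volume S * c ^ 2 := by rw [setLIntegral_const, mul_comm]

namespace TriMesh

variable (M : TriMesh) {B : Finset (Affine.Triangle ℝ Plane)} {u g : Plane → ℝ} {h : ℝ}

open Classical in
/-- Off the band the maximum angle estimate is summed over the triangles. -/
theorem lintegral_interpolation_error_off_band {α C : ℝ} (hC : IsMaxAngleConstant α C)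
    (hB : B ⊆ M.triangles) (hα : ∀ T ∈ M.triangles, T ∉ B → AnglesLE T α)
    (hh : ∀ T ∈ M.triangles, Metric.diam T.closedInterior ≤ h) (hu : MemW2 M.domain ∞ u)
    (hg : Continuous g) (hug : u =ᵐ[volume.restrict M.domain] g) :
    ∫⁻ x in M.domain \ region B,
        ‖weakGrad M.domain u x - classicalGrad (M.nodalInterpolant g) x‖ₑ ^ 2 ≤
      ENNReal.ofReal (C ^ 2 * h ^ 2) * (seminorm2 M.domain (M.domain \ region B) 2 u) ^ 2 := by
  have hE : M.triangles \ B ⊆ M.triangles := Finset.sdiff_subset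
  rw [seminorm2, eLpNorm_two_sq, Measure.restrict_congr_set (M.domain_diff_region_ae_eq hB),
    M.lintegral_biUnion_interior hE, M.lintegral_biUnion_interior hE, Finset.mul_sum]
  refine Finset.sum_le_sum fun T hT => ?_
  obtain ⟨hTM, hTB⟩ := Finset.mem_sdiff.mp hT
  obtain ⟨h1, h2, h3⟩ := M.seminorm1_sub_nodalAffine_eq hu hug hTM 2
  have hK := hC T g (nodalAffine T g) (hα T hTM hTB) hg.continuousOn h1
    (nodalAffine_isInterpolant T g)
  rw [h2, h3] at hK
  rw [← eLpNorm_two_sq, ← eLpNorm_two_sq]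
  have hd : (0 : ℝ) ≤ Metric.diam T.closedInterior := Metric.diam_nonneg
  have hc : ENNReal.ofReal (C * Metric.diam T.closedInterior) ^ 2 ≤
      ENNReal.ofReal (C ^ 2 * h ^ 2) := by
    -- neither `C` nor `h` is assumed to be nonnegative
    have hle : C * Metric.diam T.closedInterior ≤ |C| * h :=
      mul_le_mul (le_abs_self C) (hh T hTM) hd (abs_nonneg C)
    have h0 : 0 ≤ |C| * h := mul_nonneg (abs_nonneg C) (hd.trans (hh T hTM))
    calc ENNReal.ofReal (C * Metric.diam T.closedInterior) ^ 2
        ≤ ENNReal.ofReal (|C| * h) ^ 2 := by gcongr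
      _ = ENNReal.ofReal (C ^ 2 * h ^ 2) := by
        rw [← ENNReal.ofReal_pow h0, mul_pow, sq_abs]
  calc _ ≤ (ENNReal.ofReal (C * Metric.diam T.closedInterior) *
        eLpNorm (weakHess M.domain u) 2 (volume.restrict (interior T.closedInterior))) ^ 2 := by
        gcongr
    _ ≤ _ := by
        rw [mul_pow]
        gcongr

/-- On the band the circumradius estimate is used pointwise almost everywhere, the circumradius
being bounded in terms of the diameter and of the altitudes. -/
theorem lintegral_interpolation_error_on_band {C hbar : ℝ} (hC : IsCircumradiusConstant C)
    (hB : B ⊆ M.triangles) (hh : ∀ T ∈ M.triangles, Metric.diam T.closedInterior ≤ h)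
    (hbar0 : 0 < hbar) (hheight : ∀ T ∈ B, ∀ i, hbar ≤ T.height i) (hu : MemW2 M.domain ∞ u)
    (hg : Continuous g) (hug : u =ᵐ[volume.restrict M.domain] g) :
    ∫⁻ x in region B,
        ‖weakGrad M.domain u x - classicalGrad (M.nodalInterpolant g) x‖ₑ ^ 2 ≤
      volume (region B) *
        (ENNReal.ofReal (|C| * (h ^ 2 / (2 * hbar))) * seminorm2 M.domain (region B) ∞ u) ^ 2 := by
  refine setLIntegral_enorm_sq_le ?_
  rw [Measure.restrict_congr_set (region_ae_eq B), ae_restrict_biUnion_finset_iff]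
  intro T hT
  have hTM := hB hT
  obtain ⟨h1, h2, h3⟩ := M.seminorm1_sub_nodalAffine_eq hu hug hTM ∞
  have hK := hC T g (nodalAffine T g) hg.continuousOn h1 (nodalAffine_isInterpolant T g)
  rw [h2, h3] at hK
  have hle : C * T.circumradius ≤ |C| * (h ^ 2 / (2 * hbar)) :=
    mul_le_mul (le_abs_self C) (circumradius_le_of_height T hbar0 (hh T hTM) (hheight T hT))
      T.circumradius_nonneg (abs_nonneg C)
  have hsub : interior T.closedInterior ⊆ region B :=
    interior_subset.trans (closedInterior_subset_region hT)
  have hbound := hK.trans (mul_le_mul' (ENNReal.ofReal_le_ofReal hle)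
    (eLpNorm_mono_measure (weakHess M.domain u) (Measure.restrict_mono hsub le_rfl)))
  rw [eLpNorm_exponent_top] at hbound
  filter_upwards [ae_le_eLpNormEssSup (f := fun x => weakGrad M.domain u x -
    classicalGrad (M.nodalInterpolant g) x)
    (μ := volume.restrict (interior T.closedInterior))] with x hx
  exact hx.trans hbound

end TriMesh

end ErrorEstimate

theorem mainTheorem2 :
    (∃ C_c : ℝ, 0 < C_c ∧ IsCircumradiusConstant C_c) ∧
    (∀ α₀ : ℝ, α₀ < Real.pi → ∃ C_I : ℝ, 0 < C_I ∧ IsMaxAngleConstant α₀ C_I) ∧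
    ∀ (α₀ C_c C_I : ℝ), α₀ < Real.pi → IsCircumradiusConstant C_c → IsMaxAngleConstant α₀ C_I →
      ∀ (M : TriMesh) (B : Finset (Affine.Triangle ℝ Plane)) (h hbar D : ℝ) (f u w : Plane → ℝ),
        B ⊆ M.triangles →
        -- all elements outside the band satisfy the maximum angle condition
        (∀ T ∈ M.triangles, T ∉ B → AnglesLE T α₀) →
        -- the elements have size at most `h`, and the band elements have altitudes at least `hbar`
        (∀ T ∈ M.triangles, Metric.diam T.closedInterior ≤ h) →
        0 < hbar → (∀ T ∈ B, ∀ i, hbar ≤ T.height i) →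
        0 < D → D ≤ 1 →
        MemLp f 2 (volume.restrict M.domain) →
        IsWeakPoissonSolution M.domain f u →
        MemW2 M.domain ∞ u →
        M.IsTFEMSolution B D f w →
        (seminorm1 M.domain (M.domain \ region B) 2 (fun x => u x - w x)) ^ 2 +
            ENNReal.ofReal D * (seminorm1 M.domain (region B) 2 (fun x => u x - w x)) ^ 2 ≤
          ENNReal.ofReal (4 * C_I ^ 2 * h ^ 2) *
              (seminorm2 M.domain (M.domain \ region B) 2 u) ^ 2 +
            ENNReal.ofReal (4 / D) * volume (region B) *
              (seminorm1 M.domain (region B) ∞ u) ^ 2 +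
            ENNReal.ofReal (6 * D * C_c ^ 2 * (h ^ 4 / hbar ^ 2)) * volume (region B) *
              (seminorm2 M.domain (region B) ∞ u) ^ 2 := by
  refine ⟨exists_isCircumradiusConstant, fun α hα => exists_isMaxAngleConstant hα, ?_⟩
  intro α₀ C_c C_I _ hCc hCI M B h hbar D f u w hB hα hh hbar0 hheight hD hD1 _ hu hu2 hw
  have hΩ : IsOpen M.domain := isOpen_interior
  have hfin : volume M.domain ≠ ⊤ := M.domain_isBounded.measure_lt_top.ne
  obtain ⟨L, g, hgL, hug, hg0⟩ :=
    MemH10.exists_lipschitz (isCompact_region M.triangles) hu.1 hu2.1.2.2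
  have hIV := M.nodalInterpolant_memV hg0
  obtain ⟨L', hL'⟩ := M.exists_lipschitzWith_nodalInterpolant hg0
  have hIG : IsWeakGrad M.domain (M.nodalInterpolant g) (classicalGrad (M.nodalInterpolant g)) :=
    hL'.isWeakGrad
  have hwG : IsWeakGrad M.domain w (weakGrad M.domain w) := hw.1.2.1.1.isWeakGrad
  have huG : IsWeakGrad M.domain u (weakGrad M.domain u) := hu.1.1.1.isWeakGrad
  -- the test function is the difference of the interpolant and the discrete solution
  set θ : Plane → ℝ := fun x => M.nodalInterpolant g x - w x with hθ
  have hθV : M.MemV θ := by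
    refine ⟨⟨hIV.1.1.sub hw.1.1.1, fun T hT => ?_⟩, hIV.2.sub hΩ hw.1.2⟩
    obtain ⟨q₁, hq₁⟩ := hIV.1.2 T hT
    obtain ⟨q₂, hq₂⟩ := hw.1.1.2 T hT
    exact ⟨q₁ - q₂, fun x hx => by simp [hθ, hq₁ x hx, hq₂ x hx]⟩
  have hθG := (hIG.sub hwG).weakGrad_ae_eq hΩ
  have heG := (huG.sub hwG).weakGrad_ae_eq hΩ
  have hvar : ∫ x in M.domain, temperedCoeff B D x * inner ℝ (weakGrad M.domain w x)
        (classicalGrad (M.nodalInterpolant g) x - weakGrad M.domain w x) =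
      ∫ x in M.domain, inner ℝ (weakGrad M.domain u x)
        (classicalGrad (M.nodalInterpolant g) x - weakGrad M.domain w x) := by
    refine Eq.trans ?_ (((hw.2 θ hθV).trans (hu.2 θ hθV.2).symm).trans ?_)
    · refine integral_congr_ae ?_
      filter_upwards [hθG] with x hx
      rw [hx]
    · refine integral_congr_ae ?_
      filter_upwards [hθG] with x hx
      rw [hx]
  have hRm : MeasurableSet (region B) := (isClosed_region B).measurableSet
  have hq2 : MemLp (classicalGrad (M.nodalInterpolant g)) 2 (volume.restrict M.domain) :=
    (memLp_congr_ae (hIG.weakGrad_ae_eq hΩ)).mp hIV.2.1.2.2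
  have key := energy_le hRm hΩ.measurableSet hD hD1 hu.1.1.2.2 hw.1.2.1.2.2 hq2
    (d := temperedCoeff B D) (fun x hx => by simp [temperedCoeff, hx])
    (fun x hx => by simp [temperedCoeff, hx]) hvar
  rw [Measure.restrict_congr_set (M.domain_inter_region_ae_eq hB)] at key
  have l1 : (seminorm1 M.domain (M.domain \ region B) 2 (fun x => u x - w x)) ^ 2 =
      ∫⁻ x in M.domain \ region B, ‖weakGrad M.domain u x - weakGrad M.domain w x‖ₑ ^ 2 := by
    rw [seminorm1, eLpNorm_two_sq]
    refine lintegral_congr_ae ?_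
    filter_upwards [ae_mono (Measure.restrict_mono Set.sdiff_subset le_rfl) heG] with x hx
    rw [hx]
  have l2 : (seminorm1 M.domain (region B) 2 (fun x => u x - w x)) ^ 2 =
      ∫⁻ x in region B, ‖weakGrad M.domain u x - weakGrad M.domain w x‖ₑ ^ 2 := by
    rw [seminorm1, eLpNorm_two_sq,
      ← Measure.restrict_congr_set (M.domain_inter_region_ae_eq hB)]
    refine lintegral_congr_ae ?_
    filter_upwards [ae_mono (Measure.restrict_mono Set.inter_subset_left le_rfl) heG] with x hx
    rw [hx]
  rw [l1, l2]
  refine key.trans ?_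
  have r1 := M.lintegral_interpolation_error_off_band hCI hB hα hh hu2 hgL.continuous hug
  have r2 : ∫⁻ x in region B, ‖weakGrad M.domain u x‖ₑ ^ 2 ≤
      volume (region B) * (seminorm1 M.domain (region B) ∞ u) ^ 2 := by
    refine setLIntegral_enorm_sq_le ?_
    rw [seminorm1, eLpNorm_exponent_top]
    exact ae_le_eLpNormEssSup
  have r3 := M.lintegral_interpolation_error_on_band hCc hB hh hbar0 hheight hu2 hgL.continuous hug
  have c1 : ENNReal.ofReal 4 * ENNReal.ofReal (C_I ^ 2 * h ^ 2) =
      ENNReal.ofReal (4 * C_I ^ 2 * h ^ 2) := by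
    rw [← ENNReal.ofReal_mul (by norm_num), mul_assoc]
  have c3 : ENNReal.ofReal (5 / 2 * D) * ENNReal.ofReal (|C_c| * (h ^ 2 / (2 * hbar))) ^ 2 ≤
      ENNReal.ofReal (6 * D * C_c ^ 2 * (h ^ 4 / hbar ^ 2)) := by
    rw [← ENNReal.ofReal_pow (by positivity), ← ENNReal.ofReal_mul (by positivity)]
    refine ENNReal.ofReal_le_ofReal ?_
    have e : 5 / 2 * D * (|C_c| * (h ^ 2 / (2 * hbar))) ^ 2 =
        5 / 8 * (D * C_c ^ 2 * (h ^ 4 / hbar ^ 2)) := by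
      rw [mul_pow, sq_abs]
      field_simp
      ring
    have h0 : 0 ≤ D * C_c ^ 2 * (h ^ 4 / hbar ^ 2) := by positivity
    rw [e]
    linarith
  rw [add_assoc]
  refine add_le_add ?_ (add_le_add ?_ ?_)
  · rw [← c1, mul_assoc]
    gcongr
  · rw [mul_assoc]
    gcongr
  · calc _ ≤ ENNReal.ofReal (5 / 2 * D) * (volume (region B) *
          (ENNReal.ofReal (|C_c| * (h ^ 2 / (2 * hbar))) *
            seminorm2 M.domain (region B) ∞ u) ^ 2) := by gcongr
      _ = ENNReal.ofReal (5 / 2 * D) * ENNReal.ofReal (|C_c| * (h ^ 2 / (2 * hbar))) ^ 2 *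
          volume (region B) * (seminorm2 M.domain (region B) ∞ u) ^ 2 := by ring
      _ ≤ _ := by gcongr
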